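/- Let $Q$ be a probability distribution on the real line with $$\int x\,Q(dx)=0,\qquad \int x^2\,Q(dx)=\tfrac12,\qquad b:=\int x^4\,Q(dx)<\infty .$$ Let $(X_{ii}/\sqrt2)_{i\in\mathbb N}$, $(X^{\mathrm{Re}}_{ij})_{i<j}$ and $(X^{\mathrm{Im}}_{ij})_{i<j}$ ($i,j\in\mathbb N$) be independent families of independent real random variables with distribution $Q$ on some probability space. For $i<j$ put $X_{ij}:=X^{\mathrm{Re}}_{ij}+\mathbf i X^{\mathrm{Im}}_{ij}$ and $X_{ji}:=X^{\mathrm{Re}}_{ij}-\mathbf i X^{\mathrm{Im}}_{ij}$. Let $X_N:=(X_{ij})_{1\le i,j\le N}$ be the Hermitian Wigner matrix of size $N\times N$, and for $\mu,\nu\in\mathbb C$ let $$f(N;\mu,\nu):=\mathbb E\bigl(\det(X_N-\mu I_N)\cdot\det(X_N-\nu I_N)\bigr),$$ where $I_N$ is the $N\times N$ identity matrix. Then the expectation defining $f(N;\mu,\nu)$ exists (the product of determinants is integrable) for all $N$ and all $\mu,\nu\in\mathbb C$. Moreover, for every sequence $(\xi_N)_{N\in\mathbb N}$ of real numbers with $\lim_{N\to\infty}\xi_N/\sqrt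 N=\xi$ for some $\xi\in(-2,2)$, and for every $\eta\in\mathbb C$, $$\lim_{N\to\infty}\sqrt{\frac{2\pi}{N}}\cdot\frac1{N!}\cdot e^{-\xi_N^2/2}\cdot f\Bigl(N;\xi_N+\frac{\eta}{\sqrt N},\,\xi_N-\frac{\eta}{\sqrt N}\Bigr)=\exp\bigl(b-\tfrac34\bigr)\cdot\sqrt{4-\xi^2}\cdot\frac{\sin\bigl(\sqrt{4-\xi^2}\,\eta\bigr)}{\sqrt{4-\xi^2}\,\eta},$$ where $\sin 0/0:=1$. -/

import Mathlib

open MeasureTheory ProbabilityTheory Filter Topology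

noncomputable section

/-- Labels of the real random variables from which a Hermitian Wigner matrix is built:
one for each diagonal position `(i, i)`, and two (real and imaginary part) for each position
`(i, j)` with `i < j`.  Rows and columns are numbered `0, 1, 2, …`. -/
inductive WignerLabel : Type
  | diag (i : ℕ) : WignerLabel
  | re (i j : ℕ) (h : i < j) : WignerLabel
  | im (i j : ℕ) (h : i < j) : WignerLabel

/-- The three families of real random variables `d i` (which is `X_ii / √2`), `u i j`
(which is `Re X_ij`, `i < j`) and `v i j` (which is `Im X_ij`, `i < j`) as one family.
The values of `u i j` and `v i j` for `i ≥ j` are never used. -/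
def wignerFamily {Ω : Type*} (d : ℕ → Ω → ℝ) (u v : ℕ → ℕ → Ω → ℝ) : WignerLabel → Ω → ℝ
  | .diag i => d i
  | .re i j _ => u i j
  | .im i j _ => v i j

/-- All the variables `d i`, `u i j`, `v i j` (`i < j`) are random variables on `(Ω, P)` with
distribution `Q`, and they are jointly independent. -/
structure IsWignerFamily {Ω : Type*} [MeasurableSpace Ω] (Q : Measure ℝ) (P : Measure Ω)
    (d : ℕ → Ω → ℝ) (u v : ℕ → ℕ → Ω → ℝ) : Prop where
  measurable : ∀ k, Measurable (wignerFamily d u v k)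
  law : ∀ k, P.map (wignerFamily d u v k) = Q
  indep : iIndepFun (wignerFamily d u v) P

/-- The entry `X_ij` of the Wigner matrix: `X_ii = √2 · d i`, `X_ij = u i j + 𝐢 v i j` and
`X_ji = u i j - 𝐢 v i j` for `i < j`. -/
def wignerEntry {Ω : Type*} (d : ℕ → Ω → ℝ) (u v : ℕ → ℕ → Ω → ℝ) (i j : ℕ) (ω : Ω) : ℂ :=
  if i = j then ((√2 * d i ω : ℝ) : ℂ)
  else if i < j then (u i j ω : ℂ) + Complex.I * (v i j ω : ℂ)
  else (u j i ω : ℂ) - Complex.I * (v j i ω : ℂ)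

/-- The `N × N` Wigner matrix `X_N`. -/
def wignerMatrix {Ω : Type*} (d : ℕ → Ω → ℝ) (u v : ℕ → ℕ → Ω → ℝ) (N : ℕ) (ω : Ω) :
    Matrix (Fin N) (Fin N) ℂ :=
  Matrix.of fun i j => wignerEntry d u v i j ω

/-- The product `det (X_N - μ I) · det (X_N - ν I)`. -/
def charPolyProd {Ω : Type*} (d : ℕ → Ω → ℝ) (u v : ℕ → ℕ → Ω → ℝ) (N : ℕ) (μ ν : ℂ) (ω : Ω) :
    ℂ :=
  (wignerMatrix d u v N ω - μ • (1 : Matrix (Fin N) (Fin N) ℂ)).det *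
    (wignerMatrix d u v N ω - ν • (1 : Matrix (Fin N) (Fin N) ℂ)).det

/-- The second-order correlation function of the characteristic polynomial,
`f(N; μ, ν) = 𝔼 (det (X_N - μ I) · det (X_N - ν I))`, for complex `μ, ν`. -/
def corrFun {Ω : Type*} [MeasurableSpace Ω] (P : Measure Ω)
    (d : ℕ → Ω → ℝ) (u v : ℕ → ℕ → Ω → ℝ) (N : ℕ) (μ ν : ℂ) : ℂ :=
  ∫ ω, charPolyProd d u v N μ ν ω ∂P

/-- `sin z / z` for complex `z`, with the value `1` at `z = 0`. -/
def complexSinc (z : ℂ) : ℂ := if z = 0 then 1 else Complex.sin z / z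

end

/-! The proof has an algebraic half, which produces an exact generating function, and an analytic
half, which extracts its coefficients.

Write `f N` for the correlation function as a function of `μ, ν`. Border `X_N` by its last row and
column. Schur's formula (`det_fromBlocks_sub`) makes `det (X_{N+1} - μ)` a quadratic form in the new
column, with the adjugate of `X_N - μ` as matrix. The new column is independent of the block, so the
expectation of a product of two such determinants needs only its mixed moments of order four. These
are the complex Gaussian pairings plus a correction `2b - 3/2` when all indices agree
(`integral_col_four`).

Every resulting expectation is again expressed by `f`. Traces of adjugates are derivatives in `μ`
and `ν` by Jacobi's formula. The trace of a product of two adjugates is a difference quotient by the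
resolvent identity (`smul_adjugate_mul_adjugate`). The diagonal cofactors are determinants of a
Wigner matrix of size `N - 1`. This gives `f (N+1) = (1 + μν) f N - μ ∂_ν f N - ν ∂_μ f N + ∂_μ ∂_ν
f N + (∂_ν f N - ∂_μ f N) / (μ - ν) + (2b - 3/2) N f (N-1)`, and together with `f 0 = 1` it
determines `f` (`corrFun_eq`). The numbers `N! [z^N] corrGenFun β μ ν z` with `β = b - 3/4` solve
it, so `f N` is a Cauchy integral of `corrGenFun` over a circle (`corrFun_eq_circleCoeff`).

For `μ, ν = x ± η/√N` the factor `e^{-x²/2}` combines with the exponent into `-(x²/2)(1-z)/(1+z) -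
(η²/N) z/(1-z) + β z²`. On the circle of radius `1 - 1/N` the first term has nonpositive real part
and the second is bounded, so the bound `norm_coeffIntegrand_le` is uniform in `x`. The singularity
`(1-z)^{-3/2}` dominates: with `θ = t/N` and `s = 1 - i t` one has `N(1-z) → s` and `z^{-N} → e^s`.
By dominated convergence the half circle around `1` tends to a multiple of `∫ exp (κ s - η²/s)
s^{-3/2}` with `κ = 1 - ξ²/4`. The half around `-1`, where the singularity is only `(1+z)^{-1/2}`,
vanishes in the limit. Expanding `exp (-η²/s)` and inverting the Laplace transform termwise yields
the sine kernel (`integral_cexp_sub_div_mul_cpow`). -/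

noncomputable section

/-! ### Determinants and adjugates of shifted matrices. -/

section MatrixAlgebra

variable {n : Type*} [Fintype n] [DecidableEq n]

/-- Jacobi's formula, by differentiating the Leibniz expansion: replacing the factor of column `i`
by the derivative of its entry yields a cofactor. It is what turns traces of adjugates into
derivatives of the correlation function. -/
theorem hasDerivAt_det_sub_smul_one (X : Matrix n n ℂ) (μ : ℂ) :
    HasDerivAt (fun μ : ℂ => (X - μ • (1 : Matrix n n ℂ)).det)
      (-(X - μ • (1 : Matrix n n ℂ)).adjugate.trace) μ := by
  have h1 : ∀ i j, HasDerivAt (fun μ : ℂ => (X - μ • (1 : Matrix n n ℂ)) i j)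
      (-(1 : Matrix n n ℂ) i j) μ := by
    intro i j
    simpa using ((hasDerivAt_id μ).mul_const ((1 : Matrix n n ℂ) i j)).const_sub (X i j)
  have h2 : HasDerivAt (fun μ : ℂ => (X - μ • (1 : Matrix n n ℂ)).det)
      (∑ σ : Equiv.Perm n, (Equiv.Perm.sign σ : ℤ) • ∑ i, (∏ j ∈ Finset.univ.erase i,
        (X - μ • (1 : Matrix n n ℂ)) (σ j) j) • (-(1 : Matrix n n ℂ) (σ i) i)) μ := by
    simp_rw [Matrix.det_apply]
    refine HasDerivAt.fun_sum fun σ _ => ?_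
    refine HasDerivAt.const_smul _ ?_
    exact HasDerivAt.fun_finsetProd fun i _ => h1 _ _
  convert h2 using 1
  rw [Matrix.trace]
  simp_rw [Finset.smul_sum]
  rw [Finset.sum_comm, ← Finset.sum_neg_distrib]
  refine Finset.sum_congr rfl fun i _ => ?_
  set A := X - μ • (1 : Matrix n n ℂ)
  have h3 : A.adjugate i i = (A.updateCol i (Pi.single i 1)).det := by
    rw [← Matrix.transpose_apply A.adjugate, Matrix.adjugate_transpose, Matrix.adjugate_apply,
      Matrix.updateRow_transpose, Matrix.det_transpose]
  rw [Matrix.diag_apply, h3, Matrix.det_apply, ← Finset.sum_neg_distrib]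
  refine Finset.sum_congr rfl fun σ _ => ?_
  rw [← smul_neg]
  congr 1
  rw [← Finset.mul_prod_erase _ _ (Finset.mem_univ i), Matrix.updateCol_self, smul_eq_mul,
    mul_comm, Matrix.one_apply, Pi.single_apply, mul_neg]
  congr 2
  refine Finset.prod_congr rfl fun j hj => ?_
  rw [Matrix.updateCol_ne (Finset.ne_of_mem_erase hj)]

/-- For invertible `X - μ` this is the Schur complement formula. Both sides are continuous in `μ`,
and invertibility fails only at the finitely many eigenvalues, so the identity extends to all `μ`.
-/
theorem det_fromBlocks_sub (X : Matrix n n ℂ) (c r : n → ℂ) (x μ : ℂ) :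
    (Matrix.fromBlocks (X - μ • (1 : Matrix n n ℂ)) (Matrix.of fun i (_ : Unit) => c i)
      (Matrix.of fun (_ : Unit) j => r j) (Matrix.of fun _ _ => x - μ)).det =
    (x - μ) * (X - μ • (1 : Matrix n n ℂ)).det -
      ∑ i, ∑ j, r i * c j * (X - μ • (1 : Matrix n n ℂ)).adjugate i j := by
  set F : ℂ → Matrix n n ℂ := fun μ => X - μ • (1 : Matrix n n ℂ) with hF
  have hFc : Continuous F := by fun_prop
  suffices h : (fun μ => (Matrix.fromBlocks (F μ) (Matrix.of fun i (_ : Unit) => c i)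
      (Matrix.of fun (_ : Unit) j => r j) (Matrix.of fun _ _ => x - μ)).det) =
      fun μ => (x - μ) * (F μ).det - ∑ i, ∑ j, r i * c j * (F μ).adjugate i j from
    congrFun h μ
  have hd : Dense {μ : ℂ | (F μ).det ≠ 0} := by
    have hfin : {μ : ℂ | (F μ).det = 0}.Finite := by
      refine (X.charpoly.roots.toFinset.finite_toSet).subset fun μ hμ => ?_
      simp only [Finset.mem_coe, Multiset.mem_toFinset]
      rw [Polynomial.mem_roots (Matrix.charpoly_monic X).ne_zero, Polynomial.IsRoot,
        Matrix.eval_charpoly]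
      have h0 : Matrix.scalar n μ - X = -(F μ) := by
        simp [hF, Matrix.smul_one_eq_diagonal]
      rw [h0, Matrix.det_neg]
      have : (F μ).det = 0 := hμ
      simp [this]
    exact hfin.countable.dense_compl ℝ
  refine Continuous.ext_on hd ?_ ?_ ?_
  · refine Continuous.matrix_det ?_
    exact Continuous.matrix_fromBlocks hFc continuous_const continuous_const
      (continuous_pi fun _ => continuous_pi fun _ => by simpa using continuous_sub_left x)
  · have h1 : Continuous fun μ => (F μ).det := hFc.matrix_det
    have h2 : ∀ i j, Continuous fun μ => (F μ).adjugate i j := fun i j =>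
      hFc.matrix_adjugate.matrix_elem i j
    fun_prop
  · intro μ hμ
    have hu : IsUnit (F μ).det := isUnit_iff_ne_zero.mpr hμ
    let _ := (F μ).invertibleOfIsUnitDet hu
    simp only
    rw [Matrix.det_fromBlocks₁₁, Matrix.det_unique (n := Unit), mul_comm]
    have hinv : ∀ i j, (F μ).adjugate i j = (F μ).det * (⅟(F μ)) i j := by
      intro i j
      rw [Matrix.invOf_eq_nonsing_inv, Matrix.inv_def, Matrix.smul_apply, smul_eq_mul,
        Ring.inverse_eq_inv', mul_inv_cancel_left₀ hμ]
    simp_rw [hinv]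
    simp only [Matrix.sub_apply, Matrix.mul_apply, Matrix.of_apply, sub_mul, Finset.sum_mul]
    congr 1
    rw [Finset.sum_comm]
    refine Finset.sum_congr rfl fun i _ => Finset.sum_congr rfl fun j _ => ?_
    ring

/-- The resolvent identity with denominators cleared, hence valid at eigenvalues too. -/
theorem smul_adjugate_mul_adjugate (X : Matrix n n ℂ) (μ ν : ℂ) :
    (μ - ν) • ((X - μ • (1 : Matrix n n ℂ)).adjugate * (X - ν • (1 : Matrix n n ℂ)).adjugate) =
    (X - ν • (1 : Matrix n n ℂ)).det • (X - μ • (1 : Matrix n n ℂ)).adjugate -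
    (X - μ • (1 : Matrix n n ℂ)).det • (X - ν • (1 : Matrix n n ℂ)).adjugate := by
  set A := X - μ • (1 : Matrix n n ℂ)
  set B := X - ν • (1 : Matrix n n ℂ)
  have h : (μ - ν) • (1 : Matrix n n ℂ) = B - A := by simp [A, B, sub_smul]
  calc (μ - ν) • (A.adjugate * B.adjugate)
      = A.adjugate * ((μ - ν) • (1 : Matrix n n ℂ)) * B.adjugate := by simp
    _ = A.adjugate * (B * B.adjugate) - (A.adjugate * A) * B.adjugate := by
        rw [h]; noncomm_ring
    _ = _ := by rw [Matrix.mul_adjugate, Matrix.adjugate_mul]; simp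

/-- The bound is deliberately crude: a product over all entries factors along independent variables,
so its moments are easy to control. -/
theorem norm_det_le (M : Matrix n n ℂ) :
    ‖M.det‖ ≤ (Fintype.card n).factorial * ∏ i, ∏ j, (1 + ‖M i j‖) := by
  rw [Matrix.det_apply]
  refine (norm_sum_le _ _).trans ?_
  have h : ∀ σ : Equiv.Perm n, ‖Equiv.Perm.sign σ • ∏ i, M (σ i) i‖ ≤
      ∏ i, ∏ j, (1 + ‖M i j‖) := by
    intro σ
    have h1 : ‖Equiv.Perm.sign σ • ∏ i, M (σ i) i‖ = ∏ i, ‖M (σ i) i‖ := by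
      rcases Int.units_eq_one_or (Equiv.Perm.sign σ) with h | h <;> simp [h]
    rw [h1, Finset.prod_comm]
    refine Finset.prod_le_prod (fun _ _ => norm_nonneg _) fun i _ => ?_
    calc ‖M (σ i) i‖ ≤ 1 + ‖M (σ i) i‖ := by linarith
      _ ≤ ∏ j, (1 + ‖M j i‖) := by
        rw [← Finset.mul_prod_erase _ _ (Finset.mem_univ (σ i))]
        refine le_mul_of_one_le_right (by positivity) (Finset.one_le_prod fun j _ => ?_)
        linarith [norm_nonneg (M j i)]
  refine (Finset.sum_le_sum fun σ _ => h σ).trans ?_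
  simp [Fintype.card_perm]

theorem norm_adjugate_le (M : Matrix n n ℂ) (k l : n) :
    ‖M.adjugate k l‖ ≤ (Fintype.card n).factorial * 2 ^ (Fintype.card n) ^ 2 *
      ∏ i, ∏ j, (1 + ‖M i j‖) := by
  rw [Matrix.adjugate_apply]
  refine (norm_det_le _).trans ?_
  rw [mul_assoc]
  gcongr
  calc ∏ i, ∏ j, (1 + ‖(M.updateRow l (Pi.single k 1)) i j‖)
      ≤ ∏ i : n, ∏ j : n, (2 * (1 + ‖M i j‖)) := by
        gcongr with i _ j _
        by_cases h : i = l
        · subst h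
          rw [Matrix.updateRow_self]
          have : ‖(Pi.single k 1 : n → ℂ) j‖ ≤ 1 := by
            by_cases hj : j = k
            · subst hj; simp
            · simp [hj]
          nlinarith [norm_nonneg (M i j)]
        · rw [Matrix.updateRow_ne h]
          nlinarith [norm_nonneg (M i j)]
    _ = _ := by
        simp [Finset.prod_mul_distrib, pow_mul, pow_two]

end MatrixAlgebra

/-! ### Labels, independence and measurability of the blocks. -/

section Independence

variable {Ω : Type*}

/-- The σ-algebra generated by the variables of a Wigner family with labels in `S`. -/
abbrev labelAlgebra (d : ℕ → Ω → ℝ) (u v : ℕ → ℕ → Ω → ℝ) (S : Set WignerLabel) :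
    MeasurableSpace Ω :=
  ⨆ k ∈ S, MeasurableSpace.comap (wignerFamily d u v k) inferInstance

/-- The larger of the two matrix indices of a label. -/
def WignerLabel.colIndex : WignerLabel → ℕ
  | .diag i => i
  | .re _ j _ => j
  | .im _ j _ => j

/-- The labels of the variables in the `N × N` Wigner matrix. -/
def blockLabels (N : ℕ) : Set WignerLabel := {k | k.colIndex < N}

/-- The labels of the off-diagonal variables in column `N` and the rows in `s`. -/
def colLabels (N : ℕ) (s : Set ℕ) : Set WignerLabel :=
  {k | ∃ i, ∃ h : i < N, i ∈ s ∧ (k = .re i N h ∨ k = .im i N h)}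

variable {d : ℕ → Ω → ℝ} {u v : ℕ → ℕ → Ω → ℝ}

theorem labelAlgebra_mono {S T : Set WignerLabel} (h : S ⊆ T) :
    labelAlgebra d u v S ≤ labelAlgebra d u v T :=
  biSup_mono fun _ hk => h hk

theorem measurable_wignerFamily_labelAlgebra {S : Set WignerLabel} {k : WignerLabel}
    (hk : k ∈ S) : Measurable[labelAlgebra d u v S] (wignerFamily d u v k) :=
  (comap_measurable (wignerFamily d u v k)).mono
    (le_iSup₂_of_le (f := fun k (_ : k ∈ S) =>
      MeasurableSpace.comap (wignerFamily d u v k) inferInstance) k hk le_rfl) le_rfl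

theorem disjoint_colLabels (N : ℕ) {s t : Set ℕ} (h : Disjoint s t) :
    Disjoint (colLabels N s) (colLabels N t) := by
  rw [Set.disjoint_left] at h ⊢
  rintro k ⟨i, hi, his, hk⟩ ⟨j, hj, hjt, hk'⟩
  have : i = j := by
    rcases hk with rfl | rfl <;> rcases hk' with hk' | hk' <;> simp_all
  exact h his (this ▸ hjt)

theorem disjoint_diag_colLabels (N : ℕ) (s : Set ℕ) :
    Disjoint {WignerLabel.diag N} (colLabels N s) := by
  rw [Set.disjoint_left]
  rintro k rfl ⟨j, hj, hjt, hk'⟩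
  rcases hk' with hk' | hk' <;> simp at hk'

theorem disjoint_row_blockLabels (N : ℕ) (s : Set ℕ) :
    Disjoint ({WignerLabel.diag N} ∪ colLabels N s) (blockLabels N) := by
  rw [Set.disjoint_left]
  rintro k (rfl | ⟨j, hj, hjt, hk'⟩) h
  · simp [blockLabels, WignerLabel.colIndex] at h
  · rcases hk' with rfl | rfl <;> simp [blockLabels, WignerLabel.colIndex] at h

theorem measurable_wignerEntry_block {N i j : ℕ} (hi : i < N) (hj : j < N) :
    Measurable[labelAlgebra d u v (blockLabels N)] (wignerEntry d u v i j) := by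
  have hR : ∀ {k}, k ∈ blockLabels N → Measurable[labelAlgebra d u v (blockLabels N)]
      (wignerFamily d u v k) := measurable_wignerFamily_labelAlgebra
  rcases lt_trichotomy i j with h | rfl | h
  · have h1 : Measurable[labelAlgebra d u v (blockLabels N)] (u i j) := hR (k := .re i j h) hj
    have h2 : Measurable[labelAlgebra d u v (blockLabels N)] (v i j) := hR (k := .im i j h) hj
    have : wignerEntry d u v i j = fun ω => (u i j ω : ℂ) + Complex.I * (v i j ω : ℂ) := by
      funext ω; simp [wignerEntry, h.ne, h]
    rw [this]
    fun_prop
  · have h1 : Measurable[labelAlgebra d u v (blockLabels N)] (d i) := hR (k := .diag i) hi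
    have : wignerEntry d u v i i = fun ω => ((√2 * d i ω : ℝ) : ℂ) := by
      funext ω; simp [wignerEntry]
    rw [this]
    fun_prop
  · have h1 : Measurable[labelAlgebra d u v (blockLabels N)] (u j i) := hR (k := .re j i h) hi
    have h2 : Measurable[labelAlgebra d u v (blockLabels N)] (v j i) := hR (k := .im j i h) hi
    have : wignerEntry d u v i j = fun ω => (u j i ω : ℂ) - Complex.I * (v j i ω : ℂ) := by
      funext ω; simp [wignerEntry, h.ne', h.le]
    rw [this]
    fun_prop

theorem wignerEntry_of_lt {i j : ℕ} (h : i < j) :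
    wignerEntry d u v i j = fun ω => (u i j ω : ℂ) + Complex.I * (v i j ω : ℂ) := by
  funext ω; simp [wignerEntry, h.ne, h]

theorem wignerEntry_diag (i : ℕ) :
    wignerEntry d u v i i = fun ω => ((√2 * d i ω : ℝ) : ℂ) := by
  funext ω; simp [wignerEntry]

theorem wignerEntry_conj {i j : ℕ} (h : i < j) (ω : Ω) :
    wignerEntry d u v j i ω = starRingEnd ℂ (wignerEntry d u v i j ω) := by
  simp [wignerEntry, h.ne, h, h.ne', h.le, sub_eq_add_neg]

theorem measurable_wignerEntry_col {N i : ℕ} (hi : i < N) {s : Set ℕ} (his : i ∈ s) :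
    Measurable[labelAlgebra d u v (colLabels N s)] (wignerEntry d u v i N) := by
  have h1 : Measurable[labelAlgebra d u v (colLabels N s)] (u i N) :=
    measurable_wignerFamily_labelAlgebra (k := .re i N hi) ⟨i, hi, his, Or.inl rfl⟩
  have h2 : Measurable[labelAlgebra d u v (colLabels N s)] (v i N) :=
    measurable_wignerFamily_labelAlgebra (k := .im i N hi) ⟨i, hi, his, Or.inr rfl⟩
  rw [wignerEntry_of_lt hi]
  fun_prop

theorem measurable_wignerEntry_diag (N : ℕ) :
    Measurable[labelAlgebra d u v {WignerLabel.diag N}] (wignerEntry d u v N N) := by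
  have h1 : Measurable[labelAlgebra d u v {WignerLabel.diag N}] (d N) :=
    measurable_wignerFamily_labelAlgebra (k := .diag N) rfl
  rw [wignerEntry_diag]
  fun_prop

theorem Matrix.measurable_det {m : MeasurableSpace Ω} {n : Type*} [Fintype n] [DecidableEq n]
    {M : Ω → Matrix n n ℂ} (h : ∀ i j, Measurable fun ω => M ω i j) :
    Measurable fun ω => (M ω).det := by
  simp_rw [Matrix.det_apply']
  fun_prop

theorem Matrix.measurable_adjugate {m : MeasurableSpace Ω} {n : Type*} [Fintype n]
    [DecidableEq n] {M : Ω → Matrix n n ℂ} (h : ∀ i j, Measurable fun ω => M ω i j) (k l : n) :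
    Measurable fun ω => (M ω).adjugate k l := by
  simp_rw [Matrix.adjugate_apply]
  refine Matrix.measurable_det fun i j => ?_
  by_cases hi : i = l
  · subst hi; simp only [Matrix.updateRow_self]; exact measurable_const
  · simp only [Matrix.updateRow_ne hi]; exact h i j

section Shifted

variable (d u v) in
/-- The shifted Wigner matrix `X_N - μ I`. -/
def shiftedMatrix (N : ℕ) (μ : ℂ) (ω : Ω) : Matrix (Fin N) (Fin N) ℂ :=
  wignerMatrix d u v N ω - μ • (1 : Matrix (Fin N) (Fin N) ℂ)

theorem measurable_shiftedMatrix (N : ℕ) (μ : ℂ) (i j : Fin N) :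
    Measurable[labelAlgebra d u v (blockLabels N)] (fun ω => shiftedMatrix d u v N μ ω i j) := by
  have := measurable_wignerEntry_block (d := d) (u := u) (v := v) i.2 j.2
  simp only [shiftedMatrix, Matrix.sub_apply, wignerMatrix, Matrix.of_apply]
  exact this.sub_const _

theorem measurable_det_shiftedMatrix (N : ℕ) (μ : ℂ) :
    Measurable[labelAlgebra d u v (blockLabels N)] (fun ω => (shiftedMatrix d u v N μ ω).det) :=
  Matrix.measurable_det (measurable_shiftedMatrix N μ)

theorem measurable_adjugate_shiftedMatrix (N : ℕ) (μ : ℂ) (i j : Fin N) :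
    Measurable[labelAlgebra d u v (blockLabels N)]
      (fun ω => (shiftedMatrix d u v N μ ω).adjugate i j) :=
  Matrix.measurable_adjugate (measurable_shiftedMatrix N μ) i j

variable (d u v) in
/-- The product of `1 + |X_ij|` over all entries of the `N × N` Wigner matrix. -/
def entryBound (N : ℕ) (ω : Ω) : ℝ :=
  ∏ i : Fin N, ∏ j : Fin N, (1 + ‖wignerEntry d u v i j ω‖)

theorem one_le_entryBound (N : ℕ) (ω : Ω) : 1 ≤ entryBound d u v N ω :=
  Finset.one_le_prod fun i _ => Finset.one_le_prod fun j _ => by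
    linarith [norm_nonneg (wignerEntry d u v i j ω)]

theorem prod_shiftedMatrix_le (N : ℕ) (μ : ℂ) (ω : Ω) :
    ∏ i, ∏ j, (1 + ‖shiftedMatrix d u v N μ ω i j‖) ≤
      (1 + ‖μ‖) ^ N ^ 2 * entryBound d u v N ω := by
  calc ∏ i, ∏ j, (1 + ‖shiftedMatrix d u v N μ ω i j‖)
      ≤ ∏ i : Fin N, ∏ j : Fin N, ((1 + ‖μ‖) * (1 + ‖wignerEntry d u v i j ω‖)) := by
        gcongr with i _ j _
        have h1 : ‖shiftedMatrix d u v N μ ω i j‖ ≤ ‖wignerEntry d u v i j ω‖ + ‖μ‖ := by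
          simp only [shiftedMatrix, Matrix.sub_apply, wignerMatrix, Matrix.of_apply]
          refine (norm_sub_le _ _).trans ?_
          gcongr
          by_cases h : i = j
          · subst h; simp
          · simp [Matrix.one_apply_ne h]
        nlinarith [norm_nonneg (wignerEntry d u v i j ω), norm_nonneg μ]
    _ = _ := by
        simp [Finset.prod_mul_distrib, pow_mul, pow_two, entryBound]

/-- The constant in the bounds for the determinant and the adjugate of a shifted matrix. -/
def minorConst (N : ℕ) (R : ℝ) : ℝ := (N.factorial * 2 ^ N ^ 2) * (1 + R) ^ N ^ 2

theorem minorConst_nonneg (N : ℕ) {R : ℝ} (hR : 0 ≤ R) : 0 ≤ minorConst N R := by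
  unfold minorConst; positivity

theorem norm_det_shiftedMatrix_le (N : ℕ) {μ : ℂ} {R : ℝ} (hμ : ‖μ‖ ≤ R) (ω : Ω) :
    ‖(shiftedMatrix d u v N μ ω).det‖ ≤ minorConst N R * entryBound d u v N ω := by
  refine (norm_det_le _).trans ?_
  have h0 := one_le_entryBound (d := d) (u := u) (v := v) N ω
  have h1 : (1 + ‖μ‖) ^ N ^ 2 ≤ (1 + R) ^ N ^ 2 := by gcongr
  have h2 : (1 : ℝ) ≤ 2 ^ N ^ 2 := one_le_pow₀ (by norm_num)
  have hR : 0 ≤ R := (norm_nonneg μ).trans hμ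
  calc _ ≤ (N.factorial : ℝ) * ((1 + ‖μ‖) ^ N ^ 2 * entryBound d u v N ω) := by
        rw [Fintype.card_fin]; gcongr; exact prod_shiftedMatrix_le N μ ω
    _ ≤ (N.factorial * 2 ^ N ^ 2) * ((1 + R) ^ N ^ 2 * entryBound d u v N ω) := by
        gcongr
        exact le_mul_of_one_le_right (by positivity) h2
    _ = _ := by rw [minorConst]; ring

theorem norm_adjugate_shiftedMatrix_le (N : ℕ) {μ : ℂ} {R : ℝ} (hμ : ‖μ‖ ≤ R) (ω : Ω)
    (i j : Fin N) :
    ‖(shiftedMatrix d u v N μ ω).adjugate i j‖ ≤ minorConst N R * entryBound d u v N ω := by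
  refine (norm_adjugate_le _ _ _).trans ?_
  have h0 := one_le_entryBound (d := d) (u := u) (v := v) N ω
  have h1 : (1 + ‖μ‖) ^ N ^ 2 ≤ (1 + R) ^ N ^ 2 := by gcongr
  rw [Fintype.card_fin, minorConst, mul_assoc _ _ (entryBound d u v N ω)]
  gcongr
  exact (prod_shiftedMatrix_le N μ ω).trans (by gcongr)

/-- The last row is the conjugate of the last column, hence the square. The three factors depend on
disjoint sets of labels. -/
theorem entryBound_succ (N : ℕ) (ω : Ω) :
    entryBound d u v (N + 1) ω = ((1 + ‖wignerEntry d u v N N ω‖) *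
      (∏ i : Fin N, (1 + ‖wignerEntry d u v i N ω‖)) ^ 2) * entryBound d u v N ω := by
  unfold entryBound
  rw [Fin.prod_univ_castSucc]
  simp_rw [Fin.prod_univ_castSucc]
  simp only [Fin.val_castSucc, Fin.val_last]
  rw [Finset.prod_mul_distrib]
  have : ∏ i : Fin N, (1 + ‖wignerEntry d u v N i ω‖) =
      ∏ i : Fin N, (1 + ‖wignerEntry d u v i N ω‖) :=
    Finset.prod_congr rfl fun i _ => by rw [wignerEntry_conj i.2]; simp
  rw [this]
  ring

end Shifted

end Independence

namespace IsWignerFamily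

variable {Ω : Type*} [MeasurableSpace Ω] {Q : Measure ℝ} {P : Measure Ω}
  {d : ℕ → Ω → ℝ} {u v : ℕ → ℕ → Ω → ℝ}

theorem labelAlgebra_le (hX : IsWignerFamily Q P d u v) (S : Set WignerLabel) :
    labelAlgebra d u v S ≤ ‹MeasurableSpace Ω› :=
  iSup₂_le fun k _ => (hX.measurable k).comap_le

theorem indepFun (hX : IsWignerFamily Q P d u v) {S T : Set WignerLabel} (hST : Disjoint S T)
    {E F : Type*} [MeasurableSpace E] [MeasurableSpace F] {f : Ω → E} {g : Ω → F}
    (hf : Measurable[labelAlgebra d u v S] f) (hg : Measurable[labelAlgebra d u v T] g) :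
    IndepFun f g P := by
  rw [IndepFun_iff_Indep]
  have h := indep_iSup_of_disjoint (fun k => (hX.measurable k).comap_le) hX.indep hST
  exact indep_of_indep_of_le_left (indep_of_indep_of_le_right h hg.comap_le) hf.comap_le

/-- For independent factors the product formula needs measurability only, so moments can be computed
without separate integrability checks. -/
theorem integral_mul (hX : IsWignerFamily Q P d u v) {S T : Set WignerLabel}
    (hST : Disjoint S T) {f g : Ω → ℂ}
    (hf : Measurable[labelAlgebra d u v S] f) (hg : Measurable[labelAlgebra d u v T] g) :
    ∫ ω, f ω * g ω ∂P = (∫ ω, f ω ∂P) * ∫ ω, g ω ∂P :=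
  (hX.indepFun hST hf hg).integral_fun_mul_eq_mul_integral
    (hf.mono (hX.labelAlgebra_le S) le_rfl).aestronglyMeasurable
    (hg.mono (hX.labelAlgebra_le T) le_rfl).aestronglyMeasurable

theorem integrable_mul (hX : IsWignerFamily Q P d u v) {S T : Set WignerLabel}
    (hST : Disjoint S T) {f g : Ω → ℝ}
    (hf : Measurable[labelAlgebra d u v S] f) (hg : Measurable[labelAlgebra d u v T] g)
    (hfi : Integrable f P) (hgi : Integrable g P) :
    Integrable (fun ω => f ω * g ω) P :=
  (hX.indepFun hST hf hg).integrable_mul hfi hgi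

theorem integral_comp (hX : IsWignerFamily Q P d u v) (k : WignerLabel) {φ : ℝ → ℝ}
    (hφ : Measurable φ) :
    ∫ ω, φ (wignerFamily d u v k ω) ∂P = ∫ x, φ x ∂Q := by
  rw [← hX.law k, integral_map (hX.measurable k).aemeasurable hφ.aestronglyMeasurable]

theorem integrable_comp (hX : IsWignerFamily Q P d u v) (k : WignerLabel) {φ : ℝ → ℝ}
    (hφ : Integrable φ Q) :
    Integrable (fun ω => φ (wignerFamily d u v k ω)) P := by
  rw [← hX.law k] at hφ
  exact hφ.comp_measurable (hX.measurable k)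

end IsWignerFamily

namespace IsWignerFamily

variable {Ω : Type*} [MeasurableSpace Ω] {Q : Measure ℝ} [IsProbabilityMeasure Q] {P : Measure Ω}
  [IsProbabilityMeasure P] {d : ℕ → Ω → ℝ} {u v : ℕ → ℕ → Ω → ℝ}

/-! ### Integrability from the fourth moment. -/

section Integrability

variable (hX : IsWignerFamily Q P d u v) (hfour : Integrable (fun x : ℝ => x ^ 4) Q)
include hX hfour

omit [IsProbabilityMeasure P] in
theorem integrable_one_add_abs_pow_four (k : WignerLabel) :
    Integrable (fun ω => (1 + |wignerFamily d u v k ω|) ^ 4) P := by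
  refine hX.integrable_comp k (φ := fun x => (1 + |x|) ^ 4) ?_
  -- Convexity gives `(1 + a)^4 ≤ 8 (1 + a^4)` for `a ≥ 0`.
  refine Integrable.mono' (g := fun x => 8 + 8 * x ^ 4)
    ((integrable_const _).add (hfour.const_mul 8)) (by fun_prop) (ae_of_all _ fun x => ?_)
  rw [Real.norm_eq_abs, abs_of_nonneg (by positivity), ← Even.pow_abs (by decide : Even 4) x]
  have := abs_nonneg x
  nlinarith [sq_nonneg (|x| - 1), sq_nonneg (|x|^2 - 1), sq_nonneg (|x|^2 - |x|),
    mul_nonneg this (sq_nonneg (|x| - 1))]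

omit [IsProbabilityMeasure P] in
theorem integrable_wignerEntry_pow_four {i j : ℕ} (h : i < j) :
    Integrable (fun ω => (1 + ‖wignerEntry d u v i j ω‖) ^ 4) P := by
  have hu : Measurable[labelAlgebra d u v {.re i j h}] (u i j) :=
    measurable_wignerFamily_labelAlgebra (k := .re i j h) rfl
  have hv : Measurable[labelAlgebra d u v {.im i j h}] (v i j) :=
    measurable_wignerFamily_labelAlgebra (k := .im i j h) rfl
  have hm : Measurable (wignerEntry d u v i j) :=
    (measurable_wignerEntry_col h (Set.mem_singleton i)).mono (hX.labelAlgebra_le _) le_rfl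
  refine Integrable.mono' (hX.integrable_mul
    (f := fun ω => (1 + |u i j ω|) ^ 4) (g := fun ω => (1 + |v i j ω|) ^ 4)
    (S := {.re i j h}) (T := {.im i j h}) (by simp) (by fun_prop) (by fun_prop)
    (hX.integrable_one_add_abs_pow_four hfour (.re i j h))
    (hX.integrable_one_add_abs_pow_four hfour (.im i j h))) ?_ (ae_of_all _ fun ω => ?_)
  · exact (by fun_prop : Measurable fun ω => (1 + ‖wignerEntry d u v i j ω‖) ^
      4).aestronglyMeasurable
  · rw [Real.norm_eq_abs, abs_of_nonneg (by positivity), ← mul_pow]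
    gcongr
    rw [wignerEntry_of_lt h]
    have : ‖(u i j ω : ℂ) + Complex.I * (v i j ω : ℂ)‖ ≤ |u i j ω| + |v i j ω| := by
      refine (norm_add_le _ _).trans ?_
      simp
    nlinarith [abs_nonneg (u i j ω), abs_nonneg (v i j ω)]

omit [IsProbabilityMeasure P] in
theorem integrable_diag_sq (N : ℕ) :
    Integrable (fun ω => (1 + ‖wignerEntry d u v N N ω‖) ^ 2) P := by
  have hm : Measurable (wignerEntry d u v N N) :=
    (measurable_wignerEntry_diag N).mono (hX.labelAlgebra_le _) le_rfl
  refine Integrable.mono' ((hX.integrable_one_add_abs_pow_four hfour (.diag N)).const_mul 4) ?_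
    (ae_of_all _ fun ω => ?_)
  · exact (by fun_prop : Measurable fun ω => (1 + ‖wignerEntry d u v N N ω‖) ^
      2).aestronglyMeasurable
  · rw [Real.norm_eq_abs, abs_of_nonneg (by positivity), wignerEntry_diag]
    simp only [wignerFamily, Complex.norm_real, Real.norm_eq_abs, abs_mul]
    have h2 : |√2| ≤ 2 := by
      rw [abs_of_nonneg (by positivity)]
      exact Real.sqrt_le_iff.mpr ⟨by norm_num, by norm_num⟩
    have h3 := abs_nonneg (d N ω)
    calc (1 + |√2| * |d N ω|) ^ 2 ≤ (2 * (1 + |d N ω|)) ^ 2 := by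
          gcongr
          nlinarith
      _ = 4 * (1 + |d N ω|) ^ 2 := by ring
      _ ≤ 4 * (1 + |d N ω|) ^ 4 := by
          gcongr 4 * ?_
          exact pow_le_pow_right₀ (by linarith) (by norm_num)

theorem integrable_prod_col (N : ℕ) (s : Finset (Fin N)) :
    Integrable (fun ω => ∏ i ∈ s, (1 + ‖wignerEntry d u v i N ω‖) ^ 4) P := by
  induction s using Finset.induction_on with
  | empty => simp
  | insert i s hi ih =>
    simp_rw [Finset.prod_insert hi]
    have hm : ∀ j : Fin N, ∀ t : Set ℕ, (j : ℕ) ∈ t →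
        Measurable[labelAlgebra d u v (colLabels N t)] (wignerEntry d u v j N) :=
      fun j t h => measurable_wignerEntry_col j.2 h
    refine hX.integrable_mul (S := colLabels N {(i : ℕ)})
      (T := colLabels N ((fun j : Fin N => (j : ℕ)) '' s)) (disjoint_colLabels N ?_) ?_ ?_
      (hX.integrable_wignerEntry_pow_four hfour i.2) ih
    · rw [Set.disjoint_singleton_left]
      rintro ⟨j, hj, hij⟩
      exact hi (Fin.ext hij ▸ hj)
    · have := hm i {(i : ℕ)} rfl
      fun_prop
    · refine Finset.measurable_fun_prod _ fun j hj => ?_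
      have := hm j _ (Set.mem_image_of_mem (fun j : Fin N => (j : ℕ)) (Finset.mem_coe.mpr hj))
      fun_prop

/-- Each off-diagonal modulus occurs twice in `entryBound`, so the square contains its fourth power,
which is just what `hfour` controls; a diagonal modulus enters only squared. Independence splits off
one row and column at a time. -/
theorem integrable_entryBound_sq (N : ℕ) :
    Integrable (fun ω => entryBound d u v N ω ^ 2) P := by
  induction N with
  | zero => simp [entryBound]
  | succ N ih =>
    have h : ∀ ω, entryBound d u v (N + 1) ω ^ 2 = ((1 + ‖wignerEntry d u v N N ω‖) ^ 2 *
      (∏ i : Fin N, (1 + ‖wignerEntry d u v i N ω‖) ^ 4)) * entryBound d u v N ω ^ 2 := by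
      intro ω
      rw [entryBound_succ, Finset.prod_pow]
      ring
    simp_rw [h]
    have h0 : Measurable[labelAlgebra d u v {WignerLabel.diag N}]
      (fun ω => (1 + ‖wignerEntry d u v N N ω‖) ^ 2) := by
      have := measurable_wignerEntry_diag (d := d) (u := u) (v := v) N
      fun_prop
    have h1 : Measurable[labelAlgebra d u v (colLabels N Set.univ)]
      (fun ω => ∏ i : Fin N, (1 + ‖wignerEntry d u v i N ω‖) ^ 4) := by
      refine Finset.measurable_fun_prod _ fun j _ => ?_
      have := measurable_wignerEntry_col (d := d) (u := u) (v := v) j.2 (Set.mem_univ (j : ℕ))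
      fun_prop
    refine hX.integrable_mul (disjoint_row_blockLabels N Set.univ) ?_ ?_
      (hX.integrable_mul (disjoint_diag_colLabels N Set.univ) h0 h1
        (hX.integrable_diag_sq hfour N) (hX.integrable_prod_col hfour N Finset.univ)) ih
    · exact (h0.mono (labelAlgebra_mono Set.subset_union_left) le_rfl).mul
        (h1.mono (labelAlgebra_mono Set.subset_union_right) le_rfl)
    · refine Measurable.pow_const (Finset.measurable_fun_prod _ fun i _ =>
        Finset.measurable_fun_prod _ fun j _ => ?_) 2
      have := measurable_wignerEntry_block (d := d) (u := u) (v := v) i.2 j.2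
      fun_prop

end Integrability

/-! ### Moments of single entries. -/

section Moments

variable (hX : IsWignerFamily Q P d u v)
  (hmean : ∫ x, x ∂Q = 0) (hvar : ∫ x, x ^ 2 ∂Q = 1 / 2)
  (hfour : Integrable (fun x : ℝ => x ^ 4) Q)
include hX

omit [IsProbabilityMeasure Q] [IsProbabilityMeasure P] in
theorem integral_pow_mul_pow {i j : ℕ} (h : i < j) (p q : ℕ) :
    ∫ ω, ((u i j ω : ℂ) ^ p * (v i j ω : ℂ) ^ q) ∂P =
      ((∫ x, x ^ p ∂Q : ℝ) : ℂ) * ((∫ x, x ^ q ∂Q : ℝ) : ℂ) := by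
  have hu : Measurable[labelAlgebra d u v {.re i j h}] (u i j) :=
    measurable_wignerFamily_labelAlgebra (k := .re i j h) rfl
  have hv : Measurable[labelAlgebra d u v {.im i j h}] (v i j) :=
    measurable_wignerFamily_labelAlgebra (k := .im i j h) rfl
  rw [hX.integral_mul (S := {.re i j h}) (T := {.im i j h}) (by simp) (by fun_prop) (by fun_prop),
    ← hX.integral_comp (.re i j h) (φ := fun x => x ^ p) (by fun_prop),
    ← hX.integral_comp (.im i j h) (φ := fun x => x ^ q) (by fun_prop),
    ← integral_complex_ofReal, ← integral_complex_ofReal]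
  simp [wignerFamily]

include hfour

omit [IsProbabilityMeasure P] in
theorem integrable_pow_mul_pow {i j : ℕ} (h : i < j) {p q : ℕ} (hp : p ≤ 4) (hq : q ≤ 4) :
    Integrable (fun ω => (u i j ω : ℂ) ^ p * (v i j ω : ℂ) ^ q) P := by
  have hu : Measurable[labelAlgebra d u v {.re i j h}] (u i j) :=
    measurable_wignerFamily_labelAlgebra (k := .re i j h) rfl
  have hv : Measurable[labelAlgebra d u v {.im i j h}] (v i j) :=
    measurable_wignerFamily_labelAlgebra (k := .im i j h) rfl
  have hu' := hX.measurable (.re i j h)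
  have hv' := hX.measurable (.im i j h)
  simp only [wignerFamily] at hu' hv'
  refine Integrable.mono' (hX.integrable_mul
    (f := fun ω => (1 + |u i j ω|) ^ 4) (g := fun ω => (1 + |v i j ω|) ^ 4)
    (S := {.re i j h}) (T := {.im i j h}) (by simp) (by fun_prop) (by fun_prop)
    (hX.integrable_one_add_abs_pow_four hfour (.re i j h))
    (hX.integrable_one_add_abs_pow_four hfour (.im i j h)))
    (by fun_prop : Measurable fun ω => (u i j ω : ℂ) ^ p * (v i j ω : ℂ) ^ q).aestronglyMeasurable
    (ae_of_all _ fun ω => ?_)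
  have key : ∀ (x : ℝ) (p : ℕ), p ≤ 4 → |x| ^ p ≤ (1 + |x|) ^ 4 := fun x p hp =>
    calc |x| ^ p ≤ (1 + |x|) ^ p := by gcongr; linarith
      _ ≤ _ := pow_le_pow_right₀ (by linarith [abs_nonneg x]) hp
  simp only [norm_mul, norm_pow, Complex.norm_real, Real.norm_eq_abs]
  gcongr
  · exact key _ _ hp
  · exact key _ _ hq

include hmean

omit [IsProbabilityMeasure P] in
theorem integral_wignerEntry {i j : ℕ} (h : i < j) : ∫ ω, wignerEntry d u v i j ω ∂P = 0 := by
  have e : ∀ ω, wignerEntry d u v i j ω = (u i j ω : ℂ) ^ 1 * (v i j ω : ℂ) ^ 0 +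
      Complex.I * ((u i j ω : ℂ) ^ 0 * (v i j ω : ℂ) ^ 1) := by
    intro ω; rw [wignerEntry_of_lt h]; ring
  simp_rw [e]
  rw [integral_add (hX.integrable_pow_mul_pow hfour h (by norm_num) (by norm_num))
    ((hX.integrable_pow_mul_pow hfour h (by norm_num) (by norm_num)).const_mul _),
    integral_const_mul, hX.integral_pow_mul_pow h, hX.integral_pow_mul_pow h]
  simp [hmean]

omit [IsProbabilityMeasure P] in
-- Real and imaginary part have the same second moment and are uncorrelated. This vanishing removes
-- one of the three pairings in the fourth-order moments of a column.
theorem integral_wignerEntry_sq {i j : ℕ} (h : i < j) :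
    ∫ ω, wignerEntry d u v i j ω ^ 2 ∂P = 0 := by
  have e : ∀ ω, wignerEntry d u v i j ω ^ 2 = (u i j ω : ℂ) ^ 2 * (v i j ω : ℂ) ^ 0 +
      (2 * Complex.I * ((u i j ω : ℂ) ^ 1 * (v i j ω : ℂ) ^ 1) +
      (-1) * ((u i j ω : ℂ) ^ 0 * (v i j ω : ℂ) ^ 2)) := by
    intro ω; rw [wignerEntry_of_lt h]; ring_nf; simp; ring
  have hi : ∀ p q : ℕ, p ≤ 4 → q ≤ 4 →
    Integrable (fun ω => (u i j ω : ℂ) ^ p * (v i j ω : ℂ) ^ q) P :=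
    fun p q hp hq => hX.integrable_pow_mul_pow hfour h hp hq
  simp_rw [e]
  rw [integral_add (hi _ _ (by norm_num) (by norm_num))
    (((hi _ _ (by norm_num) (by norm_num)).const_mul _).fun_add
      ((hi _ _ (by norm_num) (by norm_num)).const_mul _)),
    integral_add ((hi _ _ (by norm_num) (by norm_num)).const_mul _)
      ((hi _ _ (by norm_num) (by norm_num)).const_mul _),
    integral_const_mul, integral_const_mul, hX.integral_pow_mul_pow h, hX.integral_pow_mul_pow h,
    hX.integral_pow_mul_pow h]
  simp [hmean]

include hvar
omit hmean

omit [IsProbabilityMeasure P] in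
theorem integral_wignerEntry_normSq {i j : ℕ} (h : i < j) :
    ∫ ω, starRingEnd ℂ (wignerEntry d u v i j ω) * wignerEntry d u v i j ω ∂P = 1 := by
  have e : ∀ ω, starRingEnd ℂ (wignerEntry d u v i j ω) * wignerEntry d u v i j ω =
      (u i j ω : ℂ) ^ 2 * (v i j ω : ℂ) ^ 0 + (u i j ω : ℂ) ^ 0 * (v i j ω : ℂ) ^ 2 := by
    intro ω; rw [wignerEntry_of_lt h]; simp; ring_nf; simp
  simp_rw [e]
  rw [integral_add (hX.integrable_pow_mul_pow hfour h (by norm_num) (by norm_num))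
    (hX.integrable_pow_mul_pow hfour h (by norm_num) (by norm_num)),
    hX.integral_pow_mul_pow h, hX.integral_pow_mul_pow h]
  simp [hvar]; norm_num

omit [IsProbabilityMeasure P] in
-- Expand `(u² + v²)²` to get `b + 2 · (1/2)² + b`. The excess over the complex Gaussian value `2`
-- is the constant `2b - 3/2`.
theorem integral_wignerEntry_four {i j : ℕ} (h : i < j) :
    ∫ ω, (starRingEnd ℂ (wignerEntry d u v i j ω) * wignerEntry d u v i j ω) ^ 2 ∂P =
      ((2 * (∫ x, x ^ 4 ∂Q) + 1 / 2 : ℝ) : ℂ) := by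
  have e : ∀ ω, (starRingEnd ℂ (wignerEntry d u v i j ω) * wignerEntry d u v i j ω) ^ 2 =
      (u i j ω : ℂ) ^ 4 * (v i j ω : ℂ) ^ 0 + (2 * ((u i j ω : ℂ) ^ 2 * (v i j ω : ℂ) ^ 2) +
        (u i j ω : ℂ) ^ 0 * (v i j ω : ℂ) ^ 4) := by
    intro ω
    have e1 : starRingEnd ℂ (wignerEntry d u v i j ω) * wignerEntry d u v i j ω =
      (u i j ω : ℂ) ^ 2 + (v i j ω : ℂ) ^ 2 := by
      rw [wignerEntry_of_lt h]; simp; ring_nf; simp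
    rw [e1]; ring
  have hi : ∀ p q : ℕ, p ≤ 4 → q ≤ 4 →
    Integrable (fun ω => (u i j ω : ℂ) ^ p * (v i j ω : ℂ) ^ q) P :=
    fun p q hp hq => hX.integrable_pow_mul_pow hfour h hp hq
  simp_rw [e]
  rw [integral_add (hi _ _ (by norm_num) (by norm_num))
    (((hi _ _ (by norm_num) (by norm_num)).const_mul _).fun_add
      (hi _ _ (by norm_num) (by norm_num))),
    integral_add ((hi _ _ (by norm_num) (by norm_num)).const_mul _)
      (hi _ _ (by norm_num) (by norm_num)),
    integral_const_mul, hX.integral_pow_mul_pow h, hX.integral_pow_mul_pow h,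
    hX.integral_pow_mul_pow h]
  simp [hvar]; ring

omit [IsProbabilityMeasure Q] [IsProbabilityMeasure P] hfour in
theorem integral_diag_sq (N : ℕ) : ∫ ω, wignerEntry d u v N N ω ^ 2 ∂P = 1 := by
  have e : ∀ ω, wignerEntry d u v N N ω ^ 2 =
    ((2 * wignerFamily d u v (.diag N) ω ^ 2 : ℝ) : ℂ) := by
    intro ω; rw [wignerEntry_diag, ← Complex.ofReal_pow, mul_pow]; simp [wignerFamily]
  simp_rw [e]
  rw [integral_complex_ofReal, integral_const_mul, hX.integral_comp (.diag N)
    (φ := fun x => x ^ 2) (by fun_prop), hvar]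
  norm_num

include hmean
omit hvar hfour

omit [IsProbabilityMeasure Q] [IsProbabilityMeasure P] in
theorem integral_diag (N : ℕ) : ∫ ω, wignerEntry d u v N N ω ∂P = 0 := by
  have e : ∀ ω, wignerEntry d u v N N ω = ((√2 * wignerFamily d u v (.diag N) ω : ℝ) : ℂ) := by
    intro ω; rw [wignerEntry_diag]; simp [wignerFamily]
  simp_rw [e]
  rw [integral_complex_ofReal, integral_const_mul, hX.integral_comp (.diag N)
    (φ := fun x => x) (by fun_prop), hmean]
  norm_num

end Moments
end IsWignerFamily

namespace IsWignerFamily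

variable {Ω : Type*} [MeasurableSpace Ω] {Q : Measure ℝ} [IsProbabilityMeasure Q] {P : Measure Ω}
  [IsProbabilityMeasure P] {d : ℕ → Ω → ℝ} {u v : ℕ → ℕ → Ω → ℝ}

/-! ### Mixed moments of the last column. -/

section ColumnMoments

variable (hX : IsWignerFamily Q P d u v)
  (hmean : ∫ x, x ∂Q = 0) (hvar : ∫ x, x ^ 2 ∂Q = 1 / 2)
  (hfour : Integrable (fun x : ℝ => x ^ 4) Q)
include hX hmean hfour

omit [IsProbabilityMeasure P] in
theorem integral_col_mul {N : ℕ} (i : Fin N) {f : Ω → ℂ}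
    (hf : Measurable[labelAlgebra d u v (colLabels N {(i : ℕ)}ᶜ)] f) :
    ∫ ω, wignerEntry d u v i N ω * f ω ∂P = 0 := by
  rw [hX.integral_mul (disjoint_colLabels N (disjoint_compl_right (a := {(i : ℕ)})))
    (measurable_wignerEntry_col i.2 rfl) hf, hX.integral_wignerEntry hmean hfour i.2, zero_mul]

omit [IsProbabilityMeasure P] in
theorem integral_conj_col_mul {N : ℕ} (i : Fin N) {f : Ω → ℂ}
    (hf : Measurable[labelAlgebra d u v (colLabels N {(i : ℕ)}ᶜ)] f) :
    ∫ ω, starRingEnd ℂ (wignerEntry d u v i N ω) * f ω ∂P = 0 := by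
  have hm := measurable_wignerEntry_col (d := d) (u := u) (v := v) i.2 (Set.mem_singleton (i : ℕ))
  rw [hX.integral_mul (disjoint_colLabels N (disjoint_compl_right (a := {(i : ℕ)})))
    (f := fun ω => starRingEnd ℂ (wignerEntry d u v i N ω))
    (Complex.continuous_conj.measurable.comp hm) hf, integral_conj,
    hX.integral_wignerEntry hmean hfour i.2]
  simp

include hvar

omit [IsProbabilityMeasure P] in
theorem integral_col_two {N : ℕ} (i j : Fin N) :
    ∫ ω, starRingEnd ℂ (wignerEntry d u v i N ω) * wignerEntry d u v j N ω ∂P =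
      if i = j then 1 else 0 := by
  split_ifs with h
  · subst h
    exact hX.integral_wignerEntry_normSq hvar hfour i.2
  · exact hX.integral_conj_col_mul hmean hfour i
      (measurable_wignerEntry_col j.2 (fun h' => h (Fin.ext h').symm))

set_option maxHeartbeats 1000000 in
omit [IsProbabilityMeasure P] in
-- Wick's formula with a fourth-cumulant correction. By centring, an index that differs from the
-- other three gives zero, so only coincidences in pairs survive. At `i = j = k = l` both pairings
-- count, and the third term supplies the rest of `2b + 1/2`.
theorem integral_col_four {N : ℕ} (i j k l : Fin N) :
    ∫ ω, (starRingEnd ℂ (wignerEntry d u v i N ω) * wignerEntry d u v j N ω) *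
        (starRingEnd ℂ (wignerEntry d u v k N ω) * wignerEntry d u v l N ω) ∂P =
      (if i = j then if k = l then 1 else 0 else 0) +
      (if i = l then if j = k then 1 else 0 else 0) +
      (if i = j then if i = k then if i = l then ((2 * (∫ x, x ^ 4 ∂Q) - 3 / 2 : ℝ) : ℂ)
        else 0 else 0 else 0) := by
  have hm : ∀ (i : Fin N) (s : Set ℕ), (i : ℕ) ∈ s →
      Measurable[labelAlgebra d u v (colLabels N s)] (wignerEntry d u v i N) :=
    fun i s h => measurable_wignerEntry_col i.2 h
  have hmc : ∀ (i : Fin N) (s : Set ℕ), (i : ℕ) ∈ s →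
      Measurable[labelAlgebra d u v (colLabels N s)]
        (fun ω => starRingEnd ℂ (wignerEntry d u v i N ω)) :=
    fun i s h => Complex.continuous_conj.measurable.comp (hm i s h)
  have hne : ∀ {i j : Fin N}, i ≠ j → (j : ℕ) ∈ ({(i : ℕ)}ᶜ : Set ℕ) :=
    fun h h' => h (Fin.ext h').symm
  have hi : i ≠ j → i ≠ k → i ≠ l →
      ∫ ω, (starRingEnd ℂ (wignerEntry d u v i N ω) * wignerEntry d u v j N ω) *
        (starRingEnd ℂ (wignerEntry d u v k N ω) * wignerEntry d u v l N ω) ∂P = 0 := by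
    intro h1 h2 h3
    simp_rw [mul_assoc]
    exact hX.integral_conj_col_mul hmean hfour i
      ((hm j _ (hne h1)).mul ((hmc k _ (hne h2)).mul (hm l _ (hne h3))))
  have hj : j ≠ i → j ≠ k → j ≠ l →
      ∫ ω, (starRingEnd ℂ (wignerEntry d u v i N ω) * wignerEntry d u v j N ω) *
        (starRingEnd ℂ (wignerEntry d u v k N ω) * wignerEntry d u v l N ω) ∂P = 0 := by
    intro h1 h2 h3
    rw [← hX.integral_col_mul hmean hfour j
      ((hmc i _ (hne h1)).mul ((hmc k _ (hne h2)).mul (hm l _ (hne h3))))]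
    congr 1; funext ω; simp only [Pi.mul_apply]; ring
  have hk : k ≠ i → k ≠ j → k ≠ l →
      ∫ ω, (starRingEnd ℂ (wignerEntry d u v i N ω) * wignerEntry d u v j N ω) *
        (starRingEnd ℂ (wignerEntry d u v k N ω) * wignerEntry d u v l N ω) ∂P = 0 := by
    intro h1 h2 h3
    rw [← hX.integral_conj_col_mul hmean hfour k
      ((hmc i _ (hne h1)).mul ((hm j _ (hne h2)).mul (hm l _ (hne h3))))]
    congr 1; funext ω; simp only [Pi.mul_apply]; ring
  have hl : l ≠ i → l ≠ j → l ≠ k →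
      ∫ ω, (starRingEnd ℂ (wignerEntry d u v i N ω) * wignerEntry d u v j N ω) *
        (starRingEnd ℂ (wignerEntry d u v k N ω) * wignerEntry d u v l N ω) ∂P = 0 := by
    intro h1 h2 h3
    rw [← hX.integral_col_mul hmean hfour l
      ((hmc i _ (hne h1)).mul ((hm j _ (hne h2)).mul (hmc k _ (hne h3))))]
    congr 1; funext ω; simp only [Pi.mul_apply]; ring
  have hpair : ∀ i k : Fin N, i ≠ k →
      ∫ ω, (starRingEnd ℂ (wignerEntry d u v i N ω) * wignerEntry d u v i N ω) *
        (starRingEnd ℂ (wignerEntry d u v k N ω) * wignerEntry d u v k N ω) ∂P = 1 := by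
    intro i k hik
    rw [hX.integral_mul (disjoint_colLabels N (disjoint_compl_right (a := {(i : ℕ)})))
      (f := fun ω => starRingEnd ℂ (wignerEntry d u v i N ω) * wignerEntry d u v i N ω)
      (g := fun ω => starRingEnd ℂ (wignerEntry d u v k N ω) * wignerEntry d u v k N ω)
      ((hmc i _ (Set.mem_singleton _)).mul (hm i _ (Set.mem_singleton _)))
        ((hmc k _ (hne hik)).mul (hm k _ (hne hik))),
      hX.integral_wignerEntry_normSq hvar hfour i.2, hX.integral_wignerEntry_normSq hvar hfour k.2,
      one_mul]
  by_cases hij : i = j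
  · subst hij
    by_cases hkl : k = l
    · subst hkl
      by_cases hik : i = k
      · subst hik
        have := hX.integral_wignerEntry_four hvar hfour i.2
        simp_rw [pow_two] at this
        rw [this]
        simp
        ring
      · rw [hpair i k hik]
        simp [hik]
    · by_cases hil : i = l
      · subst hil
        rw [hk hkl hkl hkl]
        simp [hkl, Ne.symm hkl]
      · rw [hl (Ne.symm hil) (Ne.symm hil) (Ne.symm hkl)]
        simp [hkl, hil]
  · by_cases hil : i = l
    · subst hil
      by_cases hjk : j = k
      · subst hjk
        have h1 := hpair i j hij
        simp only [hij, if_true, if_false, zero_add, add_zero]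
        rw [← h1]
        congr 1; funext ω; ring
      · rw [hj (Ne.symm hij) hjk (Ne.symm hij)]
        simp [hij, hjk]
    -- The pairing `i = k`, `j = l` joins two unconjugated entries and vanishes with the second
    -- moment of a complex entry.
    · by_cases hik : i = k
      · subst hik
        by_cases hjl : j = l
        · subst hjl
          have e : ∀ ω, (starRingEnd ℂ (wignerEntry d u v i N ω) * wignerEntry d u v j N ω) *
            (starRingEnd ℂ (wignerEntry d u v i N ω) * wignerEntry d u v j N ω) =
            starRingEnd ℂ (wignerEntry d u v i N ω) ^ 2 * wignerEntry d u v j N ω ^ 2 := by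
            intro ω; ring
          simp_rw [e]
          rw [hX.integral_mul (disjoint_colLabels N (disjoint_compl_right (a := {(i : ℕ)})))
            (f := fun ω => starRingEnd ℂ (wignerEntry d u v i N ω) ^ 2)
            (g := fun ω => wignerEntry d u v j N ω ^ 2)
            ((hmc i _ (Set.mem_singleton _)).pow_const 2) ((hm j _ (hne hij)).pow_const 2),
            hX.integral_wignerEntry_sq hmean hfour j.2]
          simp [hij]
        · rw [hj (Ne.symm hij) (Ne.symm hij) hjl]
          simp [hij, hil]
      · rw [hi hij hik hil]
        simp [hij, hil]

end ColumnMoments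

/-! ### Expansion along the last row and column. -/

section Expansion

omit [MeasurableSpace Ω] in
theorem det_shiftedMatrix_succ (N : ℕ) (μ : ℂ) (ω : Ω) :
    (shiftedMatrix d u v (N + 1) μ ω).det =
      (wignerEntry d u v N N ω - μ) * (shiftedMatrix d u v N μ ω).det -
      ∑ i : Fin N, ∑ j : Fin N, starRingEnd ℂ (wignerEntry d u v i N ω) *
        wignerEntry d u v j N ω * (shiftedMatrix d u v N μ ω).adjugate i j := by
  rw [shiftedMatrix.eq_def d u v N, ← det_fromBlocks_sub]
  let e : Fin N ⊕ Unit ≃ Fin (N + 1) :=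
    (Equiv.sumCongr (Equiv.refl _) (Equiv.ofUnique Unit (Fin 1))).trans finSumFinEquiv
  rw [← Matrix.det_submatrix_equiv_self e]
  congr 1
  ext i j
  rcases i with i | i <;> rcases j with j | j
  · simp [e, shiftedMatrix, wignerMatrix, Matrix.one_apply, Fin.ext_iff]
  · simp [e, shiftedMatrix, wignerMatrix, Fin.ext_iff, i.2.ne]
  · simp [e, shiftedMatrix, wignerMatrix, Fin.ext_iff, j.2.ne', wignerEntry_conj]
  · simp [e, shiftedMatrix, wignerMatrix]

omit [MeasurableSpace Ω] in
theorem norm_wignerEntry_le_prod {N : ℕ} (i : Fin N) (ω : Ω) :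
    ‖wignerEntry d u v i N ω‖ ≤ ∏ i : Fin N, (1 + ‖wignerEntry d u v i N ω‖) := by
  rw [← Finset.mul_prod_erase _ _ (Finset.mem_univ i)]
  refine (by linarith : ‖wignerEntry d u v i N ω‖ ≤ 1 + ‖wignerEntry d u v i N ω‖).trans ?_
  refine le_mul_of_one_le_right (by positivity) (Finset.one_le_prod fun j _ => ?_)
  linarith [norm_nonneg (wignerEntry d u v j N ω)]

variable (hX : IsWignerFamily Q P d u v)
  (hmean : ∫ x, x ∂Q = 0) (hvar : ∫ x, x ^ 2 ∂Q = 1 / 2)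
  (hfour : Integrable (fun x : ℝ => x ^ 4) Q)
include hX hfour

/-- Products of two functions of the `N × N` block bounded by a multiple of `entryBound`
are integrable. -/
theorem integrable_of_le_entryBound {N : ℕ} {f g : Ω → ℂ} (hf : Measurable f) (hg : Measurable g)
    {C : ℝ} (hC : 0 ≤ C) (hfb : ∀ ω, ‖f ω‖ ≤ C * entryBound d u v N ω)
    (hgb : ∀ ω, ‖g ω‖ ≤ C * entryBound d u v N ω) : Integrable (fun ω => f ω * g ω) P := by
  refine Integrable.mono' ((hX.integrable_entryBound_sq hfour N).const_mul (C ^ 2))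
    (hf.mul hg).aestronglyMeasurable (ae_of_all _ fun ω => ?_)
  rw [norm_mul]
  have := one_le_entryBound (d := d) (u := u) (v := v) N ω
  calc ‖f ω‖ * ‖g ω‖ ≤ (C * entryBound d u v N ω) * (C * entryBound d u v N ω) :=
        mul_le_mul (hfb ω) (hgb ω) (norm_nonneg _) (by positivity)
    _ = _ := by ring

/-- Integrability of a product of a function of the last column and a function of the block. -/
theorem integrable_col_mul_block {N : ℕ} {f g : Ω → ℂ} (hf : Measurable f) (hg : Measurable g)
    {C C' : ℝ}
    (hfb : ∀ ω, ‖f ω‖ ≤ C * ((1 + ‖wignerEntry d u v N N ω‖) *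
      (∏ i : Fin N, (1 + ‖wignerEntry d u v i N ω‖)) ^ 2) ^ 2)
    (hgb : ∀ ω, ‖g ω‖ ≤ C' * entryBound d u v N ω ^ 2) : Integrable (fun ω => f ω * g ω) P := by
  refine Integrable.mono' ((hX.integrable_entryBound_sq hfour (N + 1)).const_mul (C * C'))
    (hf.mul hg).aestronglyMeasurable (ae_of_all _ fun ω => ?_)
  rw [norm_mul, entryBound_succ]
  calc ‖f ω‖ * ‖g ω‖ ≤ _ := mul_le_mul (hfb ω) (hgb ω) (norm_nonneg _)
        ((norm_nonneg _).trans (hfb ω))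
    _ = _ := by ring

include hmean hvar

set_option maxHeartbeats 2000000 in
/-- Expansion of the correlation function along the last row and column. -/
theorem corrFun_succ_eq (N : ℕ) (μ ν : ℂ) :
    corrFun P d u v (N + 1) μ ν =
      (1 + μ * ν) * ∫ ω, (shiftedMatrix d u v N μ ω).det * (shiftedMatrix d u v N ν ω).det ∂P +
      μ * ∑ i, ∫ ω, (shiftedMatrix d u v N μ ω).det *
        (shiftedMatrix d u v N ν ω).adjugate i i ∂P +
      ν * ∑ i, ∫ ω, (shiftedMatrix d u v N ν ω).det *
        (shiftedMatrix d u v N μ ω).adjugate i i ∂P +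
      ∑ i, ∑ k, ∫ ω, (shiftedMatrix d u v N μ ω).adjugate i i *
        (shiftedMatrix d u v N ν ω).adjugate k k ∂P +
      ∑ i, ∑ k, ∫ ω, (shiftedMatrix d u v N μ ω).adjugate i k *
        (shiftedMatrix d u v N ν ω).adjugate k i ∂P +
      ((2 * (∫ x, x ^ 4 ∂Q) - 3 / 2 : ℝ) : ℂ) *
        ∑ i, ∫ ω, (shiftedMatrix d u v N μ ω).adjugate i i *
          (shiftedMatrix d u v N ν ω).adjugate i i ∂P := by
  set x := wignerEntry d u v N N with hx
  set c : Fin N → Ω → ℂ := fun i => wignerEntry d u v i N with hc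
  set a : ℂ → Ω → ℂ := fun μ ω => (shiftedMatrix d u v N μ ω).det with ha
  set α : ℂ → Fin N → Fin N → Ω → ℂ :=
    fun μ i j ω => (shiftedMatrix d u v N μ ω).adjugate i j with hα
  set S : Set WignerLabel := {WignerLabel.diag N} ∪ colLabels N Set.univ with hS
  have hxm : Measurable[labelAlgebra d u v S] x :=
    (measurable_wignerEntry_diag N).mono (labelAlgebra_mono Set.subset_union_left) le_rfl
  have hcm0 : ∀ i, Measurable[labelAlgebra d u v (colLabels N Set.univ)] (c i) := fun i =>
    measurable_wignerEntry_col i.2 (Set.mem_univ _)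
  have hccm0 : ∀ i j, Measurable[labelAlgebra d u v (colLabels N Set.univ)]
      (fun ω => starRingEnd ℂ (c i ω) * c j ω) := fun i j =>
    (Complex.continuous_conj.measurable.comp (hcm0 i)).mul (hcm0 j)
  have hccm : ∀ i j, Measurable[labelAlgebra d u v S]
      (fun ω => starRingEnd ℂ (c i ω) * c j ω) := fun i j =>
    (hccm0 i j).mono (labelAlgebra_mono Set.subset_union_right) le_rfl
  have ham : ∀ μ, Measurable[labelAlgebra d u v (blockLabels N)] (a μ) :=
    fun μ => measurable_det_shiftedMatrix N μ
  have hαm : ∀ μ i j, Measurable[labelAlgebra d u v (blockLabels N)] (α μ i j) :=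
    fun μ i j => measurable_adjugate_shiftedMatrix N μ i j
  have hle : ∀ T, labelAlgebra d u v T ≤ ‹MeasurableSpace Ω› := hX.labelAlgebra_le
  set R : ℝ := max ‖μ‖ ‖ν‖ with hR
  set K : ℝ := minorConst N R with hK
  have hR0 : 0 ≤ R := (norm_nonneg μ).trans (le_max_left _ _)
  have hK0 : 0 ≤ K := minorConst_nonneg N hR0
  have haμ : ∀ ω, ‖a μ ω‖ ≤ K * entryBound d u v N ω :=
    fun ω => norm_det_shiftedMatrix_le N (le_max_left _ _) ω
  have haν : ∀ ω, ‖a ν ω‖ ≤ K * entryBound d u v N ω :=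
    fun ω => norm_det_shiftedMatrix_le N (le_max_right _ _) ω
  have hαμ : ∀ i j ω, ‖α μ i j ω‖ ≤ K * entryBound d u v N ω :=
    fun i j ω => norm_adjugate_shiftedMatrix_le N (le_max_left _ _) ω i j
  have hαν : ∀ i j ω, ‖α ν i j ω‖ ≤ K * entryBound d u v N ω :=
    fun i j ω => norm_adjugate_shiftedMatrix_le N (le_max_right _ _) ω i j
  have hW : ∀ ω, 0 ≤ K * entryBound d u v N ω := fun ω =>
    mul_nonneg hK0 (zero_le_one.trans (one_le_entryBound N ω))
  have hblock : ∀ {f g : Ω → ℂ}, (∀ ω, ‖f ω‖ ≤ K * entryBound d u v N ω) →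
      (∀ ω, ‖g ω‖ ≤ K * entryBound d u v N ω) →
      ∀ ω, ‖f ω * g ω‖ ≤ K ^ 2 * entryBound d u v N ω ^ 2 := by
    intro f g hf hg ω
    rw [norm_mul, ← mul_pow, pow_two]
    exact mul_le_mul (hf ω) (hg ω) (norm_nonneg _) (hW ω)
  have hxb : ∀ z : ℂ, ‖z‖ ≤ R → ∀ ω, ‖x ω - z‖ ≤ (1 + R) * (1 + ‖x ω‖) := by
    intro z hz ω
    refine (norm_sub_le _ _).trans ?_
    nlinarith [norm_nonneg (x ω)]
  have hp : ∀ ω, 1 ≤ ∏ i : Fin N, (1 + ‖wignerEntry d u v i N ω‖) := fun ω =>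
    Finset.one_le_prod fun i _ => by linarith [norm_nonneg (wignerEntry d u v i N ω)]
  have hccb : ∀ i j ω, ‖starRingEnd ℂ (c i ω) * c j ω‖ ≤
      (∏ i : Fin N, (1 + ‖wignerEntry d u v i N ω‖)) ^ 2 := by
    intro i j ω
    rw [norm_mul, pow_two, RCLike.norm_conj]
    exact mul_le_mul (norm_wignerEntry_le_prod i ω)
      (norm_wignerEntry_le_prod j ω) (norm_nonneg _) (zero_le_one.trans (hp ω))
  have hμR : ‖μ‖ ≤ R := le_max_left _ _
  have hνR : ‖ν‖ ≤ R := le_max_right _ _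
  have hdisj := disjoint_row_blockLabels N Set.univ
  -- Every summand is written as a function of the last row and column times a function of the
  -- block, so that independence applies term by term.
  have hexp : ∀ ω, charPolyProd d u v (N + 1) μ ν ω =
      ((x ω - μ) * (x ω - ν)) * (a μ ω * a ν ω) -
      ∑ k, ∑ l, ((x ω - μ) * (starRingEnd ℂ (c k ω) * c l ω)) * (a μ ω * α ν k l ω) -
      ∑ i, ∑ j, ((x ω - ν) * (starRingEnd ℂ (c i ω) * c j ω)) * (a ν ω * α μ i j ω) +
      ∑ i, ∑ j, ∑ k, ∑ l, ((starRingEnd ℂ (c i ω) * c j ω) * (starRingEnd ℂ (c k ω) * c l ω)) *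
        (α μ i j ω * α ν k l ω) := by
    intro ω
    have h1 := det_shiftedMatrix_succ (d := d) (u := u) (v := v) N μ ω
    have h2 := det_shiftedMatrix_succ (d := d) (u := u) (v := v) N ν ω
    change (shiftedMatrix d u v (N + 1) μ ω).det * (shiftedMatrix d u v (N + 1) ν ω).det = _
    rw [h1, h2]
    have e1 : ∑ k, ∑ l, ((x ω - μ) * (starRingEnd ℂ (c k ω) * c l ω)) * (a μ ω * α ν k l ω) =
        (x ω - μ) * a μ ω * ∑ k, ∑ l, starRingEnd ℂ (c k ω) * c l ω * α ν k l ω := by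
      simp_rw [Finset.mul_sum]
      exact Finset.sum_congr rfl fun k _ => Finset.sum_congr rfl fun l _ => by ring
    have e2 : ∑ k, ∑ l, ((x ω - ν) * (starRingEnd ℂ (c k ω) * c l ω)) * (a ν ω * α μ k l ω) =
        (x ω - ν) * a ν ω * ∑ k, ∑ l, starRingEnd ℂ (c k ω) * c l ω * α μ k l ω := by
      simp_rw [Finset.mul_sum]
      exact Finset.sum_congr rfl fun k _ => Finset.sum_congr rfl fun l _ => by ring
    have e3 : ∑ i, ∑ j, ∑ k, ∑ l, ((starRingEnd ℂ (c i ω) * c j ω) *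
        (starRingEnd ℂ (c k ω) * c l ω)) * (α μ i j ω * α ν k l ω) =
        (∑ i, ∑ j, starRingEnd ℂ (c i ω) * c j ω * α μ i j ω) *
        ∑ k, ∑ l, starRingEnd ℂ (c k ω) * c l ω * α ν k l ω := by
      simp_rw [Finset.sum_mul, Finset.mul_sum]
      exact Finset.sum_congr rfl fun i _ => Finset.sum_congr rfl fun j _ =>
        Finset.sum_congr rfl fun k _ => Finset.sum_congr rfl fun l _ => by ring
    rw [e1, e2, e3]
    ring
  have hb1 : ∀ ω, ‖(x ω - μ) * (x ω - ν)‖ ≤ (1 + R) ^ 2 * ((1 + ‖x ω‖) *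
      (∏ i : Fin N, (1 + ‖wignerEntry d u v i N ω‖)) ^ 2) ^ 2 := by
    intro ω
    rw [norm_mul]
    calc _ ≤ ((1 + R) * (1 + ‖x ω‖)) * ((1 + R) * (1 + ‖x ω‖)) := by
          gcongr
          · exact hxb μ hμR ω
          · exact hxb ν hνR ω
      _ = (1 + R) ^ 2 * ((1 + ‖x ω‖) * 1 ^ 2) ^ 2 := by ring
      _ ≤ _ := by gcongr; exact hp ω
  have hb2 : ∀ z : ℂ, ‖z‖ ≤ R → ∀ i j ω, ‖(x ω - z) * (starRingEnd ℂ (c i ω) * c j ω)‖ ≤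
      (1 + R) * ((1 + ‖x ω‖) * (∏ i : Fin N, (1 + ‖wignerEntry d u v i N ω‖)) ^ 2) ^ 2 := by
    intro z hz i j ω
    rw [norm_mul]
    have h1 : 1 ≤ (1 + ‖x ω‖) * (∏ i : Fin N, (1 + ‖wignerEntry d u v i N ω‖)) ^ 2 :=
      one_le_mul_of_one_le_of_one_le (by linarith [norm_nonneg (x ω)]) (one_le_pow₀ (hp ω))
    calc _ ≤ ((1 + R) * (1 + ‖x ω‖)) * (∏ i : Fin N, (1 + ‖wignerEntry d u v i N ω‖)) ^ 2 := by
          gcongr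
          · exact hxb z hz ω
          · exact hccb i j ω
      _ = (1 + R) * ((1 + ‖x ω‖) * (∏ i : Fin N, (1 + ‖wignerEntry d u v i N ω‖)) ^ 2) := by ring
      _ ≤ _ := by gcongr; exact le_self_pow₀ h1 (by norm_num)
  have hb3 : ∀ i j k l ω, ‖(starRingEnd ℂ (c i ω) * c j ω) * (starRingEnd ℂ (c k ω) * c l ω)‖ ≤
      1 * ((1 + ‖x ω‖) * (∏ i : Fin N, (1 + ‖wignerEntry d u v i N ω‖)) ^ 2) ^ 2 := by
    intro i j k l ω
    rw [norm_mul, one_mul, pow_two]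
    have h0 : (∏ i : Fin N, (1 + ‖wignerEntry d u v i N ω‖)) ^ 2 ≤ (1 + ‖x ω‖) *
        (∏ i : Fin N, (1 + ‖wignerEntry d u v i N ω‖)) ^ 2 :=
      le_mul_of_one_le_left (by positivity) (by linarith [norm_nonneg (x ω)])
    exact mul_le_mul ((hccb i j ω).trans h0) ((hccb k l ω).trans h0) (norm_nonneg _)
      (by have := hp ω; positivity)
  have hg1 := hblock haμ haν
  have hg2 : ∀ k l, ∀ ω, ‖a μ ω * α ν k l ω‖ ≤ K ^ 2 * entryBound d u v N ω ^ 2 :=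
    fun k l => hblock haμ (hαν k l)
  have hg2' : ∀ k l, ∀ ω, ‖a ν ω * α μ k l ω‖ ≤ K ^ 2 * entryBound d u v N ω ^ 2 :=
    fun k l => hblock haν (hαμ k l)
  have hg3 : ∀ i j k l, ∀ ω, ‖α μ i j ω * α ν k l ω‖ ≤ K ^ 2 * entryBound d u v N ω ^ 2 :=
    fun i j k l => hblock (hαμ i j) (hαν k l)
  have hf1m : Measurable[labelAlgebra d u v S] (fun ω => (x ω - μ) * (x ω - ν)) :=
    (hxm.sub_const μ).mul (hxm.sub_const ν)
  have hf2m : ∀ z : ℂ, ∀ i j, Measurable[labelAlgebra d u v S]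
      (fun ω => (x ω - z) * (starRingEnd ℂ (c i ω) * c j ω)) :=
    fun z i j => (hxm.sub_const z).mul (hccm i j)
  have hf3m : ∀ i j k l, Measurable[labelAlgebra d u v S]
      (fun ω => (starRingEnd ℂ (c i ω) * c j ω) * (starRingEnd ℂ (c k ω) * c l ω)) :=
    fun i j k l => (hccm i j).mul (hccm k l)
  have hg1m : Measurable[labelAlgebra d u v (blockLabels N)] (fun ω => a μ ω * a ν ω) :=
    (ham μ).mul (ham ν)
  have hg2m : ∀ z w : ℂ, ∀ k l, Measurable[labelAlgebra d u v (blockLabels N)]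
      (fun ω => a z ω * α w k l ω) := fun z w k l => (ham z).mul (hαm w k l)
  have hg3m : ∀ i j k l, Measurable[labelAlgebra d u v (blockLabels N)]
      (fun ω => α μ i j ω * α ν k l ω) := fun i j k l => (hαm μ i j).mul (hαm ν k l)
  have hi1 : Integrable (fun ω => ((x ω - μ) * (x ω - ν)) * (a μ ω * a ν ω)) P :=
    hX.integrable_col_mul_block hfour (hf1m.mono (hle _) le_rfl) (hg1m.mono (hle _) le_rfl) hb1 hg1
  have hi2 : ∀ k l, Integrable (fun ω => ((x ω - μ) * (starRingEnd ℂ (c k ω) * c l ω)) *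
      (a μ ω * α ν k l ω)) P := fun k l =>
    hX.integrable_col_mul_block hfour ((hf2m μ k l).mono (hle _) le_rfl)
      ((hg2m μ ν k l).mono (hle _) le_rfl) (hb2 μ hμR k l) (hg2 k l)
  have hi2' : ∀ k l, Integrable (fun ω => ((x ω - ν) * (starRingEnd ℂ (c k ω) * c l ω)) *
      (a ν ω * α μ k l ω)) P := fun k l =>
    hX.integrable_col_mul_block hfour ((hf2m ν k l).mono (hle _) le_rfl)
      ((hg2m ν μ k l).mono (hle _) le_rfl) (hb2 ν hνR k l) (hg2' k l)
  have hi3 : ∀ i j k l, Integrable (fun ω => ((starRingEnd ℂ (c i ω) * c j ω) *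
      (starRingEnd ℂ (c k ω) * c l ω)) * (α μ i j ω * α ν k l ω)) P := fun i j k l =>
    hX.integrable_col_mul_block hfour ((hf3m i j k l).mono (hle _) le_rfl)
      ((hg3m i j k l).mono (hle _) le_rfl) (hb3 i j k l) (hg3 i j k l)
  have hxP : Measurable x := hxm.mono (hle _) le_rfl
  have hxi2 : Integrable (fun ω => x ω ^ 2) P := by
    refine Integrable.mono' (hX.integrable_diag_sq hfour N) (hxP.pow_const 2).aestronglyMeasurable
      (ae_of_all _ fun ω => ?_)
    rw [norm_pow]
    gcongr
    exact le_add_of_nonneg_left zero_le_one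
  have hxi : Integrable x P := by
    refine Integrable.mono' (hX.integrable_diag_sq hfour N) hxP.aestronglyMeasurable
      (ae_of_all _ fun ω => ?_)
    have := norm_nonneg (x ω)
    change ‖x ω‖ ≤ (1 + ‖x ω‖) ^ 2
    nlinarith
  have hm1 : ∫ ω, (x ω - μ) * (x ω - ν) ∂P = 1 + μ * ν := by
    have e : ∀ ω, (x ω - μ) * (x ω - ν) = x ω ^ 2 + (-(μ + ν) * x ω + μ * ν) := by
      intro ω; ring
    simp_rw [e]
    rw [integral_add hxi2 ((hxi.const_mul _).fun_add (integrable_const _)),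
      integral_add (hxi.const_mul _) (integrable_const _), integral_const_mul,
      hX.integral_diag_sq hvar, hX.integral_diag hmean]
    simp
  have hm2 : ∀ (z : ℂ) (k l : Fin N), ∫ ω, (x ω - z) * (starRingEnd ℂ (c k ω) * c l ω) ∂P =
      if k = l then -z else 0 := by
    intro z k l
    rw [hX.integral_mul (disjoint_diag_colLabels N Set.univ)
      ((measurable_wignerEntry_diag N).sub_const z) (hccm0 k l),
      hX.integral_col_two hmean hvar hfour, integral_sub hxi (integrable_const _),
      hX.integral_diag hmean]
    simp
  have hm3 := fun i j k l : Fin N => hX.integral_col_four hmean hvar hfour i j k l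
  have hc0 : corrFun P d u v (N + 1) μ ν = ∫ ω, charPolyProd d u v (N + 1) μ ν ω ∂P := rfl
  rw [hc0]
  simp_rw [hexp]
  have hs2 : Integrable (fun ω => ∑ k, ∑ l, ((x ω - μ) * (starRingEnd ℂ (c k ω) * c l ω)) *
      (a μ ω * α ν k l ω)) P :=
    integrable_finsetSum _ fun k _ => integrable_finsetSum _ fun l _ => hi2 k l
  have hs2' : Integrable (fun ω => ∑ k, ∑ l, ((x ω - ν) * (starRingEnd ℂ (c k ω) * c l ω)) *
      (a ν ω * α μ k l ω)) P :=
    integrable_finsetSum _ fun k _ => integrable_finsetSum _ fun l _ => hi2' k l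
  have hs3 : Integrable (fun ω => ∑ i, ∑ j, ∑ k, ∑ l, ((starRingEnd ℂ (c i ω) * c j ω) *
      (starRingEnd ℂ (c k ω) * c l ω)) * (α μ i j ω * α ν k l ω)) P :=
    integrable_finsetSum _ fun i _ => integrable_finsetSum _ fun j _ =>
      integrable_finsetSum _ fun k _ => integrable_finsetSum _ fun l _ => hi3 i j k l
  have hd1 : Integrable (fun ω => ((x ω - μ) * (x ω - ν)) * (a μ ω * a ν ω) -
      ∑ k, ∑ l, ((x ω - μ) * (starRingEnd ℂ (c k ω) * c l ω)) * (a μ ω * α ν k l ω)) P :=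
    hi1.sub hs2
  have hd2 : Integrable (fun ω => ((x ω - μ) * (x ω - ν)) * (a μ ω * a ν ω) -
      ∑ k, ∑ l, ((x ω - μ) * (starRingEnd ℂ (c k ω) * c l ω)) * (a μ ω * α ν k l ω) -
      ∑ k, ∑ l, ((x ω - ν) * (starRingEnd ℂ (c k ω) * c l ω)) * (a ν ω * α μ k l ω)) P :=
    hd1.sub hs2'
  rw [integral_add hd2 hs3, integral_sub hd1 hs2',
    integral_sub hi1 hs2]
  have E1 : ∫ ω, ((x ω - μ) * (x ω - ν)) * (a μ ω * a ν ω) ∂P =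
      (1 + μ * ν) * ∫ ω, a μ ω * a ν ω ∂P := by
    rw [hX.integral_mul hdisj hf1m hg1m, hm1]
  have E2 : ∫ ω, ∑ k, ∑ l, ((x ω - μ) * (starRingEnd ℂ (c k ω) * c l ω)) *
      (a μ ω * α ν k l ω) ∂P = -(μ * ∑ k, ∫ ω, a μ ω * α ν k k ω ∂P) := by
    rw [integral_finsetSum _ fun k _ => integrable_finsetSum _ fun l _ => hi2 k l,
      Finset.mul_sum, ← Finset.sum_neg_distrib]
    refine Finset.sum_congr rfl fun k _ => ?_
    rw [integral_finsetSum _ fun l _ => hi2 k l]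
    simp_rw [hX.integral_mul hdisj (hf2m _ _ _) (hg2m _ _ _ _), hm2]
    simp
  have E2' : ∫ ω, ∑ k, ∑ l, ((x ω - ν) * (starRingEnd ℂ (c k ω) * c l ω)) *
      (a ν ω * α μ k l ω) ∂P = -(ν * ∑ k, ∫ ω, a ν ω * α μ k k ω ∂P) := by
    rw [integral_finsetSum _ fun k _ => integrable_finsetSum _ fun l _ => hi2' k l,
      Finset.mul_sum, ← Finset.sum_neg_distrib]
    refine Finset.sum_congr rfl fun k _ => ?_
    rw [integral_finsetSum _ fun l _ => hi2' k l]
    simp_rw [hX.integral_mul hdisj (hf2m _ _ _) (hg2m _ _ _ _), hm2]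
    simp
  have E3 : ∫ ω, ∑ i, ∑ j, ∑ k, ∑ l, ((starRingEnd ℂ (c i ω) * c j ω) *
      (starRingEnd ℂ (c k ω) * c l ω)) * (α μ i j ω * α ν k l ω) ∂P =
      ∑ i, ∑ k, (∫ ω, α μ i i ω * α ν k k ω ∂P) + ∑ i, ∑ k, (∫ ω, α μ i k ω * α ν k i ω ∂P) +
      ((2 * (∫ x, x ^ 4 ∂Q) - 3 / 2 : ℝ) : ℂ) * ∑ i, ∫ ω, α μ i i ω * α ν i i ω ∂P := by
    rw [integral_finsetSum _ fun i _ => integrable_finsetSum _ fun j _ =>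
      integrable_finsetSum _ fun k _ => integrable_finsetSum _ fun l _ => hi3 i j k l,
      Finset.mul_sum, ← Finset.sum_add_distrib, ← Finset.sum_add_distrib]
    refine Finset.sum_congr rfl fun i _ => ?_
    have step : ∀ j k l, ∫ ω, ((starRingEnd ℂ (c i ω) * c j ω) *
      (starRingEnd ℂ (c k ω) * c l ω)) * (α μ i j ω * α ν k l ω) ∂P =
      ((if i = j then if k = l then 1 else 0 else 0) +
      (if i = l then if j = k then 1 else 0 else 0) +
      (if i = j then if i = k then if i = l then ((2 * (∫ x, x ^ 4 ∂Q) - 3 / 2 : ℝ) : ℂ)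
        else 0 else 0 else 0)) * ∫ ω, α μ i j ω * α ν k l ω ∂P := by
      intro j k l
      rw [hX.integral_mul hdisj (hf3m _ _ _ _) (hg3m _ _ _ _), ← hm3]
    rw [integral_finsetSum _ fun j _ =>
      integrable_finsetSum _ fun k _ => integrable_finsetSum _ fun l _ => hi3 i j k l]
    have step2 : ∀ j, ∫ ω, ∑ k, ∑ l, ((starRingEnd ℂ (c i ω) * c j ω) *
      (starRingEnd ℂ (c k ω) * c l ω)) * (α μ i j ω * α ν k l ω) ∂P = ∑ k, ∑ l,
      ((if i = j then if k = l then 1 else 0 else 0) +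
      (if i = l then if j = k then 1 else 0 else 0) +
      (if i = j then if i = k then if i = l then ((2 * (∫ x, x ^ 4 ∂Q) - 3 / 2 : ℝ) : ℂ)
        else 0 else 0 else 0)) * ∫ ω, α μ i j ω * α ν k l ω ∂P := by
      intro j
      rw [integral_finsetSum _ fun k _ => integrable_finsetSum _ fun l _ => hi3 i j k l]
      refine Finset.sum_congr rfl fun k _ => ?_
      rw [integral_finsetSum _ fun l _ => hi3 i j k l]
      exact Finset.sum_congr rfl fun l _ => step j k l
    -- The pairings `i = j, k = l` and `i = l, j = k` collapse the sum to the product of traces and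
    -- to the trace of the product; the cumulant term leaves the diagonal cofactors.
    simp_rw [step2, add_mul, Finset.sum_add_distrib]
    congr 1
    · congr 1
      · simp [ite_mul, Finset.sum_ite_eq]
      · simp [ite_mul, Finset.sum_ite_eq]
    · simp [ite_mul, Finset.sum_ite_eq]
  rw [E1, E2, E2', E3]
  ring

end Expansion
end IsWignerFamily

/-! ### Derivatives of the correlation function and principal minors. -/

namespace IsWignerFamily

variable {Ω : Type*} [MeasurableSpace Ω] {Q : Measure ℝ} [IsProbabilityMeasure Q] {P : Measure Ω}
  [IsProbabilityMeasure P] {d : ℕ → Ω → ℝ} {u v : ℕ → ℕ → Ω → ℝ}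

omit [IsProbabilityMeasure Q] [IsProbabilityMeasure P] in
/-- Passing to a subsequence of indices turns a Wigner family into a Wigner family. -/
theorem relabel (hX : IsWignerFamily Q P d u v) {φ : ℕ → ℕ} (hφ : StrictMono φ) :
    IsWignerFamily Q P (fun i => d (φ i)) (fun i j => u (φ i) (φ j))
      (fun i j => v (φ i) (φ j)) := by
  let g : WignerLabel → WignerLabel := fun k => match k with
    | .diag i => .diag (φ i)
    | .re i j h => .re (φ i) (φ j) (hφ h)
    | .im i j h => .im (φ i) (φ j) (hφ h)
  have hg : Function.Injective g := by
    intro k l h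
    cases k <;> cases l <;> simp_all [g, hφ.injective.eq_iff]
  have he : wignerFamily (fun i => d (φ i)) (fun i j => u (φ i) (φ j))
      (fun i j => v (φ i) (φ j)) = fun k => wignerFamily d u v (g k) := by
    funext k
    cases k <;> rfl
  refine ⟨?_, ?_, ?_⟩
  · rw [he]; exact fun k => hX.measurable _
  · rw [he]; exact fun k => hX.law _
  · rw [he]; exact hX.indep.precomp hg

variable (hX : IsWignerFamily Q P d u v) (hfour : Integrable (fun x : ℝ => x ^ 4) Q)
include hX

omit [IsProbabilityMeasure Q] [IsProbabilityMeasure P] in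
theorem measurable_det (N : ℕ) (μ : ℂ) : Measurable fun ω => (shiftedMatrix d u v N μ ω).det :=
  (measurable_det_shiftedMatrix N μ).mono (hX.labelAlgebra_le _) le_rfl

omit [IsProbabilityMeasure Q] [IsProbabilityMeasure P] in
theorem measurable_adjugate (N : ℕ) (μ : ℂ) (i j : Fin N) :
    Measurable fun ω => (shiftedMatrix d u v N μ ω).adjugate i j :=
  (measurable_adjugate_shiftedMatrix N μ i j).mono (hX.labelAlgebra_le _) le_rfl

include hfour

theorem integrable_det_mul_det (N : ℕ) (μ ν : ℂ) :
    Integrable (fun ω => (shiftedMatrix d u v N μ ω).det * (shiftedMatrix d u v N ν ω).det) P :=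
  hX.integrable_of_le_entryBound hfour (hX.measurable_det N μ) (hX.measurable_det N ν)
    (minorConst_nonneg N ((norm_nonneg μ).trans (le_max_left _ ‖ν‖)))
    (norm_det_shiftedMatrix_le N (le_max_left _ _)) (norm_det_shiftedMatrix_le N (le_max_right _ _))

theorem integrable_det_mul_adjugate (N : ℕ) (μ ν : ℂ) (i j : Fin N) :
    Integrable (fun ω => (shiftedMatrix d u v N μ ω).det *
      (shiftedMatrix d u v N ν ω).adjugate i j) P :=
  hX.integrable_of_le_entryBound hfour (hX.measurable_det N μ) (hX.measurable_adjugate N ν i j)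
    (minorConst_nonneg N ((norm_nonneg μ).trans (le_max_left _ ‖ν‖)))
    (norm_det_shiftedMatrix_le N (le_max_left _ _))
    (fun ω => norm_adjugate_shiftedMatrix_le N (le_max_right _ _) ω i j)

theorem integrable_adjugate_mul_adjugate (N : ℕ) (μ ν : ℂ) (i j k l : Fin N) :
    Integrable (fun ω => (shiftedMatrix d u v N μ ω).adjugate i j *
      (shiftedMatrix d u v N ν ω).adjugate k l) P :=
  hX.integrable_of_le_entryBound hfour (hX.measurable_adjugate N μ i j)
    (hX.measurable_adjugate N ν k l)
    (minorConst_nonneg N ((norm_nonneg μ).trans (le_max_left _ ‖ν‖)))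
    (fun ω => norm_adjugate_shiftedMatrix_le N (le_max_left _ _) ω i j)
    (fun ω => norm_adjugate_shiftedMatrix_le N (le_max_right _ _) ω k l)

/-- Differentiation under the expectation. -/
theorem hasDerivAt_integral_det_mul (N : ℕ) {g : Ω → ℂ} (hg : Measurable g) {C : ℝ} (hC : 0 ≤ C)
    (hgb : ∀ ω, ‖g ω‖ ≤ C * entryBound d u v N ω) (μ : ℂ) :
    HasDerivAt (fun μ => ∫ ω, (shiftedMatrix d u v N μ ω).det * g ω ∂P)
      (-∑ i, ∫ ω, (shiftedMatrix d u v N μ ω).adjugate i i * g ω ∂P) μ := by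
  -- The dominating function must serve all shifts in the unit ball around `μ`, hence the radius
  -- enlarged by one.
  set R := ‖μ‖ + 1 with hR
  have hR0 : 0 ≤ R := by positivity
  set K := max C (minorConst N R) with hK
  have hK0 : 0 ≤ K := hC.trans (le_max_left _ _)
  have hW : ∀ ω, 0 ≤ entryBound d u v N ω := fun ω =>
    zero_le_one.trans (one_le_entryBound N ω)
  have hgb' : ∀ ω, ‖g ω‖ ≤ K * entryBound d u v N ω := fun ω =>
    (hgb ω).trans (mul_le_mul_of_nonneg_right (le_max_left _ _) (hW ω))
  have hball : ∀ z ∈ Metric.ball μ 1, ‖z‖ ≤ R := by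
    intro z hz
    rw [mem_ball_iff_norm] at hz
    calc ‖z‖ = ‖(z - μ) + μ‖ := by simp
      _ ≤ ‖z - μ‖ + ‖μ‖ := norm_add_le _ _
      _ ≤ R := by rw [hR]; linarith
  have hμR : ‖μ‖ ≤ R := hball μ (Metric.mem_ball_self one_pos)
  have hadj : ∀ z, ‖z‖ ≤ R → ∀ i j ω, ‖(shiftedMatrix d u v N z ω).adjugate i j‖ ≤
      K * entryBound d u v N ω := fun z hz i j ω =>
    (norm_adjugate_shiftedMatrix_le N hz ω i j).trans
      (mul_le_mul_of_nonneg_right (le_max_right _ _) (hW ω))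
  have hdet : ∀ z, ‖z‖ ≤ R → ∀ ω, ‖(shiftedMatrix d u v N z ω).det‖ ≤
      K * entryBound d u v N ω := fun z hz ω =>
    (norm_det_shiftedMatrix_le N hz ω).trans
      (mul_le_mul_of_nonneg_right (le_max_right _ _) (hW ω))
  have hm : ∀ z, Measurable fun ω => -(shiftedMatrix d u v N z ω).adjugate.trace * g ω := by
    intro z
    have h : Measurable fun ω => (shiftedMatrix d u v N z ω).adjugate.trace := by
      simp only [Matrix.trace, Matrix.diag_apply]
      exact Finset.measurable_sum _ fun i _ => hX.measurable_adjugate N z i i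
    exact h.neg.mul hg
  have key := hasDerivAt_integral_of_dominated_loc_of_deriv_le
    (F := fun z ω => (shiftedMatrix d u v N z ω).det * g ω)
    (F' := fun z ω => -(shiftedMatrix d u v N z ω).adjugate.trace * g ω)
    (bound := fun ω => (N * K ^ 2) * entryBound d u v N ω ^ 2) (μ := P) (x₀ := μ)
    (Metric.ball_mem_nhds μ one_pos)
    (Eventually.of_forall fun z => ((hX.measurable_det N z).mul hg).aestronglyMeasurable)
    (hX.integrable_of_le_entryBound hfour (hX.measurable_det N μ) hg hK0 (hdet μ hμR) hgb')
    (hm μ).aestronglyMeasurable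
    (ae_of_all _ fun ω z hz => ?_)
    ((hX.integrable_entryBound_sq hfour N).const_mul _)
    (ae_of_all _ fun ω z _ => (hasDerivAt_det_sub_smul_one _ z).mul_const (g ω))
  · refine key.2.congr_deriv ?_
    have : ∀ ω, -(shiftedMatrix d u v N μ ω).adjugate.trace * g ω =
        -∑ i, (shiftedMatrix d u v N μ ω).adjugate i i * g ω := by
      intro ω
      rw [Matrix.trace, neg_mul, Finset.sum_mul]
      rfl
    rw [integral_congr_ae (ae_of_all _ this), integral_neg, integral_finsetSum]
    intro i _
    exact hX.integrable_of_le_entryBound hfour (hX.measurable_adjugate N μ i i) hg hK0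
      (hadj μ hμR i i) hgb'
  · rw [norm_mul, norm_neg]
    have h1 : ‖(shiftedMatrix d u v N z ω).adjugate.trace‖ ≤ N * (K * entryBound d u v N ω) := by
      refine (norm_sum_le _ _).trans ?_
      refine (Finset.sum_le_sum fun i _ => hadj z (hball z hz) i i ω).trans ?_
      simp
    calc _ ≤ (N * (K * entryBound d u v N ω)) * (K * entryBound d u v N ω) :=
          mul_le_mul h1 (hgb' ω) (norm_nonneg _)
            (mul_nonneg (Nat.cast_nonneg N) (mul_nonneg hK0 (hW ω)))
      _ = _ := by ring

theorem sub_mul_integral_trace (N : ℕ) (μ ν : ℂ) :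
    (μ - ν) * ∑ i, ∑ k, ∫ ω, (shiftedMatrix d u v N μ ω).adjugate i k *
        (shiftedMatrix d u v N ν ω).adjugate k i ∂P =
      ∑ i, ∫ ω, (shiftedMatrix d u v N ν ω).det * (shiftedMatrix d u v N μ ω).adjugate i i ∂P -
      ∑ i, ∫ ω, (shiftedMatrix d u v N μ ω).det *
        (shiftedMatrix d u v N ν ω).adjugate i i ∂P := by
  rw [Finset.mul_sum, ← Finset.sum_sub_distrib]
  refine Finset.sum_congr rfl fun i _ => ?_
  rw [← integral_finsetSum _ fun k _ => hX.integrable_adjugate_mul_adjugate hfour N μ ν i k k i,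
    ← integral_const_mul, ← integral_sub (hX.integrable_det_mul_adjugate hfour N ν μ i i)
      (hX.integrable_det_mul_adjugate hfour N μ ν i i)]
  congr 1
  funext ω
  have h := congrFun (congrFun (smul_adjugate_mul_adjugate (wignerMatrix d u v N ω) μ ν) i) i
  simpa [Matrix.mul_apply, shiftedMatrix] using h

omit hX hfour [MeasurableSpace Ω] [IsProbabilityMeasure Q] in
-- Deleting row and column `i` reindexes by the increasing map that skips `i`. Monotonicity
-- preserves the distinction between entries above and below the diagonal, so the minor is again a
-- shifted Wigner matrix and `relabel` applies to it.
theorem adjugate_shiftedMatrix_diag (N : ℕ) (μ : ℂ) (i : Fin (N + 1)) (ω : Ω) :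
    (shiftedMatrix d u v (N + 1) μ ω).adjugate i i =
      (shiftedMatrix (fun k => d (if k < (i : ℕ) then k else k + 1))
        (fun k l => u (if k < (i : ℕ) then k else k + 1) (if l < (i : ℕ) then l else l + 1))
        (fun k l => v (if k < (i : ℕ) then k else k + 1) (if l < (i : ℕ) then l else l + 1))
        N μ ω).det := by
  rw [Matrix.adjugate_fin_succ_eq_det_submatrix, ← two_mul, pow_mul]
  simp only [even_two, Even.neg_pow, one_pow, one_mul]
  congr 1
  have hs : ∀ k : Fin N, ((i.succAbove k : Fin (N + 1)) : ℕ) =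
      if (k : ℕ) < (i : ℕ) then (k : ℕ) else k + 1 := by
    intro k
    rw [Fin.succAbove]
    simp only [Fin.lt_def, Fin.val_castSucc]
    split_ifs <;> simp
  ext k l
  simp only [Matrix.submatrix_apply, shiftedMatrix, Matrix.sub_apply, wignerMatrix, Matrix.of_apply,
    Matrix.smul_apply]
  congr 1
  · rw [hs, hs]
    simp only [wignerEntry]
    have h1 : ((if (k : ℕ) < (i : ℕ) then (k : ℕ) else k + 1) =
        if (l : ℕ) < (i : ℕ) then (l : ℕ) else l + 1) ↔ (k : ℕ) = l := by
      split_ifs <;> omega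
    have h2 : ((if (k : ℕ) < (i : ℕ) then (k : ℕ) else k + 1) <
        if (l : ℕ) < (i : ℕ) then (l : ℕ) else l + 1) ↔ (k : ℕ) < l := by
      split_ifs <;> omega
    simp only [h1, h2]
  · simp [Matrix.one_apply]

end IsWignerFamily

/-! ### The recurrence determines the correlation functions. -/

/-- A family of functions that satisfies the recurrence of the correlation functions coincides
with it. -/
theorem IsWignerFamily.corrFun_eq {Ω : Type*} [MeasurableSpace Ω] {Q : Measure ℝ}
    [IsProbabilityMeasure Q] {P : Measure Ω} [IsProbabilityMeasure P]
    (hmean : ∫ x, x ∂Q = 0) (hvar : ∫ x, x ^ 2 ∂Q = 1 / 2)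
    (hfour : Integrable (fun x : ℝ => x ^ 4) Q)
    {F F10 F01 F11 : ℕ → ℂ → ℂ → ℂ} (h0 : ∀ μ ν, F 0 μ ν = 1)
    (h10 : ∀ n μ ν, HasDerivAt (fun μ => F n μ ν) (F10 n μ ν) μ)
    (h01 : ∀ n μ ν, HasDerivAt (fun ν => F n μ ν) (F01 n μ ν) ν)
    (h11 : ∀ n μ ν, HasDerivAt (fun ν => F10 n μ ν) (F11 n μ ν) ν)
    (hrec : ∀ n μ ν, (μ - ν) * F (n + 1) μ ν = (μ - ν) * ((1 + μ * ν) * F n μ ν -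
      μ * F01 n μ ν - ν * F10 n μ ν + F11 n μ ν +
      ((2 * (∫ x, x ^ 4 ∂Q) - 3 / 2 : ℝ) : ℂ) * (n * F (n - 1) μ ν)) +
      (F01 n μ ν - F10 n μ ν)) (n : ℕ) :
    ∀ {d : ℕ → Ω → ℝ} {u v : ℕ → ℕ → Ω → ℝ}, IsWignerFamily Q P d u v →
      ∀ μ ν, corrFun P d u v n μ ν = F n μ ν := by
  -- The claim ranges over all Wigner families with law `Q` on `P`, because the minors belong to a
  -- relabelled family. Strong induction is needed since the recurrence reaches back two steps.
  induction n using Nat.strong_induction_on with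
  | _ n ih =>
  intro d u v hX
  rcases n with _ | n
  · intro μ ν
    simp [corrFun, charPolyProd, h0]
  have hbd : ∀ m (μ : ℂ) ω, ‖(shiftedMatrix d u v m μ ω).det‖ ≤
    minorConst m ‖μ‖ * entryBound d u v m ω := fun m μ ω => norm_det_shiftedMatrix_le m le_rfl ω
  have hba : ∀ m (μ : ℂ) i j ω, ‖(shiftedMatrix d u v m μ ω).adjugate i j‖ ≤
    minorConst m ‖μ‖ * entryBound d u v m ω :=
    fun m μ i j ω => norm_adjugate_shiftedMatrix_le m le_rfl ω i j
  have hF : ∀ μ ν, ∫ ω, (shiftedMatrix d u v n μ ω).det * (shiftedMatrix d u v n ν ω).det ∂P =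
      F n μ ν := fun μ ν => ih n (Nat.lt_succ_self n) hX μ ν
  have hF10 : ∀ μ ν, ∑ i, ∫ ω, (shiftedMatrix d u v n ν ω).det *
      (shiftedMatrix d u v n μ ω).adjugate i i ∂P = -F10 n μ ν := by
    intro μ ν
    have h := hX.hasDerivAt_integral_det_mul hfour n (hX.measurable_det n ν)
      (minorConst_nonneg n (norm_nonneg ν)) (hbd n ν) μ
    simp_rw [hF] at h
    rw [← h.unique (h10 n μ ν), neg_neg]
    simp_rw [mul_comm]
  have hF01 : ∀ μ ν, ∑ i, ∫ ω, (shiftedMatrix d u v n μ ω).det *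
      (shiftedMatrix d u v n ν ω).adjugate i i ∂P = -F01 n μ ν := by
    intro μ ν
    have h := hX.hasDerivAt_integral_det_mul hfour n (hX.measurable_det n μ)
      (minorConst_nonneg n (norm_nonneg μ)) (hbd n μ) ν
    have h' := h01 n μ ν
    simp_rw [← hF, mul_comm (Matrix.det (shiftedMatrix d u v n μ _))] at h'
    rw [← h.unique h', neg_neg]
    simp_rw [mul_comm]
  have hF11 : ∀ μ ν, ∑ i, ∑ k, ∫ ω, (shiftedMatrix d u v n μ ω).adjugate i i *
      (shiftedMatrix d u v n ν ω).adjugate k k ∂P = F11 n μ ν := by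
    intro μ ν
    have h : HasDerivAt (fun ν => -∑ i, ∫ ω, (shiftedMatrix d u v n ν ω).det *
        (shiftedMatrix d u v n μ ω).adjugate i i ∂P) _ ν :=
      (HasDerivAt.fun_sum fun i _ => hX.hasDerivAt_integral_det_mul hfour n
        (hX.measurable_adjugate n μ i i) (minorConst_nonneg n (norm_nonneg μ))
        (hba n μ i i) ν).fun_neg
    simp_rw [hF10, neg_neg] at h
    rw [← h.unique (h11 n μ ν), Finset.sum_neg_distrib, neg_neg]
    simp_rw [mul_comm]
  have hmin : ∀ μ ν, ∑ i, ∫ ω, (shiftedMatrix d u v n μ ω).adjugate i i *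
          (shiftedMatrix d u v n ν ω).adjugate i i ∂P = n * F (n - 1) μ ν := by
    intro μ ν
    -- For `n = 0` the truncated index `n - 1` is harmless: the factor `n` vanishes.
    rcases n with _ | m
    · simp
    · have h : ∀ i : Fin (m + 1), ∫ ω, (shiftedMatrix d u v (m + 1) μ ω).adjugate i i *
          (shiftedMatrix d u v (m + 1) ν ω).adjugate i i ∂P = F m μ ν := by
        intro i
        have hφ : StrictMono fun k : ℕ => if k < (i : ℕ) then k else k + 1 := by
          intro k l hkl
          simp only
          split_ifs <;> omega
        simp_rw [adjugate_shiftedMatrix_diag]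
        exact ih m (by omega) (hX.relabel hφ) μ ν
      simp_rw [h]
      simp
  have hne : ∀ μ ν, μ ≠ ν → corrFun P d u v (n + 1) μ ν = F (n + 1) μ ν := by
    intro μ ν hμν
    have h1 := hX.sub_mul_integral_trace hfour n μ ν
    have h2 := hrec n μ ν
    rw [hF10 μ ν, hF01 μ ν] at h1
    apply mul_left_cancel₀ (sub_ne_zero.mpr hμν)
    rw [h2, hX.corrFun_succ_eq hmean hvar hfour, hF μ ν, hF10 μ ν, hF01 μ ν, hF11, hmin,
      mul_add, mul_add, h1]
    ring
  intro μ ν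
  -- The recurrence carries a factor `μ - ν`, so the diagonal is reached by continuity.
  by_cases hμν : μ = ν
  · have hc1 : Continuous fun μ => corrFun P d u v (n + 1) μ ν :=
      continuous_iff_continuousAt.mpr fun μ =>
        (hX.hasDerivAt_integral_det_mul hfour (n + 1) (hX.measurable_det (n + 1) ν)
        (minorConst_nonneg (n + 1) (norm_nonneg ν)) (hbd (n + 1) ν) μ).continuousAt
    have hc2 : Continuous fun μ => F (n + 1) μ ν :=
      continuous_iff_continuousAt.mpr fun μ => (h10 (n + 1) μ ν).continuousAt
    have := Continuous.ext_on (dense_compl_singleton ν) hc1 hc2 fun z hz => hne z ν hz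
    exact congrFun this μ
  · exact hne μ ν hμν

/-! ### The generating function and its coefficients as circle integrals. -/

theorem hasDerivAt_intervalIntegral_of_continuous {a b : ℝ} {F F' : ℂ → ℝ → ℂ}
    (hF : Continuous fun x : ℂ × ℝ => F x.1 x.2) (hF' : Continuous fun x : ℂ × ℝ => F' x.1 x.2)
    (hd : ∀ z t, HasDerivAt (fun z => F z t) (F' z t) z) (z₀ : ℂ) :
    HasDerivAt (fun z => ∫ t in a..b, F z t) (∫ t in a..b, F' z₀ t) z₀ := by
  have hFc : ∀ z, Continuous (F z) := fun z => hF.comp (Continuous.prodMk_right z)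
  have hFc' : ∀ z, Continuous (F' z) := fun z => hF'.comp (Continuous.prodMk_right z)
  have hK : IsCompact (Metric.closedBall z₀ 1 ×ˢ Set.uIcc a b) :=
    (isCompact_closedBall z₀ 1).prod isCompact_uIcc
  obtain ⟨C, hC⟩ := hK.exists_bound_of_continuousOn hF'.continuousOn
  refine (intervalIntegral.hasDerivAt_integral_of_dominated_loc_of_deriv_le
    (bound := fun _ => C) (Metric.ball_mem_nhds z₀ one_pos)
    (Eventually.of_forall fun z => (hFc z).aestronglyMeasurable)
    ((hFc z₀).intervalIntegrable a b) (hFc' z₀).aestronglyMeasurable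
    (ae_of_all _ fun t ht z hz => ?_) intervalIntegrable_const
    (ae_of_all _ fun t _ z _ => hd z t)).2
  exact hC (z, t) ⟨Metric.ball_subset_closedBall hz, Set.uIoc_subset_uIcc ht⟩

/-- The exponential generating function of the correlation functions. -/
def corrGenFun (β μ ν z : ℂ) : ℂ :=
  Complex.exp (μ * ν * (z / (1 - z ^ 2)) - (μ ^ 2 + ν ^ 2) / 2 * (z ^ 2 / (1 - z ^ 2))) *
    (Complex.exp (β * z ^ 2) * ((1 - z) ^ (-(3 / 2) : ℂ) * (1 + z) ^ (-(1 / 2) : ℂ)))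

section UnitDisc

variable {z : ℂ} (hz : ‖z‖ < 1)
include hz

theorem one_sub_mem_slitPlane_of_norm_lt_one : 1 - z ∈ Complex.slitPlane := by
  left
  have := (Complex.re_le_norm z).trans_lt hz
  simp; linarith

theorem one_add_mem_slitPlane_of_norm_lt_one : 1 + z ∈ Complex.slitPlane := by
  simpa using one_sub_mem_slitPlane_of_norm_lt_one (z := -z) (by simpa using hz)

theorem one_sub_ne_zero_of_norm_lt_one : 1 - z ≠ 0 :=
  Complex.slitPlane_ne_zero (one_sub_mem_slitPlane_of_norm_lt_one hz)

theorem one_add_ne_zero_of_norm_lt_one : 1 + z ≠ 0 :=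
  Complex.slitPlane_ne_zero (one_add_mem_slitPlane_of_norm_lt_one hz)

theorem one_sub_sq_ne_zero_of_norm_lt_one : 1 - z ^ 2 ≠ 0 := by
  have : 1 - z ^ 2 = (1 - z) * (1 + z) := by ring
  rw [this]
  exact mul_ne_zero (one_sub_ne_zero_of_norm_lt_one hz) (one_add_ne_zero_of_norm_lt_one hz)

/-- The logarithmic derivative in `z` is rational, so after dividing out the common factor the
recurrence becomes an identity of rational functions. -/
theorem hasDerivAt_corrGenFun (β μ ν : ℂ) :
    HasDerivAt (corrGenFun β μ ν) (corrGenFun β μ ν z *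
      (μ * ν * ((1 + z ^ 2) / (1 - z ^ 2) ^ 2) - (μ ^ 2 + ν ^ 2) * (z / (1 - z ^ 2) ^ 2) +
        2 * β * z + (3 / 2) / (1 - z) - (1 / 2) / (1 + z))) z := by
  have h1 := one_sub_ne_zero_of_norm_lt_one hz
  have h2 := one_add_ne_zero_of_norm_lt_one hz
  have h3 := one_sub_sq_ne_zero_of_norm_lt_one hz
  have hid := hasDerivAt_id' z
  have hden : HasDerivAt (fun z : ℂ => 1 - z ^ 2) (-(2 * z)) z := by
    simpa using (hid.fun_pow 2).const_sub 1
  have hsq : HasDerivAt (fun z : ℂ => z ^ 2) (2 * z) z := by simpa using hid.fun_pow 2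
  have hp := (hid.fun_div hden h3).const_mul (μ * ν)
  have hq := (hsq.fun_div hden h3).const_mul ((μ ^ 2 + ν ^ 2) / 2)
  have hE := (hp.fun_sub hq).cexp
  have hB := (hsq.const_mul β).cexp
  have hm1 := ((hid.const_sub 1).cpow_const (c := (-(3 / 2) : ℂ))
    (one_sub_mem_slitPlane_of_norm_lt_one hz))
  have hm2 := ((hid.const_add 1).cpow_const (c := (-(1 / 2) : ℂ))
    (one_add_mem_slitPlane_of_norm_lt_one hz))
  refine (hE.fun_mul (hB.fun_mul (hm1.fun_mul hm2))).congr_deriv ?_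
  rw [Complex.cpow_sub _ _ h1, Complex.cpow_sub _ _ h2, Complex.cpow_one, Complex.cpow_one,
    corrGenFun]
  have h4 : 1 - z ^ 2 = (1 - z) * (1 + z) := by ring
  set A := Complex.exp (μ * ν * (z / (1 - z ^ 2)) - (μ ^ 2 + ν ^ 2) / 2 * (z ^ 2 / (1 - z ^ 2)))
  set B := Complex.exp (β * z ^ 2)
  set C := (1 - z) ^ (-(3 / 2) : ℂ)
  set D := (1 + z) ^ (-(1 / 2) : ℂ)
  rw [h4]
  field_simp
  ring

end UnitDisc

section CircleCoefficients

variable {r : ℝ}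

/-- Integral over the circle of radius `r` that represents the `n`-th coefficient of a
holomorphic function, multiplied by `2 * π`. -/
def circleCoeff (r : ℝ) (n : ℕ) (f : ℂ → ℂ) : ℂ :=
  ∫ θ in (-(Real.pi / 2))..(3 * Real.pi / 2), f (circleMap 0 r θ) * (circleMap 0 r θ ^ n)⁻¹

theorem norm_circleMap_lt_one (h0 : 0 < r) (h1 : r < 1) (θ : ℝ) : ‖circleMap 0 r θ‖ < 1 := by
  simpa [abs_of_pos h0] using h1

theorem circleMap_ne_zero_of_pos (h0 : 0 < r) (θ : ℝ) : circleMap 0 r θ ≠ 0 := by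
  simp [circleMap, h0.ne']

theorem circleCoeff_zero_eq (h0 : 0 < r) (h1 : r < 1) {f : ℂ → ℂ}
    (hf : DifferentiableOn ℂ f (Metric.ball 0 1)) :
    circleCoeff r 0 f = 2 * Real.pi * f 0 := by
  have hcl : DiffContOnCl ℂ f (Metric.ball 0 r) := by
    refine DifferentiableOn.diffContOnCl (hf.mono ?_)
    rw [closure_ball _ h0.ne']
    exact Metric.closedBall_subset_ball h1
  have h := hcl.circleIntegral_sub_inv_smul (Metric.mem_ball_self h0)
  have hper : Function.Periodic (fun θ => f (circleMap 0 r θ)) (2 * Real.pi) :=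
    (periodic_circleMap 0 r).comp f
  -- Periodicity moves the interval to the standard one. The interval starting at `-π/2` splits at
  -- `π/2` into the half circles around `1` and `-1`.
  have h2 := hper.intervalIntegral_add_eq (-(Real.pi / 2)) 0
  have e1 : -(Real.pi / 2) + 2 * Real.pi = 3 * Real.pi / 2 := by ring
  rw [e1, zero_add] at h2
  simp only [circleCoeff, pow_zero, inv_one, mul_one]
  rw [h2]
  rw [circleIntegral] at h
  have h3 : ∀ θ : ℝ, deriv (circleMap 0 r) θ • ((circleMap 0 r θ - 0)⁻¹ • f (circleMap 0 r θ)) =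
      Complex.I * f (circleMap 0 r θ) := by
    intro θ
    have := circleMap_ne_zero_of_pos h0 θ
    simp only [deriv_circleMap, smul_eq_mul, sub_zero]
    field_simp
  simp_rw [h3] at h
  rw [intervalIntegral.integral_const_mul] at h
  have := Complex.I_ne_zero
  apply mul_left_cancel₀ this
  rw [h, smul_eq_mul]; ring

/-- Integration by parts: the `θ`-derivative of `f z / z^(n+1)` integrates to zero over a full
period. -/
theorem circleCoeff_succ (h0 : 0 < r) (h1 : r < 1) {f f' : ℂ → ℂ}
    (hf : ∀ z, ‖z‖ < 1 → HasDerivAt f (f' z) z) (hf' : ContinuousOn f' (Metric.ball 0 1)) (n : ℕ) :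
    (n + 1) * circleCoeff r (n + 1) f = circleCoeff r n f' := by
  have hcm := continuous_circleMap 0 r
  have hne := circleMap_ne_zero_of_pos h0
  have hlt := norm_circleMap_lt_one h0 h1
  have hfc : Continuous fun θ => f (circleMap 0 r θ) := by
    refine continuous_iff_continuousAt.mpr fun θ => ?_
    exact (hf _ (hlt θ)).continuousAt.comp hcm.continuousAt
  have hfc' : Continuous fun θ => f' (circleMap 0 r θ) :=
    hf'.comp_continuous hcm fun θ => by simpa using hlt θ
  have hinv : ∀ n : ℕ, Continuous fun θ => (circleMap 0 r θ ^ n)⁻¹ := fun n =>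
    (hcm.pow n).inv₀ fun θ => pow_ne_zero n (hne θ)
  have hder : ∀ θ, HasDerivAt (fun θ => f (circleMap 0 r θ) * (circleMap 0 r θ ^ (n + 1))⁻¹)
      (Complex.I * (f' (circleMap 0 r θ) * (circleMap 0 r θ ^ n)⁻¹ -
        (n + 1) * (f (circleMap 0 r θ) * (circleMap 0 r θ ^ (n + 1))⁻¹))) θ := by
    intro θ
    have hc := hasDerivAt_circleMap 0 r θ
    have h2 := (hf _ (hlt θ)).comp_of_eq θ hc rfl
    have h3 := (hc.fun_pow (n + 1)).fun_inv (pow_ne_zero _ (hne θ))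
    refine (h2.mul h3).congr_deriv ?_
    have := hne θ
    simp only [Function.comp_apply, Nat.add_sub_cancel]
    push_cast
    field_simp
    ring
  have hint := intervalIntegral.integral_eq_sub_of_hasDerivAt (a := -(Real.pi / 2))
    (b := 3 * Real.pi / 2) (fun θ _ => hder θ)
    ((continuous_const.mul ((hfc'.mul (hinv n)).sub (continuous_const.mul
      (hfc.mul (hinv (n + 1)))))).intervalIntegrable _ _)
  have hend : circleMap 0 r (3 * Real.pi / 2) = circleMap 0 r (-(Real.pi / 2)) := by
    rw [← periodic_circleMap 0 r (-(Real.pi / 2))]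
    congr 1; ring
  have hi1 : IntervalIntegrable (fun θ => f' (circleMap 0 r θ) * (circleMap 0 r θ ^ n)⁻¹) volume
      (-(Real.pi / 2)) (3 * Real.pi / 2) := (hfc'.mul (hinv n)).intervalIntegrable _ _
  have hi2 : IntervalIntegrable (fun θ => (n + 1 : ℂ) *
      (f (circleMap 0 r θ) * (circleMap 0 r θ ^ (n + 1))⁻¹)) volume
      (-(Real.pi / 2)) (3 * Real.pi / 2) :=
    (continuous_const.mul (hfc.mul (hinv (n + 1)))).intervalIntegrable _ _
  rw [hend, sub_self, intervalIntegral.integral_const_mul,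
    intervalIntegral.integral_sub hi1 hi2,
    intervalIntegral.integral_const_mul] at hint
  have h4 := (mul_eq_zero.mp hint).resolve_left Complex.I_ne_zero
  exact (sub_eq_zero.mp h4).symm

end CircleCoefficients

section QuadraticExponential

variable {P Q W : ℝ → ℂ} (hP : Continuous P) (hQ : Continuous Q) (hW : Continuous W)
include hP hQ hW

/-- On the circle, `corrGenFun` depends on `μ, ν` only through this exponential, with `P = z/(1-z²)`
and `Q = z²/(1-z²)`; all other factors go into `W`. -/
theorem hasDerivAt_integral_exp_quadratic_left (a b : ℝ) (μ ν : ℂ) :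
    HasDerivAt (fun μ => ∫ t in a..b, Complex.exp (μ * ν * P t - (μ ^ 2 + ν ^ 2) / 2 * Q t) * W t)
      (∫ t in a..b, (ν * P t - μ * Q t) *
        (Complex.exp (μ * ν * P t - (μ ^ 2 + ν ^ 2) / 2 * Q t) * W t)) μ := by
  refine hasDerivAt_intervalIntegral_of_continuous
    (F := fun μ t => Complex.exp (μ * ν * P t - (μ ^ 2 + ν ^ 2) / 2 * Q t) * W t)
    (F' := fun μ t => (ν * P t - μ * Q t) *
        (Complex.exp (μ * ν * P t - (μ ^ 2 + ν ^ 2) / 2 * Q t) * W t))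
    (by fun_prop) (by fun_prop) (fun z t => ?_) μ
  have h1 := ((hasDerivAt_id' z).mul_const ν).mul_const (P t)
  have h2 := ((((hasDerivAt_id' z).fun_pow 2).add_const (ν ^ 2)).div_const 2).mul_const (Q t)
  refine ((h1.fun_sub h2).cexp.mul_const (W t)).congr_deriv ?_
  simp only [Nat.cast_ofNat]
  ring

theorem hasDerivAt_integral_exp_quadratic_right (a b : ℝ) (μ ν : ℂ) :
    HasDerivAt (fun ν => ∫ t in a..b, Complex.exp (μ * ν * P t - (μ ^ 2 + ν ^ 2) / 2 * Q t) * W t)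
      (∫ t in a..b, (μ * P t - ν * Q t) *
        (Complex.exp (μ * ν * P t - (μ ^ 2 + ν ^ 2) / 2 * Q t) * W t)) ν := by
  have h := hasDerivAt_integral_exp_quadratic_left hP hQ hW a b ν μ
  simpa only [mul_comm ν μ, add_comm (_ ^ 2) (μ ^ 2), mul_comm _ μ] using h

theorem hasDerivAt_integral_exp_quadratic_mixed (a b : ℝ) (μ ν : ℂ) :
    HasDerivAt (fun ν => ∫ t in a..b, (ν * P t - μ * Q t) *
        (Complex.exp (μ * ν * P t - (μ ^ 2 + ν ^ 2) / 2 * Q t) * W t))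
      (∫ t in a..b, (P t + (ν * P t - μ * Q t) * (μ * P t - ν * Q t)) *
        (Complex.exp (μ * ν * P t - (μ ^ 2 + ν ^ 2) / 2 * Q t) * W t)) ν := by
  refine hasDerivAt_intervalIntegral_of_continuous
    (F := fun ν t => (ν * P t - μ * Q t) *
        (Complex.exp (μ * ν * P t - (μ ^ 2 + ν ^ 2) / 2 * Q t) * W t))
    (F' := fun ν t => (P t + (ν * P t - μ * Q t) * (μ * P t - ν * Q t)) *
        (Complex.exp (μ * ν * P t - (μ ^ 2 + ν ^ 2) / 2 * Q t) * W t))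
    (by fun_prop) (by fun_prop) (fun z t => ?_) ν
  have h0 := ((hasDerivAt_id' z).mul_const (P t)).sub_const (μ * Q t)
  have h1 := ((hasDerivAt_id' z).const_mul μ).mul_const (P t)
  have h2 := ((((hasDerivAt_id' z).fun_pow 2).const_add (μ ^ 2)).div_const 2).mul_const (Q t)
  refine (h0.fun_mul ((h1.fun_sub h2).cexp.mul_const (W t))).congr_deriv ?_
  simp only [Nat.cast_ofNat]
  ring

end QuadraticExponential

theorem corrGenFun_zero (β μ ν : ℂ) : corrGenFun β μ ν 0 = 1 := by
  simp [corrGenFun]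

/-- Integral representation of the correlation function on the circle of radius `r`. -/
theorem IsWignerFamily.corrFun_eq_circleCoeff {Ω : Type*} [MeasurableSpace Ω] {Q : Measure ℝ}
    [IsProbabilityMeasure Q] {P : Measure Ω} [IsProbabilityMeasure P]
    {d : ℕ → Ω → ℝ} {u v : ℕ → ℕ → Ω → ℝ} (hX : IsWignerFamily Q P d u v)
    (hmean : ∫ x, x ∂Q = 0) (hvar : ∫ x, x ^ 2 ∂Q = 1 / 2)
    (hfour : Integrable (fun x : ℝ => x ^ 4) Q) {r : ℝ} (h0 : 0 < r) (h1 : r < 1)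
    (n : ℕ) (μ ν : ℂ) :
    corrFun P d u v n μ ν = n.factorial / (2 * Real.pi) *
      circleCoeff r n (corrGenFun (((∫ x, x ^ 4 ∂Q) - 3 / 4 : ℝ) : ℂ) μ ν) := by
  set β : ℂ := (((∫ x, x ^ 4 ∂Q) - 3 / 4 : ℝ) : ℂ) with hβ
  have hpi : (Real.pi : ℂ) ≠ 0 := by exact_mod_cast Real.pi_ne_zero
  have hcm := continuous_circleMap 0 r
  have hne := circleMap_ne_zero_of_pos h0
  have hlt := norm_circleMap_lt_one h0 h1
  set c := circleMap 0 r with hc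
  have hden : ∀ t, 1 - c t ^ 2 ≠ 0 := fun t => one_sub_sq_ne_zero_of_norm_lt_one (hlt t)
  -- The ingredients are introduced through existentials to keep them opaque to simplification until
  -- the final algebraic identity.
  obtain ⟨p, hp⟩ : ∃ p : ℝ → ℂ, ∀ t, p t = c t / (1 - c t ^ 2) := ⟨_, fun _ => rfl⟩
  obtain ⟨q, hq⟩ : ∃ q : ℝ → ℂ, ∀ t, q t = c t ^ 2 / (1 - c t ^ 2) := ⟨_, fun _ => rfl⟩
  obtain ⟨w, hw⟩ : ∃ w : ℕ → ℝ → ℂ, ∀ n t, w n t = (Complex.exp (β * c t ^ 2) *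
    ((1 - c t) ^ (-(3 / 2) : ℂ) * (1 + c t) ^ (-(1 / 2) : ℂ))) * (c t ^ n)⁻¹ :=
    ⟨_, fun _ _ => rfl⟩
  have hpc : Continuous p := by
    rw [funext hp]; exact hcm.div (by fun_prop) hden
  have hqc : Continuous q := by
    rw [funext hq]; exact (hcm.pow 2).div (by fun_prop) hden
  have hwc : ∀ n, Continuous (w n) := by
    intro n
    rw [funext (hw n)]
    refine Continuous.mul (Continuous.mul (by fun_prop) (Continuous.mul ?_ ?_))
      ((hcm.pow n).inv₀ fun t => pow_ne_zero n (hne t))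
    · exact (continuous_const.sub hcm).cpow continuous_const fun t =>
        one_sub_mem_slitPlane_of_norm_lt_one (hlt t)
    · exact (continuous_const.add hcm).cpow continuous_const fun t =>
        one_add_mem_slitPlane_of_norm_lt_one (hlt t)
  obtain ⟨G, hG⟩ : ∃ G : ℕ → ℂ → ℂ → ℝ → ℂ, ∀ n μ ν t, G n μ ν t =
    Complex.exp (μ * ν * p t - (μ ^ 2 + ν ^ 2) / 2 * q t) * w n t := ⟨_, fun _ _ _ _ => rfl⟩
  have hGc : ∀ n μ ν, Continuous (G n μ ν) := by
    intro n μ ν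
    have := hwc n
    rw [funext (hG n μ ν)]
    fun_prop
  have hGe : ∀ n μ ν t, corrGenFun β μ ν (c t) * (c t ^ n)⁻¹ = G n μ ν t := by
    intro n μ ν t
    rw [hG, hp, hq, hw, corrGenFun]; ring
  have hcoeff : ∀ n μ ν, circleCoeff r n (corrGenFun β μ ν) =
      ∫ t in (-(Real.pi / 2))..(3 * Real.pi / 2), G n μ ν t := by
    intro n μ ν
    simp_rw [← hGe]
    rfl
  have hdiff : ∀ μ ν, DifferentiableOn ℂ (corrGenFun β μ ν) (Metric.ball 0 1) := fun μ ν z hz =>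
    (hasDerivAt_corrGenFun (by simpa using hz) β μ ν).differentiableAt.differentiableWithinAt
  refine IsWignerFamily.corrFun_eq hmean hvar hfour
    (F := fun n μ ν => n.factorial / (2 * Real.pi) * circleCoeff r n (corrGenFun β μ ν))
    (F10 := fun n μ ν => n.factorial / (2 * Real.pi) *
      ∫ t in (-(Real.pi / 2))..(3 * Real.pi / 2), (ν * p t - μ * q t) * G n μ ν t)
    (F01 := fun n μ ν => n.factorial / (2 * Real.pi) *
      ∫ t in (-(Real.pi / 2))..(3 * Real.pi / 2), (μ * p t - ν * q t) * G n μ ν t)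
    (F11 := fun n μ ν => n.factorial / (2 * Real.pi) *
      ∫ t in (-(Real.pi / 2))..(3 * Real.pi / 2),
        (p t + (ν * p t - μ * q t) * (μ * p t - ν * q t)) * G n μ ν t)
    ?_ ?_ ?_ ?_ ?_ n hX μ ν
  · intro μ ν
    rw [circleCoeff_zero_eq h0 h1 (hdiff μ ν), corrGenFun_zero, Nat.factorial_zero,
      Nat.cast_one]
    field_simp
  · intro n μ ν
    simp_rw [hcoeff, hG]
    exact (hasDerivAt_integral_exp_quadratic_left hpc hqc (hwc n) _ _ μ ν).const_mul _
  · intro n μ ν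
    simp_rw [hcoeff, hG]
    exact (hasDerivAt_integral_exp_quadratic_right hpc hqc (hwc n) _ _ μ ν).const_mul _
  · intro n μ ν
    simp_rw [hG]
    exact (hasDerivAt_integral_exp_quadratic_mixed hpc hqc (hwc n) _ _ μ ν).const_mul _
  · intro n μ ν
    have hzc : ContinuousOn (fun z => corrGenFun β μ ν z *
      (μ * ν * ((1 + z ^ 2) / (1 - z ^ 2) ^ 2) - (μ ^ 2 + ν ^ 2) * (z / (1 - z ^ 2) ^ 2) +
        2 * β * z + (3 / 2) / (1 - z) - (1 / 2) / (1 + z))) (Metric.ball 0 1) := by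
      have hl : ∀ z ∈ Metric.ball (0 : ℂ) 1, ‖z‖ < 1 := fun z hz => by simpa using hz
      refine (hdiff μ ν).continuousOn.mul ?_
      have e1 : ∀ z ∈ Metric.ball (0 : ℂ) 1, (1 - z ^ 2) ^ 2 ≠ 0 := fun z hz =>
        pow_ne_zero 2 (one_sub_sq_ne_zero_of_norm_lt_one (hl z hz))
      have e2 : ∀ z ∈ Metric.ball (0 : ℂ) 1, 1 - z ≠ 0 := fun z hz =>
        one_sub_ne_zero_of_norm_lt_one (hl z hz)
      have e3 : ∀ z ∈ Metric.ball (0 : ℂ) 1, 1 + z ≠ 0 := fun z hz =>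
        one_add_ne_zero_of_norm_lt_one (hl z hz)
      fun_prop (disch := assumption)
    have hsucc := circleCoeff_succ h0 h1 (fun z hz => hasDerivAt_corrGenFun hz β μ ν) hzc n
    have hlast : (((2 * (∫ x, x ^ 4 ∂Q) - 3 / 2 : ℝ) : ℂ)) * (n * (((n - 1).factorial : ℂ) /
        (2 * Real.pi) * circleCoeff r (n - 1) (corrGenFun β μ ν))) = n.factorial / (2 * Real.pi) *
        ∫ t in (-(Real.pi / 2))..(3 * Real.pi / 2), 2 * β * c t * G n μ ν t := by
      have hk : (((2 * (∫ x, x ^ 4 ∂Q) - 3 / 2 : ℝ) : ℂ)) = 2 * β := by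
        rw [hβ]; push_cast; ring
      have hint : ∫ t in (-(Real.pi / 2))..(3 * Real.pi / 2), 2 * β * c t * G n μ ν t =
          2 * β * ∫ t in (-(Real.pi / 2))..(3 * Real.pi / 2), c t * G n μ ν t := by
        rw [← intervalIntegral.integral_const_mul]
        simp_rw [mul_assoc]
      rw [hk, hint]
      -- Multiplication by `z` shifts coefficients by one. For `n = 0` the constant term of `z ·
      -- corrGenFun` is zero, in agreement with the factor `n`.
      rcases n with _ | n
      · have h := circleCoeff_zero_eq h0 h1 (f := fun z => z * corrGenFun β μ ν z)
          (differentiableOn_id.mul (hdiff μ ν))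
        have h' : circleCoeff r 0 (fun z => z * corrGenFun β μ ν z) =
            ∫ t in (-(Real.pi / 2))..(3 * Real.pi / 2), c t * G 0 μ ν t := by
          simp_rw [← hGe, circleCoeff, mul_assoc]
          rfl
        rw [← h', h]
        simp
      · have e : ∀ t, c t * G (n + 1) μ ν t = G n μ ν t := by
          intro t
          rw [← hGe, ← hGe, pow_succ]
          have := hne t
          field_simp
        simp_rw [e]
        rw [Nat.add_sub_cancel, hcoeff, Nat.factorial_succ]
        push_cast
        ring
    rw [hlast]
    have hcons : ∀ h : ℝ → ℂ, Continuous h → IntervalIntegrable (fun t => h t * G n μ ν t) volume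
        (-(Real.pi / 2)) (3 * Real.pi / 2) := fun h hh =>
      (hh.mul (hGc n μ ν)).intervalIntegrable _ _
    have hfac : ((n + 1).factorial : ℂ) / (2 * Real.pi) * circleCoeff r (n + 1) (corrGenFun β μ ν) =
        n.factorial / (2 * Real.pi) * ((n + 1) * circleCoeff r (n + 1) (corrGenFun β μ ν)) := by
      rw [Nat.factorial_succ]; push_cast; ring
    rw [hfac, hsucc, hcoeff]
    have hL : circleCoeff r n (fun z => corrGenFun β μ ν z *
      (μ * ν * ((1 + z ^ 2) / (1 - z ^ 2) ^ 2) - (μ ^ 2 + ν ^ 2) * (z / (1 - z ^ 2) ^ 2) +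
        2 * β * z + (3 / 2) / (1 - z) - (1 / 2) / (1 + z))) =
        ∫ t in (-(Real.pi / 2))..(3 * Real.pi / 2),
          (μ * ν * ((1 + c t ^ 2) / (1 - c t ^ 2) ^ 2) - (μ ^ 2 + ν ^ 2) *
            (c t / (1 - c t ^ 2) ^ 2) +
        2 * β * c t + (3 / 2) / (1 - c t) - (1 / 2) / (1 + c t)) * G n μ ν t := by
      simp_rw [← hGe, circleCoeff]
      congr 1; funext t; ring
    rw [hL]
    -- The recurrence holds already for the integrands: divided by the common factor `G n μ ν t`, it
    -- is a rational identity in `z`, `μ`, `ν`, `β`.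
    have hmain : (μ - ν) * ∫ t in (-(Real.pi / 2))..(3 * Real.pi / 2),
          (μ * ν * ((1 + c t ^ 2) / (1 - c t ^ 2) ^ 2) - (μ ^ 2 + ν ^ 2) *
            (c t / (1 - c t ^ 2) ^ 2) +
        2 * β * c t + (3 / 2) / (1 - c t) - (1 / 2) / (1 + c t)) * G n μ ν t =
        (μ - ν) * ((1 + μ * ν) * (∫ t in (-(Real.pi / 2))..(3 * Real.pi / 2), G n μ ν t) -
          μ * (∫ t in (-(Real.pi / 2))..(3 * Real.pi / 2), (μ * p t - ν * q t) * G n μ ν t) -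
          ν * (∫ t in (-(Real.pi / 2))..(3 * Real.pi / 2), (ν * p t - μ * q t) * G n μ ν t) +
          (∫ t in (-(Real.pi / 2))..(3 * Real.pi / 2),
            (p t + (ν * p t - μ * q t) * (μ * p t - ν * q t)) * G n μ ν t) +
          ∫ t in (-(Real.pi / 2))..(3 * Real.pi / 2), 2 * β * c t * G n μ ν t) +
        ((∫ t in (-(Real.pi / 2))..(3 * Real.pi / 2), (μ * p t - ν * q t) * G n μ ν t) -
          ∫ t in (-(Real.pi / 2))..(3 * Real.pi / 2), (ν * p t - μ * q t) * G n μ ν t) := by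
      have i0 : IntervalIntegrable (G n μ ν) volume (-(Real.pi / 2)) (3 * Real.pi / 2) :=
        (hGc n μ ν).intervalIntegrable _ _
      have i1 := hcons (fun t => μ * p t - ν * q t) (by fun_prop)
      have i2 := hcons (fun t => ν * p t - μ * q t) (by fun_prop)
      have i3 := hcons (fun t => p t + (ν * p t - μ * q t) * (μ * p t - ν * q t)) (by fun_prop)
      have i4 := hcons (fun t => 2 * β * c t) (by fun_prop)
      rw [← intervalIntegral.integral_const_mul, ← intervalIntegral.integral_const_mul,
        ← intervalIntegral.integral_const_mul, ← intervalIntegral.integral_const_mul,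
        ← intervalIntegral.integral_sub (i0.const_mul _) (i1.const_mul _),
        ← intervalIntegral.integral_sub ((i0.const_mul _).sub (i1.const_mul _)) (i2.const_mul _),
        ← intervalIntegral.integral_add
          (((i0.const_mul _).sub (i1.const_mul _)).sub (i2.const_mul _)) i3,
        ← intervalIntegral.integral_add
          ((((i0.const_mul _).sub (i1.const_mul _)).sub (i2.const_mul _)).add i3) i4,
        ← intervalIntegral.integral_const_mul,
        ← intervalIntegral.integral_sub i1 i2,
        ← intervalIntegral.integral_add
          ((((((i0.const_mul _).sub (i1.const_mul _)).sub (i2.const_mul _)).add i3).add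
            i4).const_mul _) (i1.sub i2)]
      congr 1
      funext t
      have g1 := one_sub_ne_zero_of_norm_lt_one (hlt t)
      have g2 := one_add_ne_zero_of_norm_lt_one (hlt t)
      have g4 : 1 - c t ^ 2 = (1 - c t) * (1 + c t) := by ring
      rw [hp, hq, g4]
      generalize G n μ ν t = g
      generalize c t = z at *
      field_simp
      ring
    linear_combination ((n.factorial : ℂ) / (2 * Real.pi)) * hmain

/-! ### Fourier–Laplace transform of the Gamma density. -/

section GammaLaplace

open Set

theorem integrableOn_rpow_mul_exp_neg {a : ℝ} (ha : 0 < a) :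
    IntegrableOn (fun x : ℝ => x ^ (a - 1) * Real.exp (-x)) (Ioi 0) := by
  simpa only [mul_comm] using Real.GammaIntegral_convergent ha

theorem norm_cexp_neg_I_mul (y x : ℝ) : ‖Complex.exp (-(Complex.I * y * x))‖ = 1 := by
  have : -(Complex.I * y * x) = ((-(y * x) : ℝ) : ℂ) * Complex.I := by push_cast; ring
  rw [this, Complex.norm_exp_ofReal_mul_I]

theorem integrableOn_gamma_mul_cexp {a : ℝ} (ha : 0 < a) (y : ℝ) :
    IntegrableOn (fun x : ℝ => ((x ^ (a - 1) * Real.exp (-x) : ℝ) : ℂ) *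
      Complex.exp (-(Complex.I * y * x))) (Ioi 0) := by
  refine Integrable.mono' (integrableOn_rpow_mul_exp_neg ha) (by fun_prop) ?_
  refine (ae_restrict_iff' measurableSet_Ioi).mpr (ae_of_all _ fun x hx => ?_)
  rw [norm_mul, norm_cexp_neg_I_mul, mul_one, Complex.norm_real, Real.norm_eq_abs,
    abs_of_nonneg]
  have : 0 < x := hx
  positivity

/-- Integration by parts; the boundary terms vanish at infinity by exponential decay and at `0`
because `a > 0`. With the `y`-derivative of the transform this gives a first-order linear
differential equation. -/
theorem integral_gamma_mul_cexp_succ {a : ℝ} (ha : 0 < a) (y : ℝ) :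
    (1 + Complex.I * y) * ∫ x in Ioi (0 : ℝ), ((x ^ a * Real.exp (-x) : ℝ) : ℂ) *
      Complex.exp (-(Complex.I * y * x)) =
    a * ∫ x in Ioi (0 : ℝ), ((x ^ (a - 1) * Real.exp (-x) : ℝ) : ℂ) *
      Complex.exp (-(Complex.I * y * x)) := by
  have hder : ∀ x ∈ Ioi (0 : ℝ), HasDerivAt (fun x : ℝ => ((x ^ a * Real.exp (-x) : ℝ) : ℂ) *
      Complex.exp (-(Complex.I * y * x)))
      (a * (((x ^ (a - 1) * Real.exp (-x) : ℝ) : ℂ) * Complex.exp (-(Complex.I * y * x))) -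
        (1 + Complex.I * y) * (((x ^ a * Real.exp (-x) : ℝ) : ℂ) *
          Complex.exp (-(Complex.I * y * x)))) x := by
    intro x hx
    have h1 := ((Real.hasDerivAt_rpow_const (p := a) (Or.inl (ne_of_gt hx))).mul
      (hasDerivAt_neg x).exp).ofReal_comp
    have h2 := (((hasDerivAt_id x).ofReal_comp.const_mul (Complex.I * y)).fun_neg).cexp
    refine (h1.mul h2).congr_deriv ?_
    simp only [id, Pi.mul_apply]
    push_cast
    ring
  have hi1 := integrableOn_gamma_mul_cexp ha y
  have hi2 : IntegrableOn (fun x : ℝ => ((x ^ a * Real.exp (-x) : ℝ) : ℂ) *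
      Complex.exp (-(Complex.I * y * x))) (Ioi 0) := by
    simpa only [add_sub_cancel_right] using integrableOn_gamma_mul_cexp (a := a + 1) (by linarith) y
  have hcont : ContinuousWithinAt (fun x : ℝ => ((x ^ a * Real.exp (-x) : ℝ) : ℂ) *
      Complex.exp (-(Complex.I * y * x))) (Ici 0) 0 := by
    refine ContinuousAt.continuousWithinAt (ContinuousAt.mul ?_ (by fun_prop))
    exact Complex.continuous_ofReal.continuousAt.comp
      ((Real.continuousAt_rpow_const 0 a (Or.inr ha.le)).mul (by fun_prop))
  have hlim : Tendsto (fun x : ℝ => ((x ^ a * Real.exp (-x) : ℝ) : ℂ) *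
      Complex.exp (-(Complex.I * y * x))) atTop (𝓝 0) := by
    rw [tendsto_zero_iff_norm_tendsto_zero]
    have h := tendsto_rpow_mul_exp_neg_mul_atTop_nhds_zero a 1 one_pos
    refine h.congr' ?_
    filter_upwards [eventually_gt_atTop 0] with x hx
    rw [norm_mul, norm_cexp_neg_I_mul, mul_one, Complex.norm_real, Real.norm_eq_abs,
      abs_of_nonneg (by positivity)]
    simp
  have h := integral_Ioi_of_hasDerivAt_of_tendsto hcont hder
    ((hi1.const_mul _).sub (hi2.const_mul _)) hlim
  rw [integral_sub (hi1.const_mul _) (hi2.const_mul _), integral_const_mul, integral_const_mul] at h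
  simp only [Real.zero_rpow ha.ne', zero_mul, Complex.ofReal_zero, sub_zero] at h
  exact (sub_eq_zero.mp h).symm

theorem hasDerivAt_integral_gamma_mul_cexp {a : ℝ} (ha : 0 < a) (y : ℝ) :
    HasDerivAt (fun y : ℝ => ∫ x in Ioi (0 : ℝ), ((x ^ (a - 1) * Real.exp (-x) : ℝ) : ℂ) *
      Complex.exp (-(Complex.I * y * x)))
      (-Complex.I * ∫ x in Ioi (0 : ℝ), ((x ^ a * Real.exp (-x) : ℝ) : ℂ) *
      Complex.exp (-(Complex.I * y * x))) y := by
  have hx : ∀ x : ℝ, 0 < x → x ^ a = x ^ (a - 1) * x := fun x hx => by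
    rw [← Real.rpow_add_one hx.ne', sub_add_cancel]
  have hint : IntegrableOn (fun x : ℝ => x ^ a * Real.exp (-x)) (Ioi 0) := by
    simpa only [add_sub_cancel_right] using integrableOn_rpow_mul_exp_neg (a := a + 1) (by linarith)
  have key := hasDerivAt_integral_of_dominated_loc_of_deriv_le
    (F := fun (y x : ℝ) => ((x ^ (a - 1) * Real.exp (-x) : ℝ) : ℂ) *
      Complex.exp (-(Complex.I * y * x)))
    (F' := fun (y x : ℝ) => ((x ^ (a - 1) * Real.exp (-x) : ℝ) : ℂ) *
      (Complex.exp (-(Complex.I * y * x)) * (-(Complex.I * x))))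
    (bound := fun x => x ^ a * Real.exp (-x)) (μ := volume.restrict (Ioi 0)) (x₀ := y)
    (s := univ) univ_mem
    (Eventually.of_forall fun y => (by fun_prop))
    (integrableOn_gamma_mul_cexp ha y) (by fun_prop)
    ((ae_restrict_iff' measurableSet_Ioi).mpr (ae_of_all _ fun x hx0 z _ => ?_))
    hint
    (ae_of_all _ fun x z _ => ?_)
  · refine key.2.congr_deriv ?_
    rw [← integral_const_mul]
    refine setIntegral_congr_fun measurableSet_Ioi fun x hx0 => ?_
    simp only [hx x hx0]
    push_cast
    ring
  · have h0 : 0 < x := hx0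
    rw [norm_mul, norm_mul, norm_cexp_neg_I_mul, hx x h0]
    simp only [Complex.norm_real, Real.norm_eq_abs, norm_neg, norm_mul, Complex.norm_I, one_mul]
    rw [abs_of_pos h0, Real.abs_exp, abs_of_nonneg (Real.rpow_nonneg h0.le _)]
    apply le_of_eq; ring
  · have h2 : HasDerivAt (fun z : ℝ => -(Complex.I * (z : ℂ) * x)) (-(Complex.I * x)) z := by
      refine ((((hasDerivAt_id z).ofReal_comp.const_mul Complex.I).mul_const (x :
        ℂ)).fun_neg).congr_deriv ?_
      simp
    exact h2.cexp.const_mul _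

theorem one_add_I_mul_mem_slitPlane (y : ℝ) : 1 + Complex.I * y ∈ Complex.slitPlane := by
  left; simp

/-- The Fourier–Laplace transform of the Gamma density. -/
theorem integral_gamma_mul_cexp {a : ℝ} (ha : 0 < a) (y : ℝ) :
    ∫ x in Ioi (0 : ℝ), ((x ^ (a - 1) * Real.exp (-x) : ℝ) : ℂ) *
      Complex.exp (-(Complex.I * y * x)) = Real.Gamma a * (1 + Complex.I * y) ^ (-(a : ℂ)) := by
  set G : ℝ → ℂ := fun y => ∫ x in Ioi (0 : ℝ), ((x ^ (a - 1) * Real.exp (-x) : ℝ) : ℂ) *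
      Complex.exp (-(Complex.I * y * x)) with hG
  have hne : ∀ y : ℝ, 1 + Complex.I * y ≠ 0 := fun y =>
    Complex.slitPlane_ne_zero (one_add_I_mul_mem_slitPlane y)
  -- The power of `1 + i y` is the integrating factor; the constant is then read off at `y = 0`.
  have hder : ∀ y : ℝ, HasDerivAt (fun y : ℝ => G y * (1 + Complex.I * y) ^ (a : ℂ)) 0 y := by
    intro y
    have h1 := hasDerivAt_integral_gamma_mul_cexp ha y
    have h0 : HasDerivAt (fun y : ℝ => 1 + Complex.I * (y : ℂ)) Complex.I y := by
      simpa using ((hasDerivAt_id y).ofReal_comp.const_mul Complex.I).const_add 1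
    have h2 : HasDerivAt (fun y : ℝ => (1 + Complex.I * (y : ℂ)) ^ (a : ℂ))
        (a * (1 + Complex.I * y) ^ ((a : ℂ) - 1) * Complex.I) y :=
      ((hasDerivAt_id (1 + Complex.I * (y : ℂ))).cpow_const
        (one_add_I_mul_mem_slitPlane y)).comp_of_eq y h0 rfl |>.congr_deriv (by simp)
    refine (h1.mul h2).congr_deriv ?_
    have hs := integral_gamma_mul_cexp_succ ha y
    rw [Complex.cpow_sub _ _ (hne y), Complex.cpow_one]
    have hney := hne y
    field_simp
    linear_combination (-Complex.I * (1 + Complex.I * y) ^ (a : ℂ)) * hs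
  have hconst := is_const_of_deriv_eq_zero (fun y => (hder y).differentiableAt)
    (fun y => (hder y).deriv) y 0
  have hG0 : G 0 = Real.Gamma a := by
    simp only [hG, Complex.ofReal_zero, mul_zero, zero_mul, neg_zero, Complex.exp_zero, mul_one]
    rw [integral_complex_ofReal, Real.Gamma_eq_integral ha]
    simp_rw [mul_comm]
  simp only [hG0, Complex.ofReal_zero, mul_zero, add_zero, Complex.one_cpow, mul_one] at hconst
  rw [Complex.cpow_neg, ← hconst, mul_inv_cancel_right₀]
  rw [Complex.cpow_def_of_ne_zero (hne y)]
  exact Complex.exp_ne_zero _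

end GammaLaplace

/-! ### Laplace inversion and the limit kernel. -/

section LaplaceInversion

open Set FourierTransform

theorem norm_one_add_I_mul_ge (t : ℝ) : (1 + |t|) / 2 ≤ ‖1 + Complex.I * t‖ := by
  have h1 : |(1 + Complex.I * t).re| ≤ ‖1 + Complex.I * t‖ := Complex.abs_re_le_norm _
  have h2 : |(1 + Complex.I * t).im| ≤ ‖1 + Complex.I * t‖ := Complex.abs_im_le_norm _
  simp at h1 h2
  linarith

theorem integrable_one_add_I_mul_cpow {a : ℝ} (ha : 1 < a) :
    Integrable (fun t : ℝ => (1 + Complex.I * t) ^ (-(a : ℂ))) := by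
  have hc : Continuous (fun t : ℝ => (1 + Complex.I * t) ^ (-(a : ℂ))) :=
    Continuous.cpow (by fun_prop) continuous_const one_add_I_mul_mem_slitPlane
  have h := integrable_one_add_norm (E := ℝ) (μ := volume) (r := a) (by simpa using ha)
  refine Integrable.mono' (h.const_mul ((2 : ℝ) ^ a)) hc.aestronglyMeasurable
    (ae_of_all _ fun t => ?_)
  rw [← Complex.ofReal_neg, Complex.norm_cpow_real, Real.norm_eq_abs]
  have h1 := norm_one_add_I_mul_ge t
  have h2 : 0 < (1 + |t|) / 2 := by positivity
  calc ‖1 + Complex.I * t‖ ^ (-a) ≤ ((1 + |t|) / 2) ^ (-a) :=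
        Real.rpow_le_rpow_of_nonpos h2 h1 (by linarith)
    _ = 2 ^ a * (1 + |t|) ^ (-a) := by
        rw [Real.div_rpow (by positivity) (by norm_num), Real.rpow_neg (by norm_num : (0:ℝ) ≤ 2),
          div_inv_eq_mul, mul_comm]

theorem integrable_cexp_mul_one_sub_I_mul_cpow {a : ℝ} (ha : 1 < a) (κ : ℝ) :
    Integrable (fun t : ℝ => Complex.exp (κ * (1 - Complex.I * t)) *
      (1 - Complex.I * t) ^ (-(a : ℂ))) := by
  have h := (integrable_one_add_I_mul_cpow ha).comp_neg
  simp only [Complex.ofReal_neg, mul_neg, ← sub_eq_add_neg] at h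
  refine h.bdd_mul (c := Real.exp κ) (by fun_prop) (ae_of_all _ fun t => ?_)
  rw [Complex.norm_exp]
  simp

/-- Laplace inversion for the powers of `s`, on the line `Re s = 1`. -/
theorem integral_cexp_mul_one_sub_I_mul_cpow {a : ℝ} (ha : 1 < a) {κ : ℝ} (hκ : 0 < κ) :
    ∫ t : ℝ, Complex.exp (κ * (1 - Complex.I * t)) * (1 - Complex.I * t) ^ (-(a : ℂ)) =
      ((2 * Real.pi * κ ^ (a - 1) / Real.Gamma a : ℝ) : ℂ) := by
  have ha0 : 0 < a := by linarith
  -- Fourier inversion of the unnormalised Gamma density at the continuity point `κ > 0`; its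
  -- transform is integrable because `a > 1`.
  set f : ℝ → ℂ := (Ioi (0 : ℝ)).indicator fun x => ((x ^ (a - 1) * Real.exp (-x) : ℝ) : ℂ) with hf
  have hfi : Integrable f :=
    (integrable_indicator_iff measurableSet_Ioi).mpr (integrableOn_rpow_mul_exp_neg ha0).ofReal
  have hF : 𝓕 f = fun w : ℝ => Real.Gamma a *
      (1 + Complex.I * ((2 * Real.pi * w : ℝ) : ℂ)) ^ (-(a : ℂ)) := by
    funext w
    rw [Real.fourier_real_eq_integral_exp_smul, ← integral_gamma_mul_cexp ha0,
      ← integral_indicator measurableSet_Ioi]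
    congr 1
    funext x
    by_cases hx : x ∈ Ioi (0 : ℝ)
    · rw [hf, indicator_of_mem hx, indicator_of_mem hx, smul_eq_mul, mul_comm]
      congr 2
      push_cast; ring
    · rw [hf, indicator_of_notMem hx, indicator_of_notMem hx, smul_zero]
  have hFi : Integrable (𝓕 f) := by
    rw [hF]
    exact ((integrable_one_add_I_mul_cpow ha).comp_mul_left'
      (by positivity : (2 * Real.pi) ≠ 0)).const_mul _
  have hcont : ContinuousAt f κ := by
    have : (fun x : ℝ => ((x ^ (a - 1) * Real.exp (-x) : ℝ) : ℂ)) =ᶠ[𝓝 κ] f := by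
      filter_upwards [Ioi_mem_nhds hκ] with x hx
      rw [hf, indicator_of_mem hx]
    refine ContinuousAt.congr ?_ this
    exact Complex.continuous_ofReal.continuousAt.comp
      ((Real.continuousAt_rpow_const κ _ (Or.inl hκ.ne')).mul (by fun_prop))
  have hinv := hfi.fourierInv_fourier_eq hFi hcont
  rw [Real.fourierInv_eq', hF] at hinv
  set g : ℝ → ℂ := fun y => Complex.exp (κ * (Complex.I * y)) *
    (1 + Complex.I * y) ^ (-(a : ℂ)) with hg
  have e1 : ∀ v : ℝ, Complex.exp (((2 * Real.pi * inner ℝ v κ : ℝ) : ℂ) * Complex.I) •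
      ((Real.Gamma a : ℂ) * (1 + Complex.I * ((2 * Real.pi * v : ℝ) : ℂ)) ^ (-(a : ℂ))) =
      Real.Gamma a * g (2 * Real.pi * v) := by
    intro v
    have : ((2 * Real.pi * inner ℝ v κ : ℝ) : ℂ) * Complex.I =
        κ * (Complex.I * ((2 * Real.pi * v : ℝ) : ℂ)) := by
      simp; ring
    rw [this, hg, smul_eq_mul]
    ring
  rw [integral_congr_ae (ae_of_all _ e1), integral_const_mul, Measure.integral_comp_mul_left,
    hf, indicator_of_mem (mem_Ioi.mpr hκ), abs_of_pos (by positivity)] at hinv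
  have e2 : ∫ t : ℝ, Complex.exp (κ * (1 - Complex.I * t)) * (1 - Complex.I * t) ^ (-(a : ℂ)) =
      Real.exp κ * ∫ y, g y := by
    rw [← integral_neg_eq_self g, ← integral_const_mul]
    congr 1
    funext t
    rw [hg]
    simp only [Complex.ofReal_neg, mul_neg, ← sub_eq_add_neg, Complex.ofReal_exp]
    rw [← mul_assoc, ← Complex.exp_add]
    congr 2
    ring
  rw [e2]
  have hG : (Real.Gamma a : ℂ) ≠ 0 := by exact_mod_cast (Real.Gamma_pos_of_pos ha0).ne'
  have hpi : (Real.pi : ℂ) ≠ 0 := by exact_mod_cast Real.pi_ne_zero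
  have hexp : (Real.exp κ : ℂ) * Real.exp (-κ) = 1 := by
    rw [← Complex.ofReal_mul, ← Real.exp_add]; simp
  rw [Complex.real_smul] at hinv
  push_cast at hinv hexp ⊢
  field_simp at hinv ⊢
  linear_combination Complex.exp κ * hinv +
    (2 * (Real.pi : ℂ) * ((κ ^ (a - 1) : ℝ) : ℂ)) * hexp

theorem hasSum_complexSinc (z : ℂ) :
    HasSum (fun k : ℕ => (-1) ^ k * z ^ (2 * k) / ((2 * k + 1).factorial : ℂ)) (complexSinc z) := by
  by_cases hz : z = 0
  · subst hz
    have := hasSum_single (f := fun k : ℕ => (-1) ^ k * (0 : ℂ) ^ (2 * k) /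
      ((2 * k + 1).factorial : ℂ)) 0 (fun k hk => by simp [hk])
    simpa [complexSinc] using this
  · rw [complexSinc, if_neg hz]
    have e : (fun k : ℕ => (-1) ^ k * z ^ (2 * k) / ((2 * k + 1).factorial : ℂ)) =
        fun k : ℕ => (-1) ^ k * z ^ (2 * k + 1) / ((2 * k + 1).factorial : ℂ) / z := by
      funext k
      rw [pow_succ]
      field_simp
    rw [e]
    exact (Complex.hasSum_sin z).div_const z

/-- The limit kernel as an integral over a vertical line. -/
theorem integral_cexp_sub_div_mul_cpow {κ : ℝ} (hκ : 0 < κ) (η : ℂ) :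
    ∫ t : ℝ, Complex.exp (κ * (1 - Complex.I * t) - η ^ 2 / (1 - Complex.I * t)) *
      (1 - Complex.I * t) ^ (-(3 / 2) : ℂ) =
      ((2 * √Real.pi * (2 * √κ) : ℝ) : ℂ) * complexSinc (((2 * √κ : ℝ) : ℂ) * η) := by
  have hslit : ∀ t : ℝ, 1 - Complex.I * t ∈ Complex.slitPlane := fun t => by
    left; simp
  have hne : ∀ t : ℝ, 1 - Complex.I * t ≠ 0 := fun t => Complex.slitPlane_ne_zero (hslit t)
  have hnorm : ∀ t : ℝ, 1 ≤ ‖1 - Complex.I * t‖ := fun t => by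
    simpa using Complex.abs_re_le_norm (1 - Complex.I * t)
  -- The `k`-th term of the expansion of `exp (-η²/s)`, so the power of `s` becomes `-(k + 3/2)`.
  -- Since `|s| ≥ 1` on the line, the terms are dominated by the exponential series of `‖η‖²` times
  -- the integrable term `k = 0`.
  set F : ℕ → ℝ → ℂ := fun k t => ((-η ^ 2) ^ k / (k.factorial : ℂ)) *
    (Complex.exp (κ * (1 - Complex.I * t)) *
      (1 - Complex.I * t) ^ (-((k + 1 + 1 / 2 : ℝ) : ℂ))) with hF
  have hpow : ∀ (k : ℕ) (t : ℝ), (1 - Complex.I * t) ^ (-((k + 1 + 1 / 2 : ℝ) : ℂ)) =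
      (1 - Complex.I * t) ^ (-(3 / 2) : ℂ) / (1 - Complex.I * t) ^ k := by
    intro k t
    rw [← Complex.cpow_natCast, ← Complex.cpow_sub _ _ (hne t)]
    congr 1
    push_cast
    ring
  have hFe : ∀ k t, F k t = (Complex.exp (κ * (1 - Complex.I * t)) *
      (1 - Complex.I * t) ^ (-(3 / 2) : ℂ)) *
      ((-(η ^ 2 / (1 - Complex.I * t))) ^ k / (k.factorial : ℂ)) := by
    intro k t
    rw [hF]
    simp only [hpow]
    rw [← neg_div (1 - Complex.I * (t : ℂ)) (η ^ 2), div_pow]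
    ring
  have hk1 : ∀ k : ℕ, (1 : ℝ) < k + 1 + 1 / 2 := fun k => by
    have : (0 : ℝ) ≤ k := Nat.cast_nonneg k
    linarith
  have hFi : ∀ k, Integrable (F k) := fun k =>
    (integrable_cexp_mul_one_sub_I_mul_cpow (hk1 k) κ).const_mul _
  have hF0 : ∀ t, F 0 t = Complex.exp (κ * (1 - Complex.I * t)) *
      (1 - Complex.I * t) ^ (-(3 / 2) : ℂ) := fun t => by rw [hFe]; simp
  have hbound : ∀ k t, ‖F k t‖ ≤ (‖η‖ ^ 2) ^ k / (k.factorial : ℝ) * ‖F 0 t‖ := by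
    intro k t
    rw [hF0, hFe, norm_mul, mul_comm]
    gcongr
    rw [norm_div, norm_pow, norm_neg, norm_div, norm_pow, Complex.norm_natCast]
    gcongr
    exact div_le_self (by positivity) (hnorm t)
  have hsum : Summable fun k => ∫ t, ‖F k t‖ := by
    refine Summable.of_nonneg_of_le (fun k => integral_nonneg fun t => norm_nonneg _)
      (fun k => ?_) ((Real.summable_pow_div_factorial (‖η‖ ^ 2)).mul_right (∫ t, ‖F 0 t‖))
    rw [← integral_const_mul]
    exact integral_mono (hFi k).norm ((hFi 0).norm.const_mul _) (hbound k)
  have h1 := hasSum_integral_of_summable_integral_norm hFi hsum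
  have htsum : ∀ t, ∑' k, F k t =
      Complex.exp (κ * (1 - Complex.I * t) - η ^ 2 / (1 - Complex.I * t)) *
      (1 - Complex.I * t) ^ (-(3 / 2) : ℂ) := by
    intro t
    simp_rw [hFe]
    rw [tsum_mul_left, sub_eq_add_neg (κ * (1 - Complex.I * (t : ℂ))), Complex.exp_add,
      mul_right_comm]
    congr 2
    rw [Complex.exp_eq_exp_ℂ, NormedSpace.exp_eq_tsum_div]
  simp_rw [htsum] at h1
  have h2 := (hasSum_complexSinc (((2 * √κ : ℝ) : ℂ) * η)).mul_left
    ((2 * √Real.pi * (2 * √κ) : ℝ) : ℂ)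
  refine h1.unique ?_
  have e : (fun k => ∫ t, F k t) = fun k : ℕ => ((2 * √Real.pi * (2 * √κ) : ℝ) : ℂ) *
      ((-1) ^ k * (((2 * √κ : ℝ) : ℂ) * η) ^ (2 * k) / ((2 * k + 1).factorial : ℂ)) := by
    funext k
    rw [hF]
    simp only
    rw [integral_const_mul, integral_cexp_mul_one_sub_I_mul_cpow (hk1 k) hκ,
      Real.Gamma_nat_add_one_add_half]
    -- The duplication formula in factorial form: `k!` from the exponential and the double factorial
    -- from `Γ(k + 3/2)` combine into `(2k+1)!`, as in the series of `sin z / z`.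
    have hfac : ((2 * k + 1).factorial : ℝ) =
        ((2 * k + 1).doubleFactorial : ℝ) * (2 ^ k * k.factorial) := by
      rw [Nat.factorial_eq_mul_doubleFactorial, Nat.doubleFactorial_two_mul]
      push_cast
      ring
    have hd : ((2 * k + 1).doubleFactorial : ℝ) ≠ 0 := by
      exact_mod_cast (Nat.doubleFactorial_pos _).ne'
    have hk : (k.factorial : ℝ) ≠ 0 := by exact_mod_cast k.factorial_ne_zero
    have hκp : κ ^ ((k : ℝ) + 1 + 1 / 2 - 1) = κ ^ k * √κ := by
      rw [Real.sqrt_eq_rpow, ← Real.rpow_natCast, ← Real.rpow_add hκ]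
      congr 1; ring
    have hκs : √κ ^ (2 * k) = κ ^ k := by rw [pow_mul, Real.sq_sqrt hκ.le]
    have hpi : √Real.pi ≠ 0 := (Real.sqrt_pos.mpr Real.pi_pos).ne'
    have hpis : Real.pi = √Real.pi ^ 2 := (Real.sq_sqrt Real.pi_pos.le).symm
    have hreal : 2 * Real.pi * κ ^ ((k : ℝ) + 1 + 1 / 2 - 1) /
        ((2 * k + 1).doubleFactorial * √Real.pi / 2 ^ (k + 1)) / k.factorial =
        (2 * √Real.pi * (2 * √κ)) * ((2 * √κ) ^ (2 * k) / ((2 * k + 1).factorial : ℝ)) := by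
      rw [hκp, hfac, mul_pow, hκs]
      nth_rewrite 1 [hpis]
      field_simp
      ring
    calc (-η ^ 2) ^ k / (k.factorial : ℂ) * ((2 * Real.pi * κ ^ ((k : ℝ) + 1 + 1 / 2 - 1) /
          ((2 * k + 1).doubleFactorial * √Real.pi / 2 ^ (k + 1)) : ℝ) : ℂ)
        = (-1) ^ k * η ^ (2 * k) * ((2 * Real.pi * κ ^ ((k : ℝ) + 1 + 1 / 2 - 1) /
        ((2 * k + 1).doubleFactorial * √Real.pi / 2 ^ (k + 1)) / k.factorial : ℝ) : ℂ) := by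
          push_cast
          rw [neg_pow (η ^ 2), ← pow_mul]
          ring
      _ = _ := by
          rw [hreal]
          push_cast
          ring
  rw [← e] at h2
  exact h2

end LaplaceInversion

/-! ### Elementary estimates on circles. -/

section CircleEstimates

variable {r θ : ℝ}

theorem re_circleMap_zero (r θ : ℝ) : (circleMap 0 r θ).re = r * Real.cos θ := by
  simp [circleMap, Complex.exp_ofReal_mul_I_re]

theorem im_circleMap_zero (r θ : ℝ) : (circleMap 0 r θ).im = r * Real.sin θ := by
  simp [circleMap, Complex.exp_ofReal_mul_I_im]

/-- `|sin θ|` is the distance from `1` to the line through `0` in direction `θ`, hence a bound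
uniform in `r`. -/
theorem abs_sin_le_norm_one_sub_circleMap (r θ : ℝ) :
    |Real.sin θ| ≤ ‖1 - circleMap 0 r θ‖ := by
  rw [Complex.norm_eq_sqrt_sq_add_sq]
  apply Real.abs_le_sqrt
  simp only [Complex.sub_re, Complex.one_re, Complex.sub_im, Complex.one_im, re_circleMap_zero,
    im_circleMap_zero]
  nlinarith [Real.sin_sq_add_cos_sq θ, sq_nonneg (r - Real.cos θ)]

theorem abs_sin_le_norm_one_add_circleMap (r θ : ℝ) :
    |Real.sin θ| ≤ ‖1 + circleMap 0 r θ‖ := by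
  rw [Complex.norm_eq_sqrt_sq_add_sq]
  apply Real.abs_le_sqrt
  simp only [Complex.add_re, Complex.one_re, Complex.add_im, Complex.one_im, re_circleMap_zero,
    im_circleMap_zero]
  nlinarith [Real.sin_sq_add_cos_sq θ, sq_nonneg (r + Real.cos θ)]

theorem one_le_norm_one_add_circleMap (hr : 0 ≤ r) (hθ : 0 ≤ Real.cos θ) :
    1 ≤ ‖1 + circleMap 0 r θ‖ := by
  refine le_trans ?_ (Complex.re_le_norm _)
  simp only [Complex.add_re, Complex.one_re, re_circleMap_zero]
  nlinarith [mul_nonneg hr hθ]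

theorem one_le_norm_one_sub_circleMap (hr : 0 ≤ r) (hθ : Real.cos θ ≤ 0) :
    1 ≤ ‖1 - circleMap 0 r θ‖ := by
  refine le_trans ?_ (Complex.re_le_norm _)
  simp only [Complex.sub_re, Complex.one_re, re_circleMap_zero]
  nlinarith [mul_nonneg hr (neg_nonneg.mpr hθ)]

theorem one_sub_le_norm_one_sub_circleMap (hr : 0 ≤ r) (θ : ℝ) :
    1 - r ≤ ‖1 - circleMap 0 r θ‖ := by
  have := norm_sub_norm_le (1 : ℂ) (circleMap 0 r θ)
  simpa [abs_of_nonneg hr] using this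

theorem one_sub_le_norm_one_add_circleMap (hr : 0 ≤ r) (θ : ℝ) :
    1 - r ≤ ‖1 + circleMap 0 r θ‖ := by
  have := norm_sub_norm_le (1 : ℂ) (-circleMap 0 r θ)
  simpa [abs_of_nonneg hr] using this

/-- The Cayley transform maps the disc to the right half plane. This makes the estimates uniform in
the location `x`. -/
theorem re_one_sub_div_one_add_nonneg {z : ℂ} (hz : ‖z‖ < 1) : 0 ≤ ((1 - z) / (1 + z)).re := by
  rw [Complex.div_re, ← add_div]
  refine div_nonneg ?_ (Complex.normSq_nonneg _)
  have h : Complex.normSq z ≤ 1 := by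
    rw [Complex.normSq_eq_norm_sq]
    nlinarith [norm_nonneg z]
  rw [Complex.normSq_apply] at h
  simp only [Complex.sub_re, Complex.one_re, Complex.add_re, Complex.sub_im, Complex.one_im,
    Complex.add_im]
  nlinarith

/-- At radius `1 - 1/N` the factor `z^{-N}` stays bounded. -/
theorem inv_one_sub_inv_pow_le {N : ℕ} (hN : 2 ≤ N) :
    ((1 - 1 / (N : ℝ)) ^ N)⁻¹ ≤ Real.exp 2 := by
  have hN' : (2 : ℝ) ≤ N := by exact_mod_cast hN
  have h1 : (1 - 1 / (N : ℝ))⁻¹ ≤ Real.exp (2 / N) := by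
    refine le_trans ?_ (Real.add_one_le_exp _)
    have h2 : (0 : ℝ) < 1 - 1 / N := by
      rw [sub_pos, div_lt_one (by linarith)]; linarith
    rw [inv_le_iff_one_le_mul₀ h2]
    have : (2 / (N : ℝ) + 1) * (1 - 1 / N) = 1 + (1 / N) * (1 - 2 / N) := by
      field_simp; ring
    rw [this]
    have h3 : 0 ≤ 1 - 2 / (N : ℝ) := by
      rw [sub_nonneg, div_le_one (by linarith)]; exact hN'
    have h4 : 0 ≤ 1 / (N : ℝ) := by positivity
    nlinarith [mul_nonneg h4 h3]
  calc ((1 - 1 / (N : ℝ)) ^ N)⁻¹ = ((1 - 1 / (N : ℝ))⁻¹) ^ N := by rw [inv_pow]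
    _ ≤ (Real.exp (2 / N)) ^ N := by
        gcongr
        rw [inv_nonneg, sub_nonneg, div_le_one (by linarith)]; linarith
    _ = Real.exp 2 := by
        rw [← Real.exp_nat_mul]; congr 1; field_simp

end CircleEstimates

/-! ### The rescaled integrand and the half circle around `-1`. -/

/-- The integrand of the rescaled coefficient integral, as a function on the unit disc. -/
def coeffIntegrand (β η : ℂ) (x : ℝ) (N : ℕ) (z : ℂ) : ℂ :=
  Complex.exp (-((x : ℂ) ^ 2 / 2 * ((1 - z) / (1 + z))) - η ^ 2 / N * (z / (1 - z)) + β * z ^ 2) *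
    ((1 - z) ^ (-(3 / 2) : ℂ) * (1 + z) ^ (-(1 / 2) : ℂ)) * (z ^ N)⁻¹

theorem corrGenFun_eq_coeffIntegrand {β η : ℂ} {x : ℝ} {N : ℕ} (hN : N ≠ 0) {z : ℂ}
    (hz : ‖z‖ < 1) :
    ((Real.exp (-x ^ 2 / 2) : ℝ) : ℂ) * (corrGenFun β (x + η / ((√(N : ℝ) : ℝ) : ℂ))
      (x - η / ((√(N : ℝ) : ℝ) : ℂ)) z * (z ^ N)⁻¹) = coeffIntegrand β η x N z := by
  have h1 := one_sub_ne_zero_of_norm_lt_one hz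
  have h2 := one_add_ne_zero_of_norm_lt_one hz
  have h4 : 1 - z ^ 2 = (1 - z) * (1 + z) := by ring
  have hs : ((√(N : ℝ) : ℝ) : ℂ) ^ 2 = N := by
    rw [← Complex.ofReal_pow, Real.sq_sqrt (Nat.cast_nonneg N)]; simp
  have hs0 : ((√(N : ℝ) : ℝ) : ℂ) ≠ 0 := by
    intro h
    rw [h] at hs
    apply hN
    have : (N : ℂ) = 0 := by rw [← hs]; ring
    exact_mod_cast this
  have key : -((x : ℂ) ^ 2 / 2 * ((1 - z) / (1 + z))) - η ^ 2 / N * (z / (1 - z)) + β * z ^ 2 =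
      ((-x ^ 2 / 2 : ℝ) : ℂ) + ((x + η / ((√(N : ℝ) : ℝ) : ℂ)) * (x - η / ((√(N : ℝ) : ℝ) : ℂ)) *
        (z / (1 - z ^ 2)) - ((x + η / ((√(N : ℝ) : ℝ) : ℂ)) ^ 2 +
        (x - η / ((√(N : ℝ) : ℝ) : ℂ)) ^ 2) / 2 * (z ^ 2 / (1 - z ^ 2))) + β * z ^ 2 := by
    rw [h4, ← hs]
    generalize ((√(N : ℝ) : ℝ) : ℂ) = s at *
    push_cast
    field_simp
    ring
  rw [corrGenFun, coeffIntegrand, key, Complex.exp_add, Complex.exp_add, Complex.ofReal_exp]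
  ring

/-- The term with `x²` only decreases the modulus. Since `|1 - z| ≥ 1/N`, the quotient `z/(1-z)` is
at most `N`, which the factor `1/N` cancels. The summand `2` in the exponent bounds `|z|^{-N}`. -/
theorem norm_coeffIntegrand_le {β η : ℂ} {x : ℝ} {N : ℕ} (hN : 2 ≤ N) (θ : ℝ) :
    ‖coeffIntegrand β η x N (circleMap 0 (1 - 1 / N) θ)‖ ≤
      Real.exp (‖η‖ ^ 2 + ‖β‖ + 2) * (‖1 - circleMap 0 (1 - 1 / N) θ‖ ^ (-(3 / 2) : ℝ) *
        ‖1 + circleMap 0 (1 - 1 / N) θ‖ ^ (-(1 / 2) : ℝ)) := by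
  have hN' : (2 : ℝ) ≤ N := by exact_mod_cast hN
  have hr0 : (0 : ℝ) < 1 - 1 / N := by
    rw [sub_pos, div_lt_one (by linarith)]; linarith
  have hr1 : 1 - 1 / (N : ℝ) < 1 := by
    have : 0 < 1 / (N : ℝ) := by positivity
    linarith
  have hz := norm_circleMap_lt_one hr0 hr1 θ
  have hzn : ‖circleMap 0 (1 - 1 / (N : ℝ)) θ‖ = 1 - 1 / N := by
    rw [norm_circleMap_zero, abs_of_pos hr0]
  have h1N : 1 / (N : ℝ) ≤ ‖1 - circleMap 0 (1 - 1 / N) θ‖ := by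
    have := one_sub_le_norm_one_sub_circleMap hr0.le θ
    linarith
  set z := circleMap 0 (1 - 1 / (N : ℝ)) θ with hzdef
  have e1 : ((-(3 / 2) : ℝ) : ℂ) = -(3 / 2) := by push_cast; ring
  have e2 : ((-(1 / 2) : ℝ) : ℂ) = -(1 / 2) := by push_cast; ring
  have hm : ‖(1 - z) ^ (-(3 / 2) : ℂ) * (1 + z) ^ (-(1 / 2) : ℂ)‖ =
      ‖1 - z‖ ^ (-(3 / 2) : ℝ) * ‖1 + z‖ ^ (-(1 / 2) : ℝ) := by
    rw [norm_mul, ← e1, ← e2, Complex.norm_cpow_real, Complex.norm_cpow_real]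
  rw [coeffIntegrand, norm_mul, norm_mul, hm, norm_inv, norm_pow, hzn, Complex.norm_exp]
  have hp := inv_one_sub_inv_pow_le hN
  have hre : (-((x : ℂ) ^ 2 / 2 * ((1 - z) / (1 + z))) - η ^ 2 / N * (z / (1 - z)) +
      β * z ^ 2).re ≤ ‖η‖ ^ 2 + ‖β‖ := by
    rw [Complex.add_re, Complex.sub_re, Complex.neg_re]
    have a1 : 0 ≤ ((x : ℂ) ^ 2 / 2 * ((1 - z) / (1 + z))).re := by
      have : (x : ℂ) ^ 2 / 2 = ((x ^ 2 / 2 : ℝ) : ℂ) := by push_cast; ring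
      rw [this, Complex.re_ofReal_mul]
      exact mul_nonneg (by positivity) (re_one_sub_div_one_add_nonneg hz)
    have a2 : -(η ^ 2 / N * (z / (1 - z))).re ≤ ‖η‖ ^ 2 := by
      refine (neg_le_abs _).trans ((Complex.abs_re_le_norm _).trans ?_)
      rw [norm_mul, norm_div, norm_div, norm_pow, Complex.norm_natCast]
      have b : ‖z‖ / ‖1 - z‖ ≤ N := by
        rw [div_le_iff₀ (lt_of_lt_of_le (by positivity) h1N)]
        calc ‖z‖ ≤ 1 := hz.le
          _ = N * (1 / N) := by field_simp
          _ ≤ _ := by gcongr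
      calc ‖η‖ ^ 2 / N * (‖z‖ / ‖1 - z‖) ≤ ‖η‖ ^ 2 / N * N := by gcongr
        _ = _ := by field_simp
    have a3 : (β * z ^ 2).re ≤ ‖β‖ := by
      refine (Complex.re_le_norm _).trans ?_
      rw [norm_mul, norm_pow]
      exact mul_le_of_le_one_right (norm_nonneg _) (pow_le_one₀ (norm_nonneg _) hz.le)
    linarith
  calc _ ≤ Real.exp (‖η‖ ^ 2 + ‖β‖) * (‖1 - z‖ ^ (-(3 / 2) : ℝ) * ‖1 + z‖ ^ (-(1 / 2) : ℝ)) *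
        Real.exp 2 := by gcongr
    _ = _ := by rw [Real.exp_add _ 2]; ring

theorem continuous_coeffIntegrand_circleMap (β η : ℂ) (x : ℝ) {N : ℕ} (hN : 2 ≤ N) :
    Continuous fun θ => coeffIntegrand β η x N (circleMap 0 (1 - 1 / N) θ) := by
  have hN' : (2 : ℝ) ≤ N := by exact_mod_cast hN
  have hr0 : (0 : ℝ) < 1 - 1 / N := by
    rw [sub_pos, div_lt_one (by linarith)]; linarith
  have hr1 : 1 - 1 / (N : ℝ) < 1 := by
    have : 0 < 1 / (N : ℝ) := by positivity
    linarith
  have hz := norm_circleMap_lt_one hr0 hr1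
  have hcm := continuous_circleMap 0 (1 - 1 / (N : ℝ))
  have h0 := fun θ => circleMap_ne_zero_of_pos hr0 θ
  have h1 := fun θ => one_sub_ne_zero_of_norm_lt_one (hz θ)
  have h2 := fun θ => one_add_ne_zero_of_norm_lt_one (hz θ)
  have c1 : Continuous fun θ => (1 - circleMap 0 (1 - 1 / (N : ℝ)) θ) ^ (-(3 / 2) : ℂ) :=
    (continuous_const.sub hcm).cpow continuous_const fun θ =>
      one_sub_mem_slitPlane_of_norm_lt_one (hz θ)
  have c2 : Continuous fun θ => (1 + circleMap 0 (1 - 1 / (N : ℝ)) θ) ^ (-(1 / 2) : ℂ) :=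
    (continuous_const.add hcm).cpow continuous_const fun θ =>
      one_add_mem_slitPlane_of_norm_lt_one (hz θ)
  have c3 : Continuous fun θ => (circleMap 0 (1 - 1 / (N : ℝ)) θ ^ N)⁻¹ :=
    (hcm.pow N).inv₀ fun θ => pow_ne_zero N (h0 θ)
  have c4 : Continuous fun θ => (1 - circleMap 0 (1 - 1 / (N : ℝ)) θ) /
      (1 + circleMap 0 (1 - 1 / (N : ℝ)) θ) :=
    (continuous_const.sub hcm).div (continuous_const.add hcm) h2
  have c5 : Continuous fun θ => circleMap 0 (1 - 1 / (N : ℝ)) θ /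
      (1 - circleMap 0 (1 - 1 / (N : ℝ)) θ) :=
    hcm.div (continuous_const.sub hcm) h1
  unfold coeffIntegrand
  exact ((((continuous_const.mul c4).neg.sub (continuous_const.mul c5)).add
    (continuous_const.mul (hcm.pow 2))).cexp.mul (c1.mul c2)).mul c3

theorem sqrt_two_pi_div_le {N : ℕ} : √(2 * Real.pi / N) / (2 * Real.pi) ≤ 1 / √(N : ℝ) := by
  rw [Real.sqrt_div (by positivity), div_right_comm]
  gcongr
  rw [div_le_one (by positivity), Real.sqrt_le_left (by positivity)]
  nlinarith [Real.pi_gt_three]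

/-- The part of the circle that is bounded away from `1` does not contribute to the limit. -/
theorem tendsto_integral_coeffIntegrand_far (β η : ℂ) (x : ℕ → ℝ) :
    Tendsto (fun N : ℕ => ((√(2 * Real.pi / N) / (2 * Real.pi) : ℝ) : ℂ) *
      ∫ θ in (Real.pi / 2)..(3 * Real.pi / 2),
        coeffIntegrand β η (x N) N (circleMap 0 (1 - 1 / N) θ)) atTop (𝓝 0) := by
  set C := Real.exp (‖η‖ ^ 2 + ‖β‖ + 2) with hC
  have hle : Real.pi / 2 ≤ 3 * Real.pi / 2 := by linarith [Real.pi_pos]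
  have hcos : ∀ θ ∈ Set.uIoc (Real.pi / 2) (3 * Real.pi / 2), Real.cos θ ≤ 0 := by
    intro θ hθ
    rw [Set.uIoc_of_le hle] at hθ
    exact Real.cos_nonpos_of_pi_div_two_le_of_le hθ.1.le (by linarith [hθ.2])
  have hbase : ∀ N : ℕ, 2 ≤ N → ∀ θ ∈ Set.uIoc (Real.pi / 2) (3 * Real.pi / 2),
      ‖coeffIntegrand β η (x N) N (circleMap 0 (1 - 1 / N) θ)‖ ≤
        C * ‖1 + circleMap 0 (1 - 1 / N) θ‖ ^ (-(1 / 2) : ℝ) := by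
    intro N hN θ hθ
    have hN' : (2 : ℝ) ≤ N := by exact_mod_cast hN
    have hr0 : (0 : ℝ) ≤ 1 - 1 / N := by
      rw [sub_nonneg, div_le_one (by linarith)]; linarith
    refine (norm_coeffIntegrand_le hN θ).trans ?_
    gcongr
    refine mul_le_of_le_one_left (by positivity) ?_
    exact Real.rpow_le_one_of_one_le_of_nonpos
      (one_le_norm_one_sub_circleMap hr0 (hcos θ hθ)) (by norm_num)
  simp_rw [← intervalIntegral.integral_const_mul]
  suffices h : Tendsto (fun N : ℕ => ∫ θ in (Real.pi / 2)..(3 * Real.pi / 2),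
      ((√(2 * Real.pi / N) / (2 * Real.pi) : ℝ) : ℂ) *
        coeffIntegrand β η (x N) N (circleMap 0 (1 - 1 / N) θ)) atTop
      (𝓝 (∫ θ in (Real.pi / 2)..(3 * Real.pi / 2), (fun _ => (0 : ℂ)) θ)) by
    rwa [intervalIntegral.integral_zero] at h
  refine intervalIntegral.tendsto_integral_filter_of_dominated_convergence
    (F := fun (N : ℕ) (θ : ℝ) => ((√(2 * Real.pi / N) / (2 * Real.pi) : ℝ) : ℂ) *
      coeffIntegrand β η (x N) N (circleMap 0 (1 - 1 / N) θ)) (f := fun _ => (0 : ℂ))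
    (fun _ => C) ?_ ?_ intervalIntegrable_const ?_
  · filter_upwards [eventually_ge_atTop 2] with N hN
    exact (continuous_const.mul
      (continuous_coeffIntegrand_circleMap β η (x N) hN)).aestronglyMeasurable
  · filter_upwards [eventually_ge_atTop 2] with N hN
    refine ae_of_all _ fun θ hθ => ?_
    have hN' : (2 : ℝ) ≤ N := by exact_mod_cast hN
    have hr0 : (0 : ℝ) ≤ 1 - 1 / N := by
      rw [sub_nonneg, div_le_one (by linarith)]; linarith
    rw [norm_mul, Complex.norm_real, Real.norm_eq_abs, abs_of_nonneg (by positivity)]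
    -- Near `-1` the factor `|1+z|^{-1/2}` is at most `√N`, which the prefactor of order `1/√N`
    -- absorbs into a constant majorant.
    have h1 : 1 / (N : ℝ) ≤ ‖1 + circleMap 0 (1 - 1 / N) θ‖ := by
      have := one_sub_le_norm_one_add_circleMap hr0 θ
      linarith
    have h2 : ‖1 + circleMap 0 (1 - 1 / N) θ‖ ^ (-(1 / 2) : ℝ) ≤ √(N : ℝ) := by
      refine (Real.rpow_le_rpow_of_nonpos (by positivity) h1 (by norm_num)).trans ?_
      rw [one_div, Real.inv_rpow (by positivity), Real.rpow_neg (by positivity), inv_inv,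
        Real.sqrt_eq_rpow]
    calc _ ≤ 1 / √(N : ℝ) * (C * √(N : ℝ)) := by
          refine mul_le_mul sqrt_two_pi_div_le ((hbase N hN θ hθ).trans ?_) (norm_nonneg _)
            (by positivity)
          gcongr
      _ = C := by
          have : √(N : ℝ) ≠ 0 := (Real.sqrt_pos.mpr (by linarith)).ne'
          field_simp
  · have hae : ∀ᵐ θ : ℝ, θ ≠ Real.pi := by
      simp [ae_iff, measure_singleton]
    filter_upwards [hae] with θ hθπ hθ
    have hsin : Real.sin θ ≠ 0 := by
      rw [Set.uIoc_of_le hle] at hθ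
      intro h
      have h' : Real.sin (θ - Real.pi) = 0 := by rw [Real.sin_sub_pi, h, neg_zero]
      rw [Real.sin_eq_zero_iff_of_lt_of_lt (by linarith [hθ.1, Real.pi_pos])
        (by linarith [hθ.2, Real.pi_pos])] at h'
      exact hθπ (by linarith)
    have hlim : Tendsto (fun N : ℕ => 1 / √(N : ℝ) * (C * |Real.sin θ| ^ (-(1 / 2) : ℝ)))
        atTop (𝓝 0) := by
      have : Tendsto (fun N : ℕ => 1 / √(N : ℝ)) atTop (𝓝 0) := by
        simp_rw [one_div]
        exact (Real.tendsto_sqrt_atTop.comp tendsto_natCast_atTop_atTop).inv_tendsto_atTop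
      simpa using this.mul_const (C * |Real.sin θ| ^ (-(1 / 2) : ℝ))
    refine squeeze_zero_norm' ?_ hlim
    filter_upwards [eventually_ge_atTop 2] with N hN
    rw [norm_mul, Complex.norm_real, Real.norm_eq_abs, abs_of_nonneg (by positivity)]
    have h1 := Real.rpow_le_rpow_of_nonpos (abs_pos.mpr hsin)
      (abs_sin_le_norm_one_add_circleMap (1 - 1 / (N : ℝ)) θ) (by norm_num : -(1 / 2 : ℝ) ≤ 0)
    exact mul_le_mul sqrt_two_pi_div_le
      ((hbase N hN θ hθ).trans (mul_le_mul_of_nonneg_left h1 (Real.exp_pos _).le))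
      (norm_nonneg _) (by positivity)

theorem natCast_mul_cpow {N : ℕ} (hN : N ≠ 0) {w : ℂ} (hw : w ≠ 0) (a : ℂ) :
    ((N : ℂ) * w) ^ a = (N : ℂ) ^ a * w ^ a := by
  have hN' : (0 : ℝ) < N := by positivity
  have hc : (N : ℂ) = ((N : ℝ) : ℂ) := by simp
  have h0 : ((N : ℝ) : ℂ) ≠ 0 := by exact_mod_cast hN'.ne'
  rw [hc, Complex.cpow_def_of_ne_zero (mul_ne_zero h0 hw), Complex.cpow_def_of_ne_zero h0,
    Complex.cpow_def_of_ne_zero hw, Complex.log_ofReal_mul hN' hw, ← Complex.exp_add,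
    Complex.ofReal_log hN'.le]
  congr 1
  ring

theorem natCast_cpow_neg_three_halves {N : ℕ} (hN : N ≠ 0) :
    (N : ℂ) ^ (-(3 / 2) : ℂ) = ((1 / (N * √(N : ℝ)) : ℝ) : ℂ) := by
  have hN' : (0 : ℝ) < N := by positivity
  have e1 : (-(3 / 2) : ℂ) = ((-(1 + 1 / 2) : ℝ) : ℂ) := by push_cast; ring
  have hc : (N : ℂ) = ((N : ℝ) : ℂ) := by simp
  rw [e1, hc, ← Complex.ofReal_cpow hN'.le, Real.rpow_neg hN'.le, Real.rpow_add hN',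
    Real.rpow_one, ← Real.sqrt_eq_rpow, one_div]

/-! ### The scaling limit near `1`. -/

section NearOne

variable (t : ℝ)

theorem tendsto_circleMap_div_one :
    Tendsto (fun N : ℕ => circleMap 0 (1 - 1 / (N : ℝ)) (t / N)) atTop (𝓝 1) := by
  have h1 : Tendsto (fun N : ℕ => 1 / (N : ℝ)) atTop (𝓝 0) := tendsto_one_div_atTop_nhds_zero_nat
  have h2 : Tendsto (fun N : ℕ => t / (N : ℝ)) atTop (𝓝 0) :=
    tendsto_const_div_atTop_nhds_zero_nat t
  have h3 : Continuous fun p : ℝ × ℝ => circleMap 0 (1 - p.1) p.2 := by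
    unfold circleMap; fun_prop
  have := (h3.tendsto (0, 0)).comp (h1.prodMk_nhds h2)
  simpa [circleMap, Function.comp_def] using this

/-- With `u = 1/N` this is minus the one-sided difference quotient at `u = 0` of `(1 - u) e^{i t
u}`. -/
theorem tendsto_natCast_mul_one_sub_circleMap :
    Tendsto (fun N : ℕ => (N : ℂ) * (1 - circleMap 0 (1 - 1 / (N : ℝ)) (t / N))) atTop
      (𝓝 (1 - Complex.I * t)) := by
  have hd : HasDerivAt (fun u : ℝ => circleMap 0 (1 - u) (t * u)) (-1 + t * Complex.I) 0 := by
    have hid : HasDerivAt (fun u : ℝ => (u : ℂ)) 1 0 := Complex.ofRealCLM.hasDerivAt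
    have h1 : HasDerivAt (fun u : ℝ => ((1 - u : ℝ) : ℂ)) (-1) 0 := by
      simpa using hid.const_sub 1
    have h2 : HasDerivAt (fun u : ℝ => Complex.exp (((t * u : ℝ) : ℂ) * Complex.I))
        (t * Complex.I) 0 := by
      have := ((hid.const_mul (t : ℂ)).mul_const Complex.I).cexp
      simpa using this
    have := h1.fun_mul h2
    simpa [circleMap] using this
  have hs := hd.tendsto_slope_zero_right
  have hN : Tendsto (fun N : ℕ => ((N : ℝ))⁻¹) atTop (𝓝[>] 0) :=
    tendsto_inv_atTop_nhdsGT_zero.comp tendsto_natCast_atTop_atTop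
  have h := (hs.comp hN).neg
  have e : -(-1 + (t : ℂ) * Complex.I) = 1 - Complex.I * t := by ring
  rw [e] at h
  refine h.congr fun N => ?_
  simp [circleMap, div_eq_mul_inv]
  ring

theorem tendsto_inv_circleMap_pow :
    Tendsto (fun N : ℕ => (circleMap 0 (1 - 1 / (N : ℝ)) (t / N) ^ N)⁻¹) atTop
      (𝓝 (Complex.exp (1 - Complex.I * t))) := by
  have h := Real.tendsto_one_add_div_pow_exp (-1)
  have h1 : Tendsto (fun N : ℕ => (((1 + -1 / (N : ℝ)) ^ N : ℝ) : ℂ) * Complex.exp (t * Complex.I))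
      atTop (𝓝 (((Real.exp (-1) : ℝ) : ℂ) * Complex.exp (t * Complex.I))) :=
    ((Complex.continuous_ofReal.tendsto _).comp h).mul_const _
  have h2 := h1.inv₀ (by simp [Complex.exp_ne_zero])
  have e : (((Real.exp (-1) : ℝ) : ℂ) * Complex.exp (t * Complex.I))⁻¹ =
      Complex.exp (1 - Complex.I * t) := by
    rw [Complex.ofReal_exp, ← Complex.exp_add, ← Complex.exp_neg]
    congr 1; push_cast; ring
  rw [e] at h2
  refine h2.congr' ?_
  filter_upwards [eventually_ne_atTop 0] with N hN
  have hN' : (N : ℂ) ≠ 0 := by exact_mod_cast hN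
  congr 1
  rw [circleMap, zero_add, mul_pow, ← Complex.exp_nat_mul]
  congr 1
  · push_cast; congr 1; ring
  · congr 1; push_cast; field_simp

/-- A weighted combination of the radial bound `1/N` and the angular bound `|sin θ| ≥ (2/π)|θ|`. It
keeps the decay in `t` that a majorant integrable over the whole line requires. -/
theorem one_add_abs_div_le_norm_one_sub_circleMap {N : ℕ} (hN : 2 ≤ N)
    (ht : |t| ≤ Real.pi / 2 * N) :
    (1 + |t|) / (4 * N) ≤ ‖1 - circleMap 0 (1 - 1 / (N : ℝ)) (t / N)‖ := by
  have hN' : (2 : ℝ) ≤ N := by exact_mod_cast hN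
  have hr0 : (0 : ℝ) ≤ 1 - 1 / N := by
    rw [sub_nonneg, div_le_one (by linarith)]; linarith
  have h1 := one_sub_le_norm_one_sub_circleMap hr0 (t / N)
  have h2 := abs_sin_le_norm_one_sub_circleMap (1 - 1 / (N : ℝ)) (t / N)
  have h3 : |t / N| ≤ Real.pi / 2 := by
    rw [abs_div, Nat.abs_cast, div_le_iff₀ (by linarith)]; exact ht
  have h4 := Real.mul_abs_le_abs_sin h3
  rw [abs_div, Nat.abs_cast] at h4
  have h5 : 1 / 2 * (|t| / N) ≤ 2 / Real.pi * (|t| / N) := by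
    gcongr ?_ * _
    rw [div_le_div_iff₀ (by norm_num) Real.pi_pos]
    linarith [Real.pi_le_four]
  have e : (1 + |t|) / (4 * N) = (1 / N) / 4 + (1 / 2 * (|t| / N)) / 2 := by
    field_simp; ring
  rw [e]
  have h6 : 0 ≤ 1 / (N : ℝ) := by positivity
  linarith

end NearOne

/-- The integrand near `z = 1` in the variable `t = N θ`, with its prefactor. -/
def scaledIntegrand (β η : ℂ) (x : ℝ) (N : ℕ) (t : ℝ) : ℂ :=
  ((√(2 * Real.pi / N) / (2 * Real.pi) / N : ℝ) : ℂ) *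
    coeffIntegrand β η x N (circleMap 0 (1 - 1 / N) (t / N))

/-- The prefactor is at most `N^{-3/2}` and cancels the growth of `|1-z|^{-3/2}`; the constant `8`
is `4^{3/2}`. -/
theorem norm_scaledIntegrand_le {β η : ℂ} {x : ℝ} {N : ℕ} (hN : 2 ≤ N) {t : ℝ}
    (ht : |t| ≤ Real.pi / 2 * N) :
    ‖scaledIntegrand β η x N t‖ ≤
      Real.exp (‖η‖ ^ 2 + ‖β‖ + 2) * 8 * (1 + ‖t‖) ^ (-(3 / 2) : ℝ) := by
  have hN' : (2 : ℝ) ≤ N := by exact_mod_cast hN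
  have hN0 : (0 : ℝ) < N := by linarith
  have hr0 : (0 : ℝ) ≤ 1 - 1 / N := by
    rw [sub_nonneg, div_le_one (by linarith)]; linarith
  have hcos : 0 ≤ Real.cos (t / N) := by
    have h3 : |t / N| ≤ Real.pi / 2 := by
      rw [abs_div, Nat.abs_cast, div_le_iff₀ hN0]; exact ht
    exact Real.cos_nonneg_of_neg_pi_div_two_le_of_le (abs_le.mp h3).1 (abs_le.mp h3).2
  rw [scaledIntegrand, norm_mul, Complex.norm_real, Real.norm_eq_abs, abs_of_nonneg (by positivity)]
  have h1 : ‖1 - circleMap 0 (1 - 1 / (N : ℝ)) (t / N)‖ ^ (-(3 / 2) : ℝ) ≤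
      ((1 + |t|) / (4 * N)) ^ (-(3 / 2) : ℝ) :=
    Real.rpow_le_rpow_of_nonpos (by positivity)
      (one_add_abs_div_le_norm_one_sub_circleMap t hN ht) (by norm_num)
  have h2 : ‖1 + circleMap 0 (1 - 1 / (N : ℝ)) (t / N)‖ ^ (-(1 / 2) : ℝ) ≤ 1 :=
    Real.rpow_le_one_of_one_le_of_nonpos (one_le_norm_one_add_circleMap hr0 hcos) (by norm_num)
  have h3 : ((1 + |t|) / (4 * N)) ^ (-(3 / 2) : ℝ) =
      8 * (N * √(N : ℝ)) * (1 + |t|) ^ (-(3 / 2) : ℝ) := by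
    rw [Real.div_rpow (by positivity) (by positivity), Real.mul_rpow (by norm_num) hN0.le,
      Real.rpow_neg (by norm_num : (0 : ℝ) ≤ 4), Real.rpow_neg hN0.le, ← mul_inv, div_inv_eq_mul]
    have a1 : (4 : ℝ) ^ (3 / 2 : ℝ) = 8 := by
      rw [show (4 : ℝ) = 2 ^ (2 : ℝ) by norm_num, ← Real.rpow_mul (by norm_num)]; norm_num
    have a2 : (N : ℝ) ^ (3 / 2 : ℝ) = N * √(N : ℝ) := by
      rw [show (3 / 2 : ℝ) = 1 + 1 / 2 by norm_num, Real.rpow_add hN0, Real.rpow_one,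
        Real.sqrt_eq_rpow]
    rw [a1, a2]; ring
  have hs : √(N : ℝ) ≠ 0 := (Real.sqrt_pos.mpr hN0).ne'
  calc _ ≤ 1 / √(N : ℝ) / N * (Real.exp (‖η‖ ^ 2 + ‖β‖ + 2) *
        (8 * (N * √(N : ℝ)) * (1 + |t|) ^ (-(3 / 2) : ℝ) * 1)) := by
        refine mul_le_mul ?_ ((norm_coeffIntegrand_le hN _).trans ?_) (norm_nonneg _)
          (by positivity)
        · have := sqrt_two_pi_div_le (N := N)
          gcongr
        · rw [← h3]
          gcongr
    _ = _ := by
        rw [Real.norm_eq_abs]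
        field_simp

theorem tendsto_scaledIntegrand (β η : ℂ) {x : ℕ → ℝ} {ξ : ℝ}
    (hx : Tendsto (fun N : ℕ => x N ^ 2 / N) atTop (𝓝 (ξ ^ 2))) (t : ℝ) :
    Tendsto (fun N : ℕ => scaledIntegrand β η (x N) N t) atTop
      (𝓝 (((√(2 * Real.pi) : ℝ) : ℂ)⁻¹ * (2 : ℂ) ^ (-(1 / 2) : ℂ) * Complex.exp β *
        (Complex.exp (((1 - ξ ^ 2 / 4 : ℝ) : ℂ) * (1 - Complex.I * t) -
          η ^ 2 / (1 - Complex.I * t)) * (1 - Complex.I * t) ^ (-(3 / 2) : ℂ)))) := by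
  have hz := tendsto_circleMap_div_one t
  have hw := tendsto_natCast_mul_one_sub_circleMap t
  have hp := tendsto_inv_circleMap_pow t
  have hs : 1 - Complex.I * t ∈ Complex.slitPlane := by left; simp
  have hs0 := Complex.slitPlane_ne_zero hs
  have hx' : Tendsto (fun N : ℕ => ((x N ^ 2 / N : ℝ) : ℂ)) atTop (𝓝 ((ξ ^ 2 : ℝ) : ℂ)) :=
    (Complex.continuous_ofReal.tendsto _).comp hx
  have c1 := hw.cpow (tendsto_const_nhds (x := (-(3 / 2) : ℂ))) hs
  have c2 := (hz.const_add 1).cpow (tendsto_const_nhds (x := (-(1 / 2) : ℂ)))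
    (by left; simp : (1 + 1 : ℂ) ∈ Complex.slitPlane)
  have c3 := (((hx'.div_const 2).mul (hw.div (hz.const_add 1) (by norm_num))).neg.sub
    ((hz.div hw hs0).const_mul (η ^ 2))).add ((hz.pow 2).const_mul β)
  have h := (((c3.cexp.mul (c1.mul c2)).mul hp).const_mul (((√(2 * Real.pi) : ℝ) : ℂ)⁻¹))
  have e : ((√(2 * Real.pi) : ℝ) : ℂ)⁻¹ * (2 : ℂ) ^ (-(1 / 2) : ℂ) * Complex.exp β *
        (Complex.exp (((1 - ξ ^ 2 / 4 : ℝ) : ℂ) * (1 - Complex.I * t) -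
          η ^ 2 / (1 - Complex.I * t)) * (1 - Complex.I * t) ^ (-(3 / 2) : ℂ)) =
      ((√(2 * Real.pi) : ℝ) : ℂ)⁻¹ * (Complex.exp (-(((ξ ^ 2 : ℝ) : ℂ) / 2 *
        ((1 - Complex.I * t) / (1 + 1))) - η ^ 2 * (1 / (1 - Complex.I * t)) + β * 1 ^ 2) *
        ((1 - Complex.I * t) ^ (-(3 / 2) : ℂ) * (1 + 1) ^ (-(1 / 2) : ℂ)) *
        Complex.exp (1 - Complex.I * t)) := by
    have e1 : ((1 - ξ ^ 2 / 4 : ℝ) : ℂ) * (1 - Complex.I * t) - η ^ 2 / (1 - Complex.I * t) =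
        (-(((ξ ^ 2 : ℝ) : ℂ) / 2 * ((1 - Complex.I * t) / (1 + 1))) -
          η ^ 2 * (1 / (1 - Complex.I * t))) + (1 - Complex.I * t) := by
      push_cast; ring
    rw [e1, Complex.exp_add, Complex.exp_add _ (β * 1 ^ 2), one_add_one_eq_two, one_pow, mul_one]
    ring
  rw [e]
  refine h.congr' ?_
  filter_upwards [eventually_ge_atTop 2] with N hN
  have hN' : (2 : ℝ) ≤ N := by exact_mod_cast hN
  have hN0 : N ≠ 0 := by omega
  have hNc : (N : ℂ) ≠ 0 := by exact_mod_cast hN0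
  have hr0 : (0 : ℝ) < 1 - 1 / N := by
    rw [sub_pos, div_lt_one (by linarith)]; linarith
  have hr1 : 1 - 1 / (N : ℝ) < 1 := by
    have : 0 < 1 / (N : ℝ) := by positivity
    linarith
  have hz1 := norm_circleMap_lt_one hr0 hr1 (t / N)
  have n1 := one_sub_ne_zero_of_norm_lt_one hz1
  have n2 := one_add_ne_zero_of_norm_lt_one hz1
  -- The prefactor equals `(2π)^{-1/2} N^{-3/2}`; its power of `N` turns `(1-z)^{-3/2}` into
  -- `(N(1-z))^{-3/2}`, which converges.
  have hpre : √(2 * Real.pi / N) / (2 * Real.pi) / N =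
      (√(2 * Real.pi))⁻¹ * (1 / (N * √(N : ℝ))) := by
    have hsN : √(N : ℝ) ≠ 0 := (Real.sqrt_pos.mpr (by linarith)).ne'
    have hsp : √(2 * Real.pi) ≠ 0 := (Real.sqrt_pos.mpr (by positivity)).ne'
    have hsq : √(2 * Real.pi) ^ 2 = 2 * Real.pi := Real.sq_sqrt (by positivity)
    rw [Real.sqrt_div (by positivity)]
    nth_rewrite 2 [← hsq]
    field_simp
  rw [scaledIntegrand, coeffIntegrand, hpre, natCast_mul_cpow hN0 n1,
    natCast_cpow_neg_three_halves hN0]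
  simp only [Pi.div_apply]
  generalize circleMap 0 (1 - 1 / (N : ℝ)) (t / N) = z at *
  have e2 : -(((x N ^ 2 / N : ℝ) : ℂ) / 2 * (N * (1 - z) / (1 + z))) -
      η ^ 2 * (z / (N * (1 - z))) + β * z ^ 2 =
      -((x N : ℂ) ^ 2 / 2 * ((1 - z) / (1 + z))) - η ^ 2 / N * (z / (1 - z)) + β * z ^ 2 := by
    push_cast; field_simp
  rw [e2]
  push_cast
  ring

theorem tendsto_integral_coeffIntegrand_near (β η : ℂ) {x : ℕ → ℝ} {ξ : ℝ}
    (hξ : ξ ∈ Set.Ioo (-2 : ℝ) 2)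
    (hx : Tendsto (fun N : ℕ => x N ^ 2 / N) atTop (𝓝 (ξ ^ 2))) :
    Tendsto (fun N : ℕ => ((√(2 * Real.pi / N) / (2 * Real.pi) : ℝ) : ℂ) *
      ∫ θ in (-(Real.pi / 2))..(Real.pi / 2),
        coeffIntegrand β η (x N) N (circleMap 0 (1 - 1 / N) θ)) atTop
      (𝓝 (Complex.exp β * ((√(4 - ξ ^ 2) : ℝ) : ℂ) *
        complexSinc (((√(4 - ξ ^ 2) : ℝ) : ℂ) * η))) := by
  -- Here `|ξ| < 2` enters: Laplace inversion needs a positive `κ`, and `2√κ` is the `√(4 - ξ²)` of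
  -- the limit.
  have hκ : 0 < 1 - ξ ^ 2 / 4 := by nlinarith [hξ.1, hξ.2]
  have hw : 2 * √(1 - ξ ^ 2 / 4) = √(4 - ξ ^ 2) := by
    rw [show 4 - ξ ^ 2 = 2 ^ 2 * (1 - ξ ^ 2 / 4) by ring, Real.sqrt_mul (by norm_num),
      Real.sqrt_sq (by norm_num)]
  have hlim : Tendsto (fun N : ℕ => ∫ t : ℝ, (Set.Ioc (-(Real.pi / 2) * N)
      (Real.pi / 2 * N)).indicator (scaledIntegrand β η (x N) N) t) atTop
      (𝓝 (∫ t : ℝ, ((√(2 * Real.pi) : ℝ) : ℂ)⁻¹ * (2 : ℂ) ^ (-(1 / 2) : ℂ) * Complex.exp β *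
        (Complex.exp (((1 - ξ ^ 2 / 4 : ℝ) : ℂ) * (1 - Complex.I * t) -
          η ^ 2 / (1 - Complex.I * t)) * (1 - Complex.I * t) ^ (-(3 / 2) : ℂ)))) := by
    refine tendsto_integral_filter_of_dominated_convergence
      (fun t : ℝ => Real.exp (‖η‖ ^ 2 + ‖β‖ + 2) * 8 * (1 + ‖t‖) ^ (-(3 / 2) : ℝ)) ?_ ?_ ?_ ?_
    · filter_upwards [eventually_ge_atTop 2] with N hN
      have : Continuous (scaledIntegrand β η (x N) N) :=
        continuous_const.mul ((continuous_coeffIntegrand_circleMap β η (x N) hN).comp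
          (continuous_id.div_const _))
      exact this.aestronglyMeasurable.indicator measurableSet_Ioc
    · filter_upwards [eventually_ge_atTop 2] with N hN
      refine ae_of_all _ fun t => ?_
      by_cases ht : t ∈ Set.Ioc (-(Real.pi / 2) * N) (Real.pi / 2 * N)
      · rw [Set.indicator_of_mem ht]
        exact norm_scaledIntegrand_le hN (abs_le.mpr ⟨by linarith [ht.1], ht.2⟩)
      · rw [Set.indicator_of_notMem ht, norm_zero]
        positivity
    · exact (integrable_one_add_norm (by norm_num)).const_mul _
    -- The cutoff is eventually inactive: once `N ≥ |t|`, the point `t` lies in the interval because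
    -- `π/2 > 1`.
    · refine ae_of_all _ fun t => (tendsto_scaledIntegrand β η hx t).congr' ?_
      have hN := tendsto_natCast_atTop_atTop (R := ℝ)
      filter_upwards [hN.eventually_ge_atTop |t|, hN.eventually_gt_atTop 0] with N hN hN0
      rw [Set.indicator_of_mem]
      have h := abs_le.mp hN
      have hp : (N : ℝ) < Real.pi / 2 * N := by nlinarith [Real.pi_gt_three]
      exact ⟨by linarith, by linarith⟩
  rw [integral_const_mul, integral_cexp_sub_div_mul_cpow hκ, hw] at hlim
  have hconst : ((√(2 * Real.pi) : ℝ) : ℂ)⁻¹ * (2 : ℂ) ^ (-(1 / 2) : ℂ) *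
      ((2 * √Real.pi : ℝ) : ℂ) = 1 := by
    have e1 : (2 : ℂ) ^ (-(1 / 2) : ℂ) = (((√2)⁻¹ : ℝ) : ℂ) := by
      have a1 : (-(1 / 2) : ℂ) = ((-(1 / 2) : ℝ) : ℂ) := by push_cast; ring
      rw [a1, show (2 : ℂ) = ((2 : ℝ) : ℂ) by simp, ← Complex.ofReal_cpow (by norm_num),
        Real.rpow_neg (by norm_num), Real.sqrt_eq_rpow]
    rw [e1, ← Complex.ofReal_inv, ← Complex.ofReal_mul, ← Complex.ofReal_mul,
      Real.sqrt_mul (by norm_num)]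
    have h2 : √(2 : ℝ) * √2 = 2 := Real.mul_self_sqrt (by norm_num)
    have hp : √Real.pi ≠ 0 := (Real.sqrt_pos.mpr Real.pi_pos).ne'
    have hs : √(2 : ℝ) ≠ 0 := by positivity
    have h3 : (√2 * √Real.pi)⁻¹ * (√2)⁻¹ * (2 * √Real.pi) = 1 := by
      field_simp
      linarith
    rw [h3, Complex.ofReal_one]
  have hfinal : ((√(2 * Real.pi) : ℝ) : ℂ)⁻¹ * (2 : ℂ) ^ (-(1 / 2) : ℂ) * Complex.exp β *
      (((2 * √Real.pi * √(4 - ξ ^ 2) : ℝ) : ℂ) *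
        complexSinc (((√(4 - ξ ^ 2) : ℝ) : ℂ) * η)) =
      Complex.exp β * ((√(4 - ξ ^ 2) : ℝ) : ℂ) *
        complexSinc (((√(4 - ξ ^ 2) : ℝ) : ℂ) * η) := by
    rw [Complex.ofReal_mul (2 * √Real.pi)]
    linear_combination (Complex.exp β * ((√(4 - ξ ^ 2) : ℝ) : ℂ) *
        complexSinc (((√(4 - ξ ^ 2) : ℝ) : ℂ) * η)) * hconst
  rw [hfinal] at hlim
  refine hlim.congr' ?_
  filter_upwards [eventually_ge_atTop 2] with N hN
  have hN0 : (0 : ℝ) < N := by positivity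
  have hle : -(Real.pi / 2) * N ≤ Real.pi / 2 * N := by nlinarith [Real.pi_pos]
  have hsub := intervalIntegral.integral_comp_div (a := -(Real.pi / 2) * N) (b := Real.pi / 2 * N)
    (fun θ => coeffIntegrand β η (x N) N (circleMap 0 (1 - 1 / N) θ)) hN0.ne'
  rw [mul_div_cancel_right₀ _ hN0.ne', mul_div_cancel_right₀ _ hN0.ne'] at hsub
  rw [integral_indicator measurableSet_Ioc, ← intervalIntegral.integral_of_le hle]
  unfold scaledIntegrand
  rw [intervalIntegral.integral_const_mul, hsub, Complex.real_smul, ← mul_assoc,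
    ← Complex.ofReal_mul, div_mul_cancel₀ _ hN0.ne']

theorem IsWignerFamily.tendsto_corrFun {Ω : Type*} [MeasurableSpace Ω] {P : Measure Ω}
    [IsProbabilityMeasure P] {Q : Measure ℝ} [IsProbabilityMeasure Q]
    {d : ℕ → Ω → ℝ} {u v : ℕ → ℕ → Ω → ℝ} (hX : IsWignerFamily Q P d u v)
    (hmean : ∫ x, x ∂Q = 0) (hvar : ∫ x, x ^ 2 ∂Q = 1 / 2)
    (hfour : Integrable (fun x : ℝ => x ^ 4) Q) {x : ℕ → ℝ} {ξ : ℝ} (hξ : ξ ∈ Set.Ioo (-2 : ℝ) 2)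
    (hx : Tendsto (fun N : ℕ => x N ^ 2 / N) atTop (𝓝 (ξ ^ 2))) (η : ℂ) :
    Tendsto
      (fun N : ℕ =>
        ((√(2 * Real.pi / (N : ℝ)) * (1 / (N.factorial : ℝ)) *
            Real.exp (-(x N) ^ 2 / 2) : ℝ) : ℂ) *
          corrFun P d u v N
            ((x N : ℂ) + η / ((√(N : ℝ) : ℝ) : ℂ))
            ((x N : ℂ) - η / ((√(N : ℝ) : ℝ) : ℂ)))
      atTop
      (𝓝 (((Real.exp ((∫ x, x ^ 4 ∂Q) - 3 / 4) * √(4 - ξ ^ 2) : ℝ) : ℂ) *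
        complexSinc (((√(4 - ξ ^ 2) : ℝ) : ℂ) * η))) := by
  set β : ℂ := (((∫ x, x ^ 4 ∂Q) - 3 / 4 : ℝ) : ℂ) with hβ
  have h := (tendsto_integral_coeffIntegrand_near β η hξ hx).add
    (tendsto_integral_coeffIntegrand_far β η x)
  rw [add_zero] at h
  rw [Complex.ofReal_mul, Complex.ofReal_exp, ← hβ]
  refine h.congr' ?_
  filter_upwards [eventually_ge_atTop 2] with N hN
  have hN' : (2 : ℝ) ≤ N := by exact_mod_cast hN
  have hN0 : N ≠ 0 := by omega
  have hr0 : (0 : ℝ) < 1 - 1 / N := by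
    rw [sub_pos, div_lt_one (by linarith)]; linarith
  have hr1 : 1 - 1 / (N : ℝ) < 1 := by
    have : 0 < 1 / (N : ℝ) := by positivity
    linarith
  have hc := continuous_coeffIntegrand_circleMap β η (x N) hN
  rw [← mul_add, intervalIntegral.integral_add_adjacent_intervals (hc.intervalIntegrable _ _)
    (hc.intervalIntegrable _ _), hX.corrFun_eq_circleCoeff hmean hvar hfour hr0 hr1, ← hβ,
    circleCoeff]
  have hi : ∀ θ : ℝ, coeffIntegrand β η (x N) N (circleMap 0 (1 - 1 / N) θ) =
      ((Real.exp (-x N ^ 2 / 2) : ℝ) : ℂ) * (corrGenFun β (x N + η / ((√(N : ℝ) : ℝ) : ℂ))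
      (x N - η / ((√(N : ℝ) : ℝ) : ℂ)) (circleMap 0 (1 - 1 / N) θ) *
        (circleMap 0 (1 - 1 / N) θ ^ N)⁻¹) := fun θ =>
    (corrGenFun_eq_coeffIntegrand hN0 (norm_circleMap_lt_one hr0 hr1 θ)).symm
  simp_rw [hi]
  rw [intervalIntegral.integral_const_mul]
  have hfac : (N.factorial : ℂ) ≠ 0 := by exact_mod_cast N.factorial_ne_zero
  push_cast
  field_simp

end

theorem proposition3
    {Ω : Type*} [MeasurableSpace Ω] (P : Measure Ω) [IsProbabilityMeasure P]
    (Q : Measure ℝ) [IsProbabilityMeasure Q]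
    (hmean : ∫ x, x ∂Q = 0)
    (hvar : ∫ x, x ^ 2 ∂Q = 1 / 2)
    (hfour : Integrable (fun x : ℝ => x ^ 4) Q)
    (d : ℕ → Ω → ℝ) (u v : ℕ → ℕ → Ω → ℝ)
    (hX : IsWignerFamily Q P d u v)
    (ξN : ℕ → ℝ) (ξ : ℝ) (hξ : ξ ∈ Set.Ioo (-2 : ℝ) 2)
    (hlim : Tendsto (fun N : ℕ => ξN N / √(N : ℝ)) atTop (𝓝 ξ))
    (η : ℂ) :
    (∀ (N : ℕ) (μ ν : ℂ), Integrable (charPolyProd d u v N μ ν) P) ∧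
    Tendsto
      (fun N : ℕ =>
        ((√(2 * Real.pi / (N : ℝ)) * (1 / (N.factorial : ℝ)) *
            Real.exp (-(ξN N) ^ 2 / 2) : ℝ) : ℂ) *
          corrFun P d u v N
            ((ξN N : ℂ) + η / ((√(N : ℝ) : ℝ) : ℂ))
            ((ξN N : ℂ) - η / ((√(N : ℝ) : ℝ) : ℂ)))
      atTop
      (𝓝 (((Real.exp ((∫ x, x ^ 4 ∂Q) - 3 / 4) * √(4 - ξ ^ 2) : ℝ) : ℂ) *
        complexSinc (((√(4 - ξ ^ 2) : ℝ) : ℂ) * η))) := by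
  -- The location `ξN` enters the rescaled integrand only through its square, so convergence of `ξN²
  -- / N` to `ξ²` suffices.
  refine ⟨fun N μ ν => hX.integrable_det_mul_det hfour N μ ν,
    hX.tendsto_corrFun hmean hvar hfour hξ ((hlim.pow 2).congr fun N => ?_) η⟩
  rw [div_pow, Real.sq_sqrt (Nat.cast_nonneg N)]
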